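/- **Conventions.** Manifolds are smooth, finite-dimensional, Hausdorff and without boundary. A *singular semi-Riemannian manifold* $(M,g)$ is a manifold with a smooth symmetric $(0,2)$-tensor field $g=\langle\cdot,\cdot\rangle$, whose rank and signature may vary. Write $v^\flat=g(v,\cdot)$, let $T_p^\bullet M=\{v^\flat : v\in T_pM\}$ carry the inner product $\langle\langle u^\flat,v^\flat\rangle\rangle_\bullet=g(u,v)$, and let $\mathcal A^\bullet(M)$ be the set of smooth 1-forms $\omega$ with $\omega_p\in T^\bullet_pM$ for all $p$. The Koszul form is $$\mathcal K(X,Y,Z)=\tfrac12\{X\langle Y,Z\rangle+Y\langle Z,X\rangle-Z\langle X,Y\rangle-\langle X,[Y,Z]\rangle+\langle Y,[Z,X]\rangle+\langle Z,[X,Y]\rangle\},$$ and, for a vector field $P$, the semi-symmetric metric Koszul form is $\overline{\mathcal K}(X,Y,Z)=\mathcal K(X,Y,Z)+g(Y,P)g(X,Z)-g(X,Y)g(P,Z)$. Put $\nabla^\flat_XY=\mathcal K(X,Y,\cdot)$ and, if $\nabla^\flat_XY\in\mathcal A^\bullet(M)$ for all $X,Y$, put $(\nabla_X\omega)(Y)=X(\omega(Y))-\langle\langle\nabla^\flat_XY,\omega\rangle\rangle_\bullet$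 for $\omega\in\mathcal A^\bullet(M)$; this is taken on the (open dense) union of the regions of constant signature and extended by continuity to the rest of $M$ where possible. $(M,g)$ is *semi-regular* if $\nabla^\flat_XY\in\mathcal A^\bullet(M)$ and $\nabla_Z(\nabla^\flat_XY)$ extends to an element of $\mathcal A^\bullet(M)$ for all smooth vector fields $X,Y,Z$; then $$R(X,Y,Z,T)=(\nabla_X\nabla^\flat_YZ)(T)-(\nabla_Y\nabla^\flat_XZ)(T)-(\nabla^\flat_{[X,Y]}Z)(T).$$ Replacing $\mathcal K$ by $\overline{\mathcal K}$ throughout defines $\overline\nabla^\flat$, $\overline\nabla$, *semi-symmetric metric semi-regular* manifolds and $\overline R$. The Hessian of $f$ is $H^f(X,Y)=(\nabla_X df)(Y)$, and $g^*_B$ is the inner product of covectors of a nondegenerate metric $g_B$. **Theorem.** Let $(B,g_B)$ be a nondegenerate semi-Riemannian manifold, $(F,g_F)$ a semi-regular manifold and $f\in C^\infty(B)$ (zeros of $f$ are allowed). Then the warped product $B\times_fF=(B\times F,\ \pi_B^*g_B+(f\circ\pi_B)^2\pi_F^*g_F)$ is semi-regular. Let $P\in\Gamma(TF)$. Then $B\times_fF$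 is also semi-symmetric metric semi-regular with respect to (the lift of) $P$, and for all $X,Y,Z,T\in\Gamma(TB)$ and $U,V,W,Q\in\Gamma(TF)$, lifted to $B\times F$, its curvature $\overline R$ is given by: 1. $\overline R(X,Y,Z,T)=R_B(X,Y,Z,T)+f^2g_B(X,Z)g_F(P,P)g_B(Y,T)-f^2g_B(Y,Z)g_F(P,P)g_B(X,T)$. 2. $\overline R(X,Y,Z,Q)=-\overline R(Z,Q,X,Y)=-fX(f)g_B(Y,Z)g_F(P,Q)+fY(f)g_B(X,Z)g_F(P,Q)$. 3. $\overline R(X,Y,W,Q)=\overline R(W,Q,X,Y)=0$. 4. $\overline R(X,V,W,T)=-fH^f(X,T)g_F(V,W)-[\mathcal K_F(V,P,W)+f^2g_F(P,P)g_F(V,W)-f^2g_F(V,P)g_F(P,W)]\,f^2g_B(X,T)$. 5. $\overline R(U,V,Z,Q)=-\overline R(Z,Q,U,V)=f^3Z(f)[-g_F(P,U)g_F(Q,V)+g_F(P,V)g_F(Q,U)]$. 6. $\overline R(U,V,W,Q)=f^2R_F(U,V,W,Q)+f^2g_B^*(df,df)[g_F(U,W)g_F(V,Q)-g_F(V,W)g_F(U,Q)]$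 $-f^6g_F(V,P)g_F(U,W)g_F(P,Q)+f^6g_F(U,P)g_F(V,W)g_F(P,Q)$ $+f^4\mathcal K_F(U,P,W)g_F(V,Q)-f^4\mathcal K_F(V,P,W)g_F(U,Q)-f^4\mathcal K_F(U,P,Q)g_F(V,W)+f^4\mathcal K_F(V,P,Q)g_F(U,W)$ $+f^6g_F(P,P)g_F(U,W)g_F(V,Q)-f^6g_F(U,P)g_F(P,W)g_F(V,Q)$ $-f^6g_F(P,P)g_F(V,W)g_F(U,Q)+f^6g_F(V,P)g_F(P,W)g_F(U,Q)$. Here $R_B$, $H^f$, $g_B^*$ belong to $(B,g_B)$ and $R_F$, $\mathcal K_F$ to $(F,g_F)$. -/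

import Mathlib

open scoped Manifold ContDiff Topology

noncomputable section

namespace SingularGeometry

section Basic

variable {E : Type*} [NormedAddCommGroup E] [NormedSpace ℝ E]
  {H : Type*} [TopologicalSpace H] (I : ModelWithCorners ℝ E H)
  {M : Type*} [TopologicalSpace M] [ChartedSpace H M]

/-- (Not necessarily smooth) vector fields on `M`. -/
abbrev VField (M : Type*) [TopologicalSpace M] [ChartedSpace H M] : Type _ :=
  Π p : M, TangentSpace I p

/-- (Not necessarily smooth) fields of bilinear forms on the tangent spaces of `M`. -/
abbrev BilinField (M : Type*) [TopologicalSpace M] [ChartedSpace H M] : Type _ :=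
  Π p : M, TangentSpace I p →L[ℝ] TangentSpace I p →L[ℝ] ℝ

/-- A 1-form, seen as a map from vector fields to functions. Only its values on smooth
vector fields matter. -/
abbrev FormMap (M : Type*) [TopologicalSpace M] [ChartedSpace H M] : Type _ :=
  VField I M → M → ℝ

variable {I}

/-- `h ∈ C^∞(M)`. -/
def SmoothFun (I : ModelWithCorners ℝ E H) (h : M → ℝ) : Prop :=
  ContMDiff I 𝓘(ℝ, ℝ) ∞ h

/-- `X ∈ Γ(TM)`. -/
def SmoothVF [IsManifold I ∞ M] (X : VField I M) : Prop :=
  ContMDiff I I.tangent ∞ (fun p => (⟨p, X p⟩ : TangentBundle I M))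

/-- The function `X(h)`. -/
def dir (X : VField I M) (h : M → ℝ) : M → ℝ :=
  fun p => (mfderiv I 𝓘(ℝ, ℝ) h p (X p) : ℝ)

/-- The function `g(X, Y)`. -/
def pair (g : BilinField I M) (X Y : VField I M) : M → ℝ :=
  fun p => g p (X p) (Y p)

/-- `g` is a singular semi-Riemannian metric: a smooth symmetric `(0,2)`-tensor field, with
no condition on its rank or signature. -/
structure IsSingularMetric [IsManifold I ∞ M] (g : BilinField I M) : Prop where
  symm : ∀ (p : M) (v w : TangentSpace I p), g p v w = g p w v
  smooth : ContMDiff I (I.prod 𝓘(ℝ, E →L[ℝ] E →L[ℝ] ℝ)) ∞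
    (fun p => Bundle.TotalSpace.mk' (E →L[ℝ] E →L[ℝ] ℝ)
      (E := fun p : M => TangentSpace I p →L[ℝ] TangentSpace I p →L[ℝ] ℝ) p (g p))

/-- `g` is nondegenerate at every point. -/
def IsNondegenerate (g : BilinField I M) : Prop :=
  ∀ (p : M) (v : TangentSpace I p), (∀ w : TangentSpace I p, g p v w = 0) → v = 0

/-- The quadratic form `v ↦ g(v, v)` on the tangent space at `p`. -/
def quadAt (g : BilinField I M) (p : M) : QuadraticForm ℝ (TangentSpace I p) :=
  LinearMap.BilinMap.toQuadraticMap (ContinuousLinearMap.toLinearMap₁₂ (g p))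

/-- The signature of `g` at `p`: the positive and the negative index of inertia (their sum
determines the dimension of the radical). -/
def signature (g : BilinField I M) (p : M) : ℕ × ℕ :=
  (sigPos (quadAt g p), sigNeg (quadAt g p))

/-- The union of the (open) regions of constant signature; it is open and dense in `M`. -/
def constSig (g : BilinField I M) : Set M :=
  {p | ∀ᶠ q in 𝓝 p, signature g q = signature g p}

/-- The 1-form `df`. -/
def differential (f : M → ℝ) : FormMap I M := fun X => dir X f

/-- `α ∈ A¹(M)`: a `C^∞(M)`-linear map from `Γ(TM)` to `C^∞(M)`. -/
structure IsOneForm [IsManifold I ∞ M] (α : FormMap I M) : Prop where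
  smooth : ∀ X, SmoothVF X → SmoothFun I (α X)
  add : ∀ X Y, SmoothVF X → SmoothVF Y → α (X + Y) = α X + α Y
  smul : ∀ (h : M → ℝ) (X : VField I M), SmoothFun I h → SmoothVF X →
    α (fun p => h p • X p) = h * α X

/-- The covector `α_p` is `v^♭ = g_p(v, ·)`. -/
def IsFlatOfAt [IsManifold I ∞ M] (g : BilinField I M) (α : FormMap I M) (p : M)
    (v : TangentSpace I p) : Prop :=
  ∀ Z, SmoothVF Z → α Z p = g p v (Z p)

/-- `α ∈ A^•(M)`: `α` is a smooth 1-form and every `α_p` belongs to the image `T_p^•M` of the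
map `v ↦ v^♭`. -/
structure IsRadAnn [IsManifold I ∞ M] (g : BilinField I M) (α : FormMap I M) : Prop where
  oneForm : IsOneForm α
  flat : ∀ p, ∃ v : TangentSpace I p, IsFlatOfAt g α p v

open Classical in
/-- The inner product `⟨⟨α, γ⟩⟩_•` at `p`, that is `g_p(u, v)` if `α_p = u^♭` and `γ_p = v^♭`
(independent of the choice of `u` and `v`); the value is `0` if `α_p` or `γ_p` is not of this
form. For a nondegenerate metric this is the inner product `g^*` of covectors. -/
def coInner [IsManifold I ∞ M] (g : BilinField I M) (α γ : FormMap I M) (p : M) : ℝ :=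
  if h : ∃ uv : TangentSpace I p × TangentSpace I p,
      IsFlatOfAt g α p uv.1 ∧ IsFlatOfAt g γ p uv.2
  then g p h.choose.1 h.choose.2 else 0

/-- The Koszul form of `g`. The 1-form `koszul g X Y` is the lower covariant derivative
`∇^♭_X Y`. -/
def koszul (g : BilinField I M) (X Y : VField I M) : FormMap I M := fun Z p =>
  (1 / 2 : ℝ) * (dir X (pair g Y Z) p + dir Y (pair g Z X) p - dir Z (pair g X Y) p
    - pair g X (VectorField.mlieBracket I Y Z) p
    + pair g Y (VectorField.mlieBracket I Z X) p
    + pair g Z (VectorField.mlieBracket I X Y) p)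

/-- The semi-symmetric metric Koszul form of `g` with respect to `P`. The 1-form
`koszulSS g P X Y` is the semi-symmetric metric lower covariant derivative of `Y` in the
direction of `X`. -/
def koszulSS (g : BilinField I M) (P X Y : VField I M) : FormMap I M := fun Z p =>
  koszul g X Y Z p + pair g Y P p * pair g X Z p - pair g X Y p * pair g P Z p

/-! In the following definitions `K` is one of the two Koszul forms `koszul g`,
`koszulSS g P`. -/

/-- The covariant derivative `(∇_X α)(Y) = X(α(Y)) - ⟨⟨∇^♭_X Y, α⟩⟩_•`, to be used on
the regions of constant signature. -/
def covDerivConst [IsManifold I ∞ M] (g : BilinField I M)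
    (K : VField I M → VField I M → FormMap I M) (X : VField I M) (α : FormMap I M) :
    FormMap I M :=
  fun Y p => dir X (α Y) p - coInner g (K X Y) α p

/-- The covariant derivative `(∇_X α)(Y)` on `M`: the continuous extension from the regions of
constant signature to the points at which the signature changes. -/
def covDeriv [IsManifold I ∞ M] (g : BilinField I M)
    (K : VField I M → VField I M → FormMap I M) (X : VField I M) (α : FormMap I M) :
    FormMap I M :=
  fun Y => extendFrom (constSig g) (covDerivConst g K X α Y)

/-- `(M, g)` is a semi-regular manifold with respect to `K`: for all `X, Y, Z ∈ Γ(TM)`,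
`∇^♭_X Y ∈ A^•(M)`, and `∇_Z (∇^♭_X Y)`, which is defined on the regions of constant
signature, is the restriction of an element of `A^•(M)`. -/
structure IsSemiRegularFor [IsManifold I ∞ M] (g : BilinField I M)
    (K : VField I M → VField I M → FormMap I M) : Prop where
  metric : IsSingularMetric g
  radicalStationary : ∀ X Y, SmoothVF X → SmoothVF Y → IsRadAnn g (K X Y)
  covDeriv_radAnn : ∀ X Y Z, SmoothVF X → SmoothVF Y → SmoothVF Z →
    ∃ η : FormMap I M, IsRadAnn g η ∧
      ∀ T, SmoothVF T → ∀ p ∈ constSig g, η T p = covDerivConst g K Z (K X Y) T p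

/-- Semi-regular semi-Riemannian manifolds. -/
def IsSemiRegular [IsManifold I ∞ M] (g : BilinField I M) : Prop :=
  IsSemiRegularFor g (koszul g)

/-- Semi-symmetric metric semi-regular semi-Riemannian manifolds, with respect to `P`. -/
def IsSemiRegularSS [IsManifold I ∞ M] (g : BilinField I M) (P : VField I M) : Prop :=
  IsSemiRegularFor g (koszulSS g P)

/-- `R(X,Y,Z,T) = (∇_X ∇^♭_Y Z)(T) - (∇_Y ∇^♭_X Z)(T) - (∇^♭_{[X,Y]} Z)(T)`. -/
def curvatureFor [IsManifold I ∞ M] (g : BilinField I M)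
    (K : VField I M → VField I M → FormMap I M) (X Y Z T : VField I M) (p : M) : ℝ :=
  covDeriv g K X (K Y Z) T p - covDeriv g K Y (K X Z) T p
    - K (VectorField.mlieBracket I X Y) Z T p

/-- The Riemann curvature tensor of `g`. -/
def curvature [IsManifold I ∞ M] (g : BilinField I M) (X Y Z T : VField I M) (p : M) : ℝ :=
  curvatureFor g (koszul g) X Y Z T p

/-- The Riemann curvature tensor of the semi-symmetric metric covariant derivative. -/
def curvatureSS [IsManifold I ∞ M] (g : BilinField I M) (P X Y Z T : VField I M) (p : M) : ℝ :=
  curvatureFor g (koszulSS g P) X Y Z T p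

/-- The Hessian `H^f(X, Y) = (∇_X df)(Y)`. -/
def hessian [IsManifold I ∞ M] (g : BilinField I M) (f : M → ℝ) (X Y : VField I M) (p : M) :
    ℝ :=
  covDeriv g (koszul g) X (differential f) Y p

end Basic

/-- The pullback `(v, w) ↦ β(A v, A w)` of a bilinear form along a linear map. -/
def pullbackForm {V W : Type*} [AddCommGroup V] [Module ℝ V] [TopologicalSpace V]
    [IsTopologicalAddGroup V] [ContinuousSMul ℝ V]
    [AddCommGroup W] [Module ℝ W] [TopologicalSpace W]
    [IsTopologicalAddGroup W] [ContinuousSMul ℝ W]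
    (A : V →L[ℝ] W) (β : W →L[ℝ] W →L[ℝ] ℝ) : V →L[ℝ] V →L[ℝ] ℝ :=
  (A.precomp ℝ).comp (β.comp A)

section Warped

variable {EB : Type*} [NormedAddCommGroup EB] [NormedSpace ℝ EB]
  {HB : Type*} [TopologicalSpace HB] {IB : ModelWithCorners ℝ EB HB}
  {B : Type*} [TopologicalSpace B] [ChartedSpace HB B]
  {EF : Type*} [NormedAddCommGroup EF] [NormedSpace ℝ EF]
  {HF : Type*} [TopologicalSpace HF] {IF : ModelWithCorners ℝ EF HF}
  {F : Type*} [TopologicalSpace F] [ChartedSpace HF F]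

/-- The metric `π_B^* g_B + (f ∘ π_B)² π_F^* g_F` on `B × F`. -/
def warped (gB : BilinField IB B) (gF : BilinField IF F) (f : B → ℝ) :
    BilinField (IB.prod IF) (B × F) := fun p =>
  pullbackForm (mfderiv (IB.prod IF) IB Prod.fst p) (gB p.1)
    + f p.1 ^ 2 • pullbackForm (mfderiv (IB.prod IF) IF Prod.snd p) (gF p.2)

/-- The lift to `B × F` of a vector field on `B`. -/
def liftB (F : Type*) [TopologicalSpace F] [ChartedSpace HF F] (X : VField IB B) :
    VField (IB.prod IF) (B × F) :=
  fun p => ((X p.1, 0) : TangentSpace IB p.1 × TangentSpace IF p.2)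

/-- The lift to `B × F` of a vector field on `F`. -/
def liftF (B : Type*) [TopologicalSpace B] [ChartedSpace HB B] (U : VField IF F) :
    VField (IB.prod IF) (B × F) :=
  fun p => ((0, U p.2) : TangentSpace IB p.1 × TangentSpace IF p.2)

/-- The curvature of the semi-symmetric metric covariant derivative of the warped product
`B ×_f F`, with respect to the lift of a vector field `P` on `F`. -/
def warpedCurvatureSS [IsManifold IB ∞ B] [IsManifold IF ∞ F]
    (gB : BilinField IB B) (gF : BilinField IF F) (f : B → ℝ) (P : VField IF F)
    (X₁ X₂ X₃ X₄ : VField (IB.prod IF) (B × F)) (p : B × F) : ℝ :=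
  curvatureSS (warped gB gF f) (liftF B P) X₁ X₂ X₃ X₄ p

end Warped

end SingularGeometry

end

noncomputable section

set_option linter.unusedSectionVars false

namespace SingularGeometry

/-! ### Functions, vector fields and Lie brackets on one manifold. -/

section Calculus

variable {E : Type*} [NormedAddCommGroup E] [NormedSpace ℝ E]
  {H : Type*} [TopologicalSpace H] {I : ModelWithCorners ℝ E H}
  {M : Type*} [TopologicalSpace M] [ChartedSpace H M]

/-! ### Smooth functions -/

/-! Everything is carried by two kinds of 1-forms on B × F: the pullbacks π_B^*β (`pullB`) and the
products f π_F^*γ with γ ∈ A^•(F) (`pullF`). If γ_q = w^♭, then f π_F^*γ is the flat of the lift of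
f⁻¹w where f ≠ 0 and vanishes where f = 0, so a single factor f keeps it in A^• across the zeros of
f. Brackets of lifts are lifts or zero, and the Koszul form on lifts is K(X,Y,·) = π_B^*K_B(X,Y,·),
K(X,V,·) = K(V,X,·) = X(f) · f π_F^*V^♭, K(U,V,·) = -f g_F(U,V) π_B^*df + f · f π_F^*K_F(U,V,·).
Four rules (`isCov_liftB_pullB`, `isCov_liftF_pullB`, `isCov_liftB_pullF`, `isCov_liftF_pullF`)
differentiate the building blocks: ∇_Z π_B^*β = π_B^*∇_Zβ, ∇_U π_B^*β = g_B^*(df,β) · f π_F^*U^♭,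
∇_Z(f π_F^*γ) = 0, ∇_U(f π_F^*γ) = -γ(U) π_B^*df + f π_F^*∇_Uγ. No right-hand side divides by f, so
the derivatives are again in A^•; this is semi-regularity on lifts, and `isSemiRegular_of_frames`
passes from lifts of local frames to all vector fields.

The delicate point is that the rules must hold on the regions of constant signature of the warped
metric, which may contain zeros of f, and there the inner product of two forms f π_F^*γ is 0 instead
of ⟨⟨γ,γ'⟩⟩. The rank of the warped metric is dim B + rank g_F where f ≠ 0 and dim B where f = 0. So
at a zero of f inside such a region either f vanishes nearby and df = 0, or g_F = 0 at the point and
every γ ∈ A^•(F) vanishes there; in both cases Z(f)γ(V) = 0, which is what the rules need. Where f ≠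
0, the F-component lies in a region of constant signature of g_F. Both indices of inertia are lower
semicontinuous, so control of the rank is control of the signature, and the regions are dense, so
the extended derivatives are unique.

The semi-symmetric part is general: the new Koszul form differs from K by g(Y,P)X^♭ - g(X,Y)P^♭.
Hence semi-regular metrics are semi-symmetric metric semi-regular for every smooth P, and
`IsSemiRegular.curvatureSS_eq` writes the new curvature through R, K(·,P,·) and g. Inserting the
values of these on lifts gives the six formulas. -/

theorem SmoothFun.add {h k : M → ℝ} (hh : SmoothFun I h) (hk : SmoothFun I k) :
    SmoothFun I (h + k) := ContMDiff.add hh hk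

theorem SmoothFun.sub {h k : M → ℝ} (hh : SmoothFun I h) (hk : SmoothFun I k) :
    SmoothFun I (h - k) := ContMDiff.sub hh hk

theorem SmoothFun.mul {h k : M → ℝ} (hh : SmoothFun I h) (hk : SmoothFun I k) :
    SmoothFun I (h * k) := ContMDiff.mul hh hk

theorem SmoothFun.neg {h : M → ℝ} (hh : SmoothFun I h) : SmoothFun I (-h) := ContMDiff.neg hh

theorem smoothFun_const (c : ℝ) : SmoothFun I (fun _ : M => c) := contMDiff_const

theorem SmoothFun.sum {ι : Type*} {s : Finset ι} {h : ι → M → ℝ}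
    (hh : ∀ i ∈ s, SmoothFun I (h i)) : SmoothFun I (∑ i ∈ s, h i) := by
  have := ContMDiff.sum (I' := I) (n := ∞) (t := s) (f := h) hh
  simpa [SmoothFun, Finset.sum_fn] using this

theorem SmoothFun.mdifferentiableAt {h : M → ℝ} (hh : SmoothFun I h) (p : M) :
    MDifferentiableAt I 𝓘(ℝ, ℝ) h p := ContMDiff.mdifferentiableAt hh (by simp)

theorem SmoothFun.congr_local {h : M → ℝ}
    (hh : ∀ p, ∃ k, SmoothFun I k ∧ h =ᶠ[𝓝 p] k) : SmoothFun I h := by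
  intro p
  obtain ⟨k, hk, e⟩ := hh p
  exact (hk p).congr_of_eventuallyEq e

/-! ### Directional derivatives -/

theorem dir_congr {X Y : VField I M} {h k : M → ℝ} {p : M} (hX : X p = Y p)
    (hh : h =ᶠ[𝓝 p] k) : dir X h p = dir Y k p := by
  simp only [dir, hX, hh.mfderiv_eq]
  rfl

theorem dir_add_vf (X Y : VField I M) (h : M → ℝ) (p : M) :
    dir (X + Y) h p = dir X h p + dir Y h p :=
  map_add (mfderiv I 𝓘(ℝ, ℝ) h p) (X p) (Y p)

theorem dir_smul_vf (a : M → ℝ) (X : VField I M) (h : M → ℝ) (p : M) :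
    dir (fun p => a p • X p) h p = a p * dir X h p :=
  map_smul (mfderiv I 𝓘(ℝ, ℝ) h p) (a p) (X p)

theorem dir_zero_vf (h : M → ℝ) (p : M) : dir (0 : VField I M) h p = 0 :=
  map_zero (mfderiv I 𝓘(ℝ, ℝ) h p)

theorem dir_of_eq_zero {X : VField I M} (h : M → ℝ) {p : M} (hX : X p = 0) : dir X h p = 0 := by
  rw [dir, hX]; exact map_zero (mfderiv I 𝓘(ℝ, ℝ) h p)

theorem dir_add {X : VField I M} {h k : M → ℝ} (hh : SmoothFun I h) (hk : SmoothFun I k) (p : M) :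
    dir X (h + k) p = dir X h p + dir X k p := by
  have := mfderiv_add (hh.mdifferentiableAt p) (hk.mdifferentiableAt p)
  simp only [dir]; rw [this]; rfl

theorem dir_neg {X : VField I M} (h : M → ℝ) (p : M) : dir X (-h) p = -dir X h p := by
  have := mfderiv_neg (I := I) (f := h) (x := p)
  simp only [dir]; rw [this]; rfl

theorem dir_mul {X : VField I M} {h k : M → ℝ} (hh : SmoothFun I h) (hk : SmoothFun I k) (p : M) :
    dir X (h * k) p = dir X h p * k p + h p * dir X k p := by
  have := ((hh.mdifferentiableAt p).hasMFDerivAt.mul (hk.mdifferentiableAt p).hasMFDerivAt).mfderiv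
  simp only [dir]
  rw [this]
  change h p * dir X k p + k p * dir X h p = dir X h p * k p + h p * dir X k p
  ring

theorem dir_const (X : VField I M) (c : ℝ) (p : M) : dir X (fun _ : M => c) p = 0 := by
  simp only [dir]
  rw [mfderiv_const]; rfl

theorem bracket_congr {X X' Y Y' : VField I M} {p : M} (hX : X =ᶠ[𝓝 p] X') (hY : Y =ᶠ[𝓝 p] Y') :
    VectorField.mlieBracket I X Y p = VectorField.mlieBracket I X' Y' p :=
  Filter.EventuallyEq.mlieBracket_vectorField_eq hX hY

variable [IsManifold I ∞ M]

/-! ### Smooth vector fields -/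

theorem SmoothVF.mdifferentiableAt {X : VField I M} (hX : SmoothVF X) (p : M) :
    MDifferentiableAt I I.tangent (fun p => (⟨p, X p⟩ : TangentBundle I M)) p :=
  ContMDiff.mdifferentiableAt hX (by simp)

theorem SmoothVF.add {X Y : VField I M} (hX : SmoothVF X) (hY : SmoothVF Y) : SmoothVF (X + Y) :=
  ContMDiff.add_section hX hY

theorem SmoothVF.smul {h : M → ℝ} {X : VField I M} (hh : SmoothFun I h) (hX : SmoothVF X) :
    SmoothVF (fun p => h p • X p) := ContMDiff.smul_section hh hX

theorem smoothVF_zero : SmoothVF (0 : VField I M) :=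
  Bundle.contMDiff_zeroSection ℝ (TangentSpace I : M → Type _)

theorem SmoothVF.sum {ι : Type*} {s : Finset ι} {X : ι → VField I M}
    (hX : ∀ i ∈ s, SmoothVF (X i)) : SmoothVF (fun p => ∑ i ∈ s, X i p) :=
  ContMDiff.sum_section hX

theorem SmoothFun.dir {X : VField I M} {h : M → ℝ} (hX : SmoothVF X) (hh : SmoothFun I h) :
    SmoothFun I (dir X h) := by
  have h1 : ContMDiff I 𝓘(ℝ, ℝ).tangent ∞
      (fun p => tangentMap I 𝓘(ℝ, ℝ) h (⟨p, X p⟩ : TangentBundle I M)) :=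
    (ContMDiff.contMDiff_tangentMap hh (by simp)).comp hX
  exact (contMDiff_snd_tangentBundle_modelSpace ℝ 𝓘(ℝ, ℝ)).comp h1

theorem SmoothVF.mlieBracket [CompleteSpace E] {X Y : VField I M} (hX : SmoothVF X)
    (hY : SmoothVF Y) : SmoothVF (VectorField.mlieBracket I X Y) := by
  have : IsManifold I (((⊤ : ℕ∞) : WithTop ℕ∞) + 1) M := by
    simpa using (inferInstance : IsManifold I ∞ M)
  have : IsManifold I (minSmoothness ℝ 2) M := by
    simpa using (inferInstance : IsManifold I 2 M)
  intro p
  exact ContMDiffAt.mlieBracket_vectorField (n := ⊤) (m := ⊤) (hX p) (hY p)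
    (by simp)

theorem IsSingularMetric.smooth_pair {g : BilinField I M} (hg : IsSingularMetric g)
    {X Y : VField I M} (hX : SmoothVF X) (hY : SmoothVF Y) : SmoothFun I (pair g X Y) := by
  have h := ContMDiff.clm_bundle_apply₂ (F₃ := ℝ) (E₃ := Bundle.Trivial M ℝ) (b := id)
    (ψ := g) (v := X) (w := Y) hg.smooth hX hY
  intro p
  exact ((Bundle.contMDiffAt_totalSpace).1 (h p)).2

theorem IsSingularMetric.pair_comm {g : BilinField I M} (hg : IsSingularMetric g)
    (X Y : VField I M) : pair g X Y = pair g Y X := funext fun p => hg.symm p _ _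

/-! ### Lie brackets -/

variable [CompleteSpace E]

theorem bracket_smul_right {h : M → ℝ} {X Y : VField I M} (hh : SmoothFun I h) (hY : SmoothVF Y)
    (p : M) : VectorField.mlieBracket I X (fun p => h p • Y p) p =
      dir X h p • Y p + h p • VectorField.mlieBracket I X Y p :=
  VectorField.mlieBracket_smul_right (hh.mdifferentiableAt p) (hY.mdifferentiableAt p)

theorem bracket_smul_left {h : M → ℝ} {X Y : VField I M} (hh : SmoothFun I h) (hX : SmoothVF X)
    (p : M) : VectorField.mlieBracket I (fun p => h p • X p) Y p =
      -(dir Y h p) • X p + h p • VectorField.mlieBracket I X Y p :=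
  VectorField.mlieBracket_smul_left (hh.mdifferentiableAt p) (hX.mdifferentiableAt p)

theorem bracket_add_right {X Y Z : VField I M} (hY : SmoothVF Y) (hZ : SmoothVF Z)
    (p : M) : VectorField.mlieBracket I X (Y + Z) p =
      VectorField.mlieBracket I X Y p + VectorField.mlieBracket I X Z p :=
  VectorField.mlieBracket_add_right (hY.mdifferentiableAt p) (hZ.mdifferentiableAt p)

theorem bracket_add_left {X Y Z : VField I M} (hX : SmoothVF X) (hY : SmoothVF Y)
    (p : M) : VectorField.mlieBracket I (X + Y) Z p =
      VectorField.mlieBracket I X Z p + VectorField.mlieBracket I Y Z p :=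
  VectorField.mlieBracket_add_left (hX.mdifferentiableAt p) (hY.mdifferentiableAt p)

theorem jacobi {X Y Z : VField I M} (hX : SmoothVF X) (hY : SmoothVF Y) (hZ : SmoothVF Z) (p : M) :
    VectorField.mlieBracket I X (VectorField.mlieBracket I Y Z) p =
      VectorField.mlieBracket I (VectorField.mlieBracket I X Y) Z p +
      VectorField.mlieBracket I Y (VectorField.mlieBracket I X Z) p := by
  have : IsManifold I (minSmoothness ℝ 3) M := by
    simpa [minSmoothness] using (inferInstance : IsManifold I 3 M)
  have h2 : minSmoothness ℝ 2 ≤ ∞ := by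
    simpa using (by exact_mod_cast le_top : ((2 : ℕ∞) : WithTop ℕ∞) ≤ ∞)
  exact VectorField.leibniz_identity_mlieBracket_apply ((hX p).of_le h2) ((hY p).of_le h2)
    ((hZ p).of_le h2)

/-- Auxiliary form of `dir_bracket`: the derivation identity tested against a vector field. -/
theorem dir_bracket_smul {X Y W : VField I M} {h : M → ℝ} (hX : SmoothVF X) (hY : SmoothVF Y)
    (hW : SmoothVF W) (hh : SmoothFun I h) (p : M) :
    dir (VectorField.mlieBracket I X Y) h p • W p =
      (dir X (dir Y h) p - dir Y (dir X h) p) • W p := by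
  -- In the Jacobi identity for X, Y and hW, the Leibniz rule produces terms in W, [X,W], [Y,W] and
  -- double brackets; all but the multiples of W cancel.
  have key := jacobi hX hY (hW.smul hh) p
  have e1 : ∀ {A : VField I M}, SmoothVF A →
      VectorField.mlieBracket I A (fun p => h p • W p) =
      (fun p => dir A h p • W p) + (fun p => h p • VectorField.mlieBracket I A W p) :=
    fun {A} hA => funext fun q => bracket_smul_right hh hW q
  have e2 : ∀ {A B : VField I M}, SmoothVF A → SmoothVF B →
      VectorField.mlieBracket I A (VectorField.mlieBracket I B (fun p => h p • W p)) p =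
      dir A (dir B h) p • W p + dir B h p • VectorField.mlieBracket I A W p
      + (dir A h p • VectorField.mlieBracket I B W p
        + h p • VectorField.mlieBracket I A (VectorField.mlieBracket I B W) p) := by
    intro A B hA hB
    rw [e1 hB, bracket_add_right (hW.smul (.dir hB hh)) ((hB.mlieBracket hW).smul hh),
      bracket_smul_right (.dir hB hh) hW, bracket_smul_right hh (hB.mlieBracket hW)]
  rw [e2 hX hY, e2 hY hX, e1 (hX.mlieBracket hY), jacobi hX hY hW p] at key
  simp only [Pi.add_apply, smul_add] at key
  rw [sub_smul]
  have : dir (VectorField.mlieBracket I X Y) h p • W p =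
    dir X (dir Y h) p • W p - dir Y (dir X h) p • W p := by
    rw [eq_sub_iff_add_eq]
    apply eq_of_sub_eq_zero
    have := sub_eq_zero.2 key
    rw [← neg_eq_zero, ← this]
    abel
  exact this

end Calculus

/-! ### Cut-off frames and tensoriality. -/

section Frames

variable {E : Type*} [NormedAddCommGroup E] [NormedSpace ℝ E] [FiniteDimensional ℝ E]
  {H : Type*} [TopologicalSpace H] {I : ModelWithCorners ℝ E H}
  {M : Type*} [TopologicalSpace M] [ChartedSpace H M] [IsManifold I ∞ M] [T2Space M]

/-! ### Bump functions and global frames near a point -/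

variable (I) in
theorem exists_smooth_bump {p : M} {U : Set M} (hU : U ∈ 𝓝 p) :
    ∃ χ : M → ℝ, SmoothFun I χ ∧ χ =ᶠ[𝓝 p] 1 ∧ tsupport χ ⊆ U := by
  obtain ⟨χ, hχ, -⟩ := (SmoothBumpFunction.nhds_basis_support (I := I) hU).mem_iff.1
    (Filter.univ_mem : Set.univ ∈ 𝓝 p)
  exact ⟨χ, χ.contMDiff, χ.eventuallyEq_one, hχ⟩

/-- Globally defined smooth vector fields `e i` that form a basis of the tangent spaces over the
set `U`, with the coordinates given there by functions `c i` that are smooth on the tangent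
bundle. -/
structure IsFrame {n : ℕ} (e : Fin n → VField I M) (c : Fin n → Π p : M, TangentSpace I p → ℝ)
    (U : Set M) : Prop where
  smooth : ∀ i, SmoothVF (e i)
  coeff_smooth : ∀ i, ContMDiff I.tangent 𝓘(ℝ, ℝ) ∞ (fun v : TangentBundle I M => c i v.1 v.2)
  sum_eq : ∀ p ∈ U, ∀ v : TangentSpace I p, v = ∑ i, c i p v • e i p
  linearIndependent : ∀ p ∈ U, LinearIndependent ℝ (fun i => e i p)

theorem IsFrame.smooth_coeff {n : ℕ} {e : Fin n → VField I M}
    {c : Fin n → Π p : M, TangentSpace I p → ℝ} {U : Set M} (h : IsFrame e c U) (i : Fin n)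
    {X : VField I M} (hX : SmoothVF X) : SmoothFun I (fun p => c i p (X p)) :=
  (h.coeff_smooth i).comp hX

variable (I) in
theorem exists_isFrame (p₀ : M) : ∃ (n : ℕ) (e : Fin n → VField I M)
    (c : Fin n → Π p : M, TangentSpace I p → ℝ), ∃ U ∈ 𝓝 p₀, IsFrame e c U := by
  let t := trivializationAt E (TangentSpace I : M → Type _) p₀
  have hp₀ : p₀ ∈ t.baseSet := FiberBundle.mem_baseSet_trivializationAt E _ p₀
  let b := Module.finBasis ℝ E
  obtain ⟨χ, hχ, hχ1, hχs⟩ := exists_smooth_bump I (t.open_baseSet.mem_nhds hp₀)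
  -- Both the frame and its coordinates are cut off by χ, which makes them globally smooth. Their
  -- product carries χ², so the expansion is claimed only where χ = 1.
  refine ⟨_, fun i p => χ p • t.localFrame b i p,
    fun i p v => χ p * b.repr (t (⟨p, v⟩ : TangentBundle I M)).2 i,
    {p | χ p = 1} ∩ t.baseSet, Filter.inter_mem hχ1 (t.open_baseSet.mem_nhds hp₀), ?_, ?_, ?_, ?_⟩
  · intro i
    exact ContMDiffOn.smul_section_of_tsupport hχ.contMDiffOn t.open_baseSet hχs
      (t.contMDiffOn_localFrame_baseSet ∞ b i)
  · intro i v
    by_cases hv : v.1 ∈ t.baseSet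
    · have h1 : ContMDiffAt I.tangent 𝓘(ℝ, ℝ) ∞ (fun v : TangentBundle I M => χ v.1) v :=
        ContMDiffAt.comp v (hχ v.1) (Bundle.contMDiffAt_proj (TangentSpace I))
      have h2 : ContMDiffAt I.tangent (I.prod 𝓘(ℝ, E)) ∞ t v :=
        t.contMDiffOn.contMDiffAt (t.open_source.mem_nhds (by simpa [t.mem_source] using hv))
      have h3 : ContMDiffAt I.tangent 𝓘(ℝ, E) ∞ (fun v : TangentBundle I M => (t v).2) v :=
        ContMDiffAt.comp v contMDiffAt_snd h2
      have h4 : ContMDiff 𝓘(ℝ, E) 𝓘(ℝ, ℝ) ∞ (fun x : E => b.repr x i) :=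
        (LinearMap.toContinuousLinearMap (b.coord i)).contDiff.contMDiff
      exact h1.mul (ContMDiffAt.comp v (h4 _) h3)
    · have hv' : v.1 ∉ tsupport χ := fun h => hv (hχs h)
      have h0 : ∀ᶠ w : TangentBundle I M in 𝓝 v, χ w.1 = 0 := by
        have hc : Continuous (fun w : TangentBundle I M => w.1) :=
          FiberBundle.continuous_proj E (TangentSpace I)
        have := hc.continuousAt.eventually
          (show ∀ᶠ x in 𝓝 v.1, χ x = 0 from (notMem_tsupport_iff_eventuallyEq.1 hv'))
        exact this
      refine (contMDiffAt_const (c := (0 : ℝ))).congr_of_eventuallyEq ?_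
      filter_upwards [h0] with w hw
      simp [hw]
  · rintro p ⟨h1, hp⟩ v
    have h1 : χ p = 1 := h1
    have := (t.basisAt b hp).sum_repr v
    simp only [h1, one_mul, one_smul]
    conv_lhs => rw [← this]
    refine Finset.sum_congr rfl fun i _ => ?_
    rw [t.localFrame_apply_of_mem_baseSet b hp]
    congr 1
  · rintro p ⟨h1, hp⟩
    have h1 : χ p = 1 := h1
    convert! (t.basisAt b hp).linearIndependent using 2 with i
    rw [h1, one_smul, t.localFrame_apply_of_mem_baseSet b hp]

theorem exists_smoothVF_eq {p : M} (v : TangentSpace I p) : ∃ X : VField I M, SmoothVF X ∧ X p = v := by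
  obtain ⟨n, e, c, U, hU, h⟩ := exists_isFrame I p
  refine ⟨fun q => ∑ i, c i p v • e i q, SmoothVF.sum fun i _ => (h.smooth i).smul
    (smoothFun_const _), (h.sum_eq p (mem_of_mem_nhds hU) v).symm⟩

/-- A vector field W with W(p) ≠ 0 can be cancelled from `dir_bracket_smul`. If the tangent space is
trivial there is no such W, but then all three derivatives vanish. -/
theorem dir_bracket {X Y : VField I M} {h : M → ℝ} (hX : SmoothVF X) (hY : SmoothVF Y)
    (hh : SmoothFun I h) (p : M) :
    dir (VectorField.mlieBracket I X Y) h p = dir X (dir Y h) p - dir Y (dir X h) p := by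
  by_cases hE : ∃ v : TangentSpace I p, v ≠ 0
  · obtain ⟨v, hv⟩ := hE
    obtain ⟨W, hW, hWp⟩ := exists_smoothVF_eq v
    exact smul_left_injective ℝ (hWp ▸ hv : W p ≠ 0) (dir_bracket_smul hX hY hW hh p)
  · push Not at hE
    rw [dir_of_eq_zero _ (hE _), dir_of_eq_zero _ (hE _), dir_of_eq_zero _ (hE _), sub_zero]

/-- Vector fields are separated by their action on smooth functions. -/
theorem eq_of_dir_eq {p : M} {v w : TangentSpace I p}
    (h : ∀ k : M → ℝ, SmoothFun I k →
      (mfderiv I 𝓘(ℝ, ℝ) k p v : ℝ) = mfderiv I 𝓘(ℝ, ℝ) k p w) : v = w := by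
  let χ : SmoothBumpFunction I p := Classical.arbitrary _
  -- The cut-off chart is a global smooth map with the invertible differential of the chart at p.
  -- Its components ℓ ∘ K are therefore enough test functions to separate tangent vectors.
  let K : M → E := fun q => χ q • extChartAt I p q
  have hK : ContMDiff I 𝓘(ℝ, E) ∞ K := χ.contMDiff_smul (contMDiffOn_extChartAt)
  have hKe : K =ᶠ[𝓝 p] extChartAt I p := by
    filter_upwards [χ.eventuallyEq_one] with q hq
    simp [K, hq]
  have hinj : Function.Injective (mfderiv I 𝓘(ℝ, E) (extChartAt I p) p) :=
    (isInvertible_mfderiv_extChartAt (mem_extChartAt_source (I := I) p)).injective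
  apply hinj
  refine (SeparatingDual.eq_iff_forall_dual_eq (R := ℝ) (V := E)).2 fun ℓ => ?_
  have hk : SmoothFun I (fun q => ℓ (K q)) := ℓ.contDiff.contMDiff.comp hK
  have hd : HasMFDerivAt I 𝓘(ℝ, ℝ) (fun q => ℓ (K q)) p
      (ℓ.comp (mfderiv I 𝓘(ℝ, E) (extChartAt I p) p)) := by
    have h1 : HasMFDerivAt I 𝓘(ℝ, E) K p (mfderiv I 𝓘(ℝ, E) (extChartAt I p) p) :=
      ((mdifferentiableAt_extChartAt (mem_chart_source H p)).hasMFDerivAt).congr_of_eventuallyEq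
        hKe
    exact (ℓ.hasFDerivAt.hasMFDerivAt (x := K p)).comp p h1
  have := h _ hk
  rw [hd.mfderiv] at this
  exact this

/-! ### Tensoriality -/

/-- Additive and `C^∞(M)`-homogeneous maps on smooth vector fields, evaluated at the point `p`. -/
structure IsTensorAt (φ : VField I M → ℝ) (p : M) : Prop where
  add : ∀ X Y, SmoothVF X → SmoothVF Y → φ (X + Y) = φ X + φ Y
  smul : ∀ (h : M → ℝ) (X : VField I M), SmoothFun I h → SmoothVF X →
    φ (fun p => h p • X p) = h p * φ X

theorem IsTensorAt.zero {φ : VField I M → ℝ} {p : M} (hφ : IsTensorAt φ p) : φ 0 = 0 := by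
  have := hφ.smul (fun _ => 0) 0 (smoothFun_const 0) smoothVF_zero
  simpa [Pi.zero_def] using this

theorem IsTensorAt.sum {φ : VField I M → ℝ} {p : M} (hφ : IsTensorAt φ p) {ι : Type*}
    (s : Finset ι) {X : ι → VField I M} (hX : ∀ i ∈ s, SmoothVF (X i)) :
    φ (fun p => ∑ i ∈ s, X i p) = ∑ i ∈ s, φ (X i) := by
  classical
  induction s using Finset.induction_on with
  | empty => simpa [Pi.zero_def] using hφ.zero
  | insert a s ha ih =>
    simp only [Finset.mem_insert, forall_eq_or_imp] at hX
    simp only [Finset.sum_insert ha, ← ih hX.2]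
    exact hφ.add _ _ hX.1 (.sum hX.2)

/-- For a bump function χ supported where X = Y, the fields χX and χY are equal everywhere, and
homogeneity with χ(p) = 1 removes χ. -/
theorem IsTensorAt.congr_germ {φ : VField I M → ℝ} {p : M} (hφ : IsTensorAt φ p)
    {X Y : VField I M} (hX : SmoothVF X) (hY : SmoothVF Y) (h : X =ᶠ[𝓝 p] Y) : φ X = φ Y := by
  obtain ⟨χ, hχ, hχ1, hχs⟩ := exists_smooth_bump I h
  have e : (fun q => χ q • X q) = fun q => χ q • Y q := by
    funext q
    by_cases hq : q ∈ tsupport χ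
    · rw [show X q = Y q from hχs hq]
    · simp [image_eq_zero_of_notMem_tsupport hq]
  have h1 := hφ.smul χ X hχ hX
  rw [e, hφ.smul χ Y hχ hY, hχ1.self_of_nhds] at h1
  simpa using h1.symm

/-- Near p a field is a combination of frame fields with smooth coefficients, and homogeneity only
sees the values of the coefficients at p. -/
theorem IsTensorAt.congr {φ : VField I M → ℝ} {p : M} (hφ : IsTensorAt φ p)
    {X Y : VField I M} (hX : SmoothVF X) (hY : SmoothVF Y) (h : X p = Y p) : φ X = φ Y := by
  obtain ⟨n, e, c, U, hU, hF⟩ := exists_isFrame I p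
  have key : ∀ Z : VField I M, SmoothVF Z → φ Z = ∑ i, c i p (Z p) * φ (e i) := by
    intro Z hZ
    have hs : ∀ i ∈ (Finset.univ : Finset (Fin n)), SmoothVF (fun q => c i q (Z q) • e i q) :=
      fun i _ => (hF.smooth i).smul (hF.smooth_coeff i hZ)
    rw [hφ.congr_germ hZ (.sum hs) (by
      filter_upwards [hU] with q hq using hF.sum_eq q hq _), hφ.sum _ hs]
    exact Finset.sum_congr rfl fun i _ => hφ.smul _ _ (hF.smooth_coeff i hZ) (hF.smooth i)
  rw [key X hX, key Y hY, h]

end Frames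

/-! ### One-forms, the space A^•, its inner product, and the Koszul form. -/

section Forms

variable {E : Type*} [NormedAddCommGroup E] [NormedSpace ℝ E] [FiniteDimensional ℝ E]
  {H : Type*} [TopologicalSpace H] {I : ModelWithCorners ℝ E H}
  {M : Type*} [TopologicalSpace M] [ChartedSpace H M] [IsManifold I ∞ M] [T2Space M]
  {g : BilinField I M}

/-- The product of a function and a 1-form. -/
def fmul (h : M → ℝ) (α : FormMap I M) : FormMap I M := fun T => h * α T

/-- The 1-form `X^♭ = g(X, ·)`. -/
def flatForm (g : BilinField I M) (X : VField I M) : FormMap I M := fun T => pair g X T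

theorem fmul_apply (h : M → ℝ) (α : FormMap I M) (T : VField I M) (p : M) :
    fmul h α T p = h p * α T p := rfl

theorem flatForm_apply (g : BilinField I M) (X T : VField I M) (p : M) :
    flatForm g X T p = pair g X T p := rfl

theorem add_form_apply (α γ : FormMap I M) (T : VField I M) (p : M) :
    (α + γ) T p = α T p + γ T p := rfl

theorem pair_add_left (X Y Z : VField I M) : pair g (X + Y) Z = pair g X Z + pair g Y Z := by
  funext p; simp [pair]

theorem pair_add_right (X Y Z : VField I M) : pair g X (Y + Z) = pair g X Y + pair g X Z := by
  funext p; simp [pair]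

theorem pair_smul_left (h : M → ℝ) (X Z : VField I M) :
    pair g (fun p => h p • X p) Z = h * pair g X Z := by
  funext p; simp [pair]

theorem pair_smul_right (h : M → ℝ) (X Z : VField I M) :
    pair g X (fun p => h p • Z p) = h * pair g X Z := by
  funext p; simp [pair]

/-! ### One-forms -/

theorem IsOneForm.isTensorAt {α : FormMap I M} (hα : IsOneForm α) (p : M) :
    IsTensorAt (fun X => α X p) p where
  add X Y hX hY := by simp [hα.add X Y hX hY]
  smul h X hh hX := by simp [hα.smul h X hh hX]

theorem IsOneForm.congr {α α' : FormMap I M} (hα : IsOneForm α)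
    (h : ∀ T, SmoothVF T → α' T = α T) : IsOneForm α' where
  smooth X hX := h X hX ▸ hα.smooth X hX
  add X Y hX hY := by rw [h _ hX, h _ hY, h _ (hX.add hY), hα.add X Y hX hY]
  smul k X hk hX := by rw [h _ hX, h _ (hX.smul hk), hα.smul k X hk hX]

theorem IsOneForm.form_add {α γ : FormMap I M} (hα : IsOneForm α) (hγ : IsOneForm γ) :
    IsOneForm (α + γ) where
  smooth X hX := (hα.smooth X hX).add (hγ.smooth X hX)
  add X Y hX hY := by
    simp only [Pi.add_apply, hα.add X Y hX hY, hγ.add X Y hX hY]; ring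
  smul k X hk hX := by
    simp only [Pi.add_apply, hα.smul k X hk hX, hγ.smul k X hk hX]; ring

theorem IsOneForm.form_fmul {h : M → ℝ} {α : FormMap I M} (hh : SmoothFun I h)
    (hα : IsOneForm α) : IsOneForm (fmul h α) where
  smooth X hX := hh.mul (hα.smooth X hX)
  add X Y hX hY := by simp only [fmul, hα.add X Y hX hY]; ring
  smul k X hk hX := by simp only [fmul, hα.smul k X hk hX]; ring

theorem isOneForm_zero : IsOneForm (0 : FormMap I M) where
  smooth _ _ := smoothFun_const 0
  add X Y _ _ := by simp
  smul h X _ _ := by simp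

theorem IsSingularMetric.isOneForm_flatForm (hg : IsSingularMetric g) {X : VField I M}
    (hX : SmoothVF X) : IsOneForm (flatForm g X) where
  smooth _ hY := hg.smooth_pair hX hY
  add _ _ _ _ := pair_add_right X _ _
  smul h _ _ _ := pair_smul_right h X _

/-! ### Covectors in the image of the flat map -/

theorem IsFlatOfAt.congr {α α' : FormMap I M} {p : M} {v : TangentSpace I p}
    (hα : IsFlatOfAt g α p v) (h : ∀ T, SmoothVF T → α' T p = α T p) : IsFlatOfAt g α' p v :=
  fun T hT => by rw [h T hT, hα T hT]

theorem IsFlatOfAt.add {α γ : FormMap I M} {p : M} {v w : TangentSpace I p}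
    (hα : IsFlatOfAt g α p v) (hγ : IsFlatOfAt g γ p w) : IsFlatOfAt g (α + γ) p (v + w) :=
  fun T hT => by simp [hα T hT, hγ T hT]

theorem IsFlatOfAt.fmul {α : FormMap I M} {p : M} {v : TangentSpace I p} (h : M → ℝ)
    (hα : IsFlatOfAt g α p v) : IsFlatOfAt g (fmul h α) p (h p • v) :=
  fun T hT => by simp [SingularGeometry.fmul, hα T hT]

theorem isFlatOfAt_flatForm (g : BilinField I M) (X : VField I M) (p : M) :
    IsFlatOfAt g (flatForm g X) p (X p) := fun _ _ => rfl

theorem isFlatOfAt_zero (g : BilinField I M) (p : M) :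
    IsFlatOfAt g 0 p 0 := fun _ _ => by simp

theorem IsRadAnn.congr {α α' : FormMap I M} (hα : IsRadAnn g α)
    (h : ∀ T, SmoothVF T → α' T = α T) : IsRadAnn g α' where
  oneForm := hα.oneForm.congr h
  flat p := (hα.flat p).imp fun _ hv => hv.congr fun T hT => by rw [h T hT]

theorem IsRadAnn.add {α γ : FormMap I M} (hα : IsRadAnn g α) (hγ : IsRadAnn g γ) :
    IsRadAnn g (α + γ) where
  oneForm := hα.oneForm.form_add hγ.oneForm
  flat p := by
    obtain ⟨v, hv⟩ := hα.flat p
    obtain ⟨w, hw⟩ := hγ.flat p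
    exact ⟨_, hv.add hw⟩

theorem IsRadAnn.fmul {h : M → ℝ} {α : FormMap I M} (hα : IsRadAnn g α) (hh : SmoothFun I h) :
    IsRadAnn g (fmul h α) where
  oneForm := hα.oneForm.form_fmul hh
  flat p := by
    obtain ⟨v, hv⟩ := hα.flat p
    exact ⟨_, hv.fmul h⟩

theorem isRadAnn_zero (g : BilinField I M) : IsRadAnn g 0 where
  oneForm := isOneForm_zero
  flat p := ⟨0, isFlatOfAt_zero g p⟩

theorem IsRadAnn.sum {ι : Type*} {s : Finset ι} {α : ι → FormMap I M}
    (h : ∀ i ∈ s, IsRadAnn g (α i)) : IsRadAnn g (∑ i ∈ s, α i) := by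
  classical
  induction s using Finset.induction_on with
  | empty => simpa using isRadAnn_zero g
  | insert a s ha ih =>
    simp only [Finset.mem_insert, forall_eq_or_imp] at h
    rw [Finset.sum_insert ha]
    exact h.1.add (ih h.2)

theorem IsSingularMetric.isRadAnn_flatForm (hg : IsSingularMetric g) {X : VField I M}
    (hX : SmoothVF X) : IsRadAnn g (flatForm g X) where
  oneForm := hg.isOneForm_flatForm hX
  flat p := ⟨X p, isFlatOfAt_flatForm g X p⟩

/-! ### The inner product of covectors -/

/-- Independence of the choice of representatives: by symmetry each of the two vectors can be
exchanged in turn, since g_p(u, ·) depends only on the covector. The vectors are realised by smooth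
fields because `IsFlatOfAt` tests only against these. -/
theorem IsSingularMetric.coInner_eq (hg : IsSingularMetric g) {α γ : FormMap I M} {p : M}
    {u v : TangentSpace I p} (hu : IsFlatOfAt g α p u) (hv : IsFlatOfAt g γ p v) :
    coInner g α γ p = g p u v := by
  have h : ∃ uv : TangentSpace I p × TangentSpace I p,
      IsFlatOfAt g α p uv.1 ∧ IsFlatOfAt g γ p uv.2 := ⟨(u, v), hu, hv⟩
  rw [coInner, dif_pos h]
  obtain ⟨h1, h2⟩ := h.choose_spec
  obtain ⟨U, hU, hUp⟩ := exists_smoothVF_eq u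
  obtain ⟨V', hV', hV'p⟩ := exists_smoothVF_eq h.choose.2
  rw [← hV'p, ← h1 V' hV', hu V' hV', hV'p, ← hUp, hg.symm, ← h2 U hU, hv U hU, hg.symm]

/-- An inner product with X^♭ is an evaluation at X. Cancellations between derivatives and inner
products rest on this. -/
theorem IsSingularMetric.coInner_flatForm (hg : IsSingularMetric g) {X : VField I M}
    (hX : SmoothVF X) {α : FormMap I M} {p : M} (hα : ∃ v, IsFlatOfAt g α p v) :
    coInner g (flatForm g X) α p = α X p := by
  obtain ⟨v, hv⟩ := hα
  rw [hg.coInner_eq (isFlatOfAt_flatForm g X p) hv, hv X hX, hg.symm]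

theorem IsSingularMetric.coInner_comm (hg : IsSingularMetric g) {α γ : FormMap I M} {p : M}
    (hα : ∃ v, IsFlatOfAt g α p v) (hγ : ∃ v, IsFlatOfAt g γ p v) :
    coInner g α γ p = coInner g γ α p := by
  obtain ⟨u, hu⟩ := hα
  obtain ⟨v, hv⟩ := hγ
  rw [hg.coInner_eq hu hv, hg.coInner_eq hv hu, hg.symm]

theorem IsSingularMetric.coInner_add_left (hg : IsSingularMetric g) {α β γ : FormMap I M} {p : M}
    (hα : ∃ v, IsFlatOfAt g α p v) (hβ : ∃ v, IsFlatOfAt g β p v)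
    (hγ : ∃ v, IsFlatOfAt g γ p v) :
    coInner g (α + β) γ p = coInner g α γ p + coInner g β γ p := by
  obtain ⟨u, hu⟩ := hα
  obtain ⟨v, hv⟩ := hβ
  obtain ⟨w, hw⟩ := hγ
  rw [hg.coInner_eq (hu.add hv) hw, hg.coInner_eq hu hw, hg.coInner_eq hv hw]
  simp

theorem IsSingularMetric.coInner_fmul_left (hg : IsSingularMetric g) {α γ : FormMap I M} {p : M}
    (h : M → ℝ) (hα : ∃ v, IsFlatOfAt g α p v) (hγ : ∃ v, IsFlatOfAt g γ p v) :
    coInner g (fmul h α) γ p = h p * coInner g α γ p := by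
  obtain ⟨u, hu⟩ := hα
  obtain ⟨w, hw⟩ := hγ
  rw [hg.coInner_eq (hu.fmul h) hw, hg.coInner_eq hu hw]
  simp

/-- The predicates that select the representing vectors coincide, so even the chosen vectors are the
same; neither symmetry of g nor membership in A^• is needed. -/
theorem coInner_congr {α α' γ γ' : FormMap I M} {p : M}
    (hα : ∀ T, SmoothVF T → α T p = α' T p) (hγ : ∀ T, SmoothVF T → γ T p = γ' T p) :
    coInner g α γ p = coInner g α' γ' p := by
  have e1 : ∀ v, IsFlatOfAt g α p v = IsFlatOfAt g α' p v := fun v => by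
    simp only [IsFlatOfAt, eq_iff_iff]
    exact forall₂_congr fun T hT => by rw [hα T hT]
  have e2 : ∀ v, IsFlatOfAt g γ p v = IsFlatOfAt g γ' p v := fun v => by
    simp only [IsFlatOfAt, eq_iff_iff]
    exact forall₂_congr fun T hT => by rw [hγ T hT]
  unfold coInner
  rw [funext e1, funext e2]

theorem IsSingularMetric.coInner_add_right (hg : IsSingularMetric g) {α β γ : FormMap I M} {p : M}
    (hα : ∃ v, IsFlatOfAt g α p v) (hβ : ∃ v, IsFlatOfAt g β p v)
    (hγ : ∃ v, IsFlatOfAt g γ p v) :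
    coInner g γ (α + β) p = coInner g γ α p + coInner g γ β p := by
  obtain ⟨u, hu⟩ := hα
  obtain ⟨v, hv⟩ := hβ
  obtain ⟨w, hw⟩ := hγ
  rw [hg.coInner_eq hw (hu.add hv), hg.coInner_eq hw hu, hg.coInner_eq hw hv]
  simp

theorem IsSingularMetric.coInner_fmul_right (hg : IsSingularMetric g) {α γ : FormMap I M} {p : M}
    (h : M → ℝ) (hα : ∃ v, IsFlatOfAt g α p v) (hγ : ∃ v, IsFlatOfAt g γ p v) :
    coInner g γ (fmul h α) p = h p * coInner g γ α p := by
  obtain ⟨u, hu⟩ := hα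
  obtain ⟨w, hw⟩ := hγ
  rw [hg.coInner_eq hw (hu.fmul h), hg.coInner_eq hw hu]
  simp

/-! ### The Koszul form -/

section Koszul

variable {X Y Z : VField I M}

theorem IsSingularMetric.smooth_koszul (hg : IsSingularMetric g) (hX : SmoothVF X)
    (hY : SmoothVF Y) (hZ : SmoothVF Z) : SmoothFun I (koszul g X Y Z) := by
  have h := (((((SmoothFun.dir hX (hg.smooth_pair hY hZ)).add
    (SmoothFun.dir hY (hg.smooth_pair hZ hX))).sub
    (SmoothFun.dir hZ (hg.smooth_pair hX hY))).sub
    (hg.smooth_pair hX (hY.mlieBracket hZ))).add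
    (hg.smooth_pair hY (hZ.mlieBracket hX))).add
    (hg.smooth_pair hZ (hX.mlieBracket hY))
  exact (smoothFun_const (1 / 2 : ℝ)).mul h

/-- Metric compatibility and, in `koszul_torsion`, vanishing torsion: later arguments use these two
identities more often than the six-term formula. -/
theorem IsSingularMetric.koszul_compat (hg : IsSingularMetric g) (p : M) :
    koszul g X Y Z p + koszul g X Z Y p = dir X (pair g Y Z) p := by
  simp only [koszul, VectorField.mlieBracket_swap (I := I) (V := Z) (W := Y),
    VectorField.mlieBracket_swap (I := I) (V := Y) (W := X),
    VectorField.mlieBracket_swap (I := I) (V := X) (W := Z), hg.pair_comm Z Y, hg.pair_comm Y X,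
    hg.pair_comm X Z]
  simp only [pair, Pi.neg_apply, map_neg]
  ring

theorem IsSingularMetric.koszul_torsion (hg : IsSingularMetric g) (p : M) :
    koszul g X Y Z p - koszul g Y X Z p = pair g (VectorField.mlieBracket I X Y) Z p := by
  simp only [koszul, VectorField.mlieBracket_swap (I := I) (V := Z) (W := Y),
    VectorField.mlieBracket_swap (I := I) (V := Y) (W := X),
    VectorField.mlieBracket_swap (I := I) (V := X) (W := Z), hg.pair_comm Z Y, hg.pair_comm Y X,
    hg.pair_comm X Z]
  simp only [pair, Pi.neg_apply, map_neg]
  rw [hg.symm p (VectorField.mlieBracket I X Y p) (Z p)]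
  ring

theorem koszul_congr {X' Y' : VField I M} {p : M} (hX : X =ᶠ[𝓝 p] X') (hY : Y =ᶠ[𝓝 p] Y') :
    koszul g X Y Z p = koszul g X' Y' Z p := by
  have eX := hX.self_of_nhds
  have eY := hY.self_of_nhds
  have h1 : pair g Y Z =ᶠ[𝓝 p] pair g Y' Z := hY.mono fun q hq => by simp [pair, hq]
  have h2 : pair g Z X =ᶠ[𝓝 p] pair g Z X' := hX.mono fun q hq => by simp [pair, hq]
  have h3 : pair g X Y =ᶠ[𝓝 p] pair g X' Y' := by
    filter_upwards [hX, hY] with q h h'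
    simp [pair, h, h']
  simp only [koszul, dir_congr eX h1, dir_congr eY h2, dir_congr (rfl : Z p = Z p) h3]
  simp only [pair, bracket_congr hY (Filter.EventuallyEq.refl _ Z),
    bracket_congr (Filter.EventuallyEq.refl _ Z) hX, bracket_congr hX hY, eX, eY]

theorem IsSingularMetric.koszul_add_right (hg : IsSingularMetric g) {Z' : VField I M}
    (hX : SmoothVF X) (hY : SmoothVF Y) (hZ : SmoothVF Z) (hZ' : SmoothVF Z') (p : M) :
    koszul g X Y (Z + Z') p = koszul g X Y Z p + koszul g X Y Z' p := by
  simp only [koszul, pair_add_left, pair_add_right, dir_add_vf,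
    dir_add (hg.smooth_pair hY hZ) (hg.smooth_pair hY hZ'),
    dir_add (hg.smooth_pair hZ hX) (hg.smooth_pair hZ' hX)]
  simp only [pair, bracket_add_right hZ hZ', bracket_add_left hZ hZ', map_add, Pi.add_apply]
  ring

theorem IsSingularMetric.koszul_smul_right (hg : IsSingularMetric g) {h : M → ℝ}
    (hh : SmoothFun I h) (hX : SmoothVF X) (hY : SmoothVF Y) (hZ : SmoothVF Z) (p : M) :
    koszul g X Y (fun p => h p • Z p) p = h p * koszul g X Y Z p := by
  simp only [koszul, pair_smul_left, pair_smul_right, dir_smul_vf,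
    dir_mul hh (hg.smooth_pair hY hZ), dir_mul hh (hg.smooth_pair hZ hX)]
  simp only [pair, bracket_smul_right hh hZ, bracket_smul_left hh hZ, map_add, map_smul,
    Pi.mul_apply, smul_eq_mul, neg_smul, map_neg]
  rw [hg.symm p (Z p) (X p), hg.symm p (Y p) (Z p)]
  ring

theorem IsSingularMetric.isOneForm_koszul (hg : IsSingularMetric g) (hX : SmoothVF X)
    (hY : SmoothVF Y) : IsOneForm (koszul g X Y) where
  smooth _ hZ := hg.smooth_koszul hX hY hZ
  add _ _ hZ hZ' := funext fun p => hg.koszul_add_right hX hY hZ hZ' p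
  smul _ _ hh hZ := funext fun p => hg.koszul_smul_right hh hX hY hZ p

/-- Compatibility exchanges the last two arguments up to a derivative of the metric, so the
behaviour in the middle argument follows from that in the last one. -/
theorem IsSingularMetric.koszul_add_middle (hg : IsSingularMetric g) {Y' : VField I M}
    (hX : SmoothVF X) (hY : SmoothVF Y) (hY' : SmoothVF Y') (hZ : SmoothVF Z) (p : M) :
    koszul g X (Y + Y') Z p = koszul g X Y Z p + koszul g X Y' Z p := by
  have h1 := hg.koszul_compat (X := X) (Y := Y + Y') (Z := Z) p
  have h2 := hg.koszul_compat (X := X) (Y := Y) (Z := Z) p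
  have h3 := hg.koszul_compat (X := X) (Y := Y') (Z := Z) p
  have h4 := hg.koszul_add_right hX hZ hY hY' p
  rw [pair_add_left, dir_add (hg.smooth_pair hY hZ) (hg.smooth_pair hY' hZ)] at h1
  linarith

theorem IsSingularMetric.koszul_smul_middle (hg : IsSingularMetric g) {h : M → ℝ}
    (hh : SmoothFun I h) (hX : SmoothVF X) (hY : SmoothVF Y) (hZ : SmoothVF Z) (p : M) :
    koszul g X (fun p => h p • Y p) Z p =
      h p * koszul g X Y Z p + dir X h p * pair g Y Z p := by
  have h1 := hg.koszul_compat (X := X) (Y := fun p => h p • Y p) (Z := Z) p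
  have h2 := hg.koszul_compat (X := X) (Y := Y) (Z := Z) p
  have h4 := hg.koszul_smul_right hh hX hZ hY p
  rw [pair_smul_left, dir_mul hh (hg.smooth_pair hY hZ), ← h2] at h1
  linear_combination h1 - h4

/-- The torsion identity exchanges the first two arguments up to a bracket, which reduces the first
argument to the middle one. The same route gives homogeneity in the first argument. -/
theorem IsSingularMetric.koszul_add_left (hg : IsSingularMetric g) {X' : VField I M}
    (hX : SmoothVF X) (hX' : SmoothVF X') (hY : SmoothVF Y) (hZ : SmoothVF Z) (p : M) :
    koszul g (X + X') Y Z p = koszul g X Y Z p + koszul g X' Y Z p := by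
  have h1 := hg.koszul_torsion (X := X + X') (Y := Y) (Z := Z) p
  have h2 := hg.koszul_torsion (X := X) (Y := Y) (Z := Z) p
  have h3 := hg.koszul_torsion (X := X') (Y := Y) (Z := Z) p
  have h4 := hg.koszul_add_middle hY hX hX' hZ p
  simp only [pair, bracket_add_left hX hX', map_add, add_apply] at h1 h2 h3
  linarith

theorem IsSingularMetric.koszul_smul_left (hg : IsSingularMetric g) {h : M → ℝ}
    (hh : SmoothFun I h) (hX : SmoothVF X) (hY : SmoothVF Y) (hZ : SmoothVF Z) (p : M) :
    koszul g (fun p => h p • X p) Y Z p = h p * koszul g X Y Z p := by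
  have h1 := hg.koszul_torsion (X := fun p => h p • X p) (Y := Y) (Z := Z) p
  have h2 := hg.koszul_torsion (X := X) (Y := Y) (Z := Z) p
  have h4 := hg.koszul_smul_middle hh hY hX hZ p
  simp only [pair, bracket_smul_left hh hX, map_add, map_smul, neg_smul, map_neg,
    add_apply, neg_apply, smul_apply,
    smul_eq_mul] at h1 h2 h4
  linear_combination h1 + h4 - h p * h2

theorem IsSingularMetric.isTensorAt_koszul (hg : IsSingularMetric g) (hY : SmoothVF Y)
    (hZ : SmoothVF Z) (p : M) : IsTensorAt (fun X => koszul g X Y Z p) p where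
  add _ _ hX hX' := hg.koszul_add_left hX hX' hY hZ p
  smul _ _ hh hX := hg.koszul_smul_left hh hX hY hZ p

theorem IsSingularMetric.koszul_zero_middle (hg : IsSingularMetric g)
    (hX : SmoothVF X) (hZ : SmoothVF Z) (p : M) : koszul g X 0 Z p = 0 := by
  have h := hg.koszul_smul_middle (smoothFun_const 0) hX smoothVF_zero hZ p
  simpa [dir_const, Pi.zero_def] using h

theorem IsSingularMetric.koszul_sum_middle (hg : IsSingularMetric g) {ι : Type*} (s : Finset ι)
    {Y : ι → VField I M} (hX : SmoothVF X) (hY : ∀ i ∈ s, SmoothVF (Y i)) (hZ : SmoothVF Z)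
    (p : M) : koszul g X (fun q => ∑ i ∈ s, Y i q) Z p = ∑ i ∈ s, koszul g X (Y i) Z p := by
  classical
  induction s using Finset.induction_on with
  | empty => simpa [Pi.zero_def] using hg.koszul_zero_middle hX hZ p
  | insert a s ha ih =>
    simp only [Finset.mem_insert, forall_eq_or_imp] at hY
    simp only [Finset.sum_insert ha, ← ih hY.2]
    exact hg.koszul_add_middle hX hY.1 (.sum hY.2) hZ p

end Koszul

end Forms

/-! ### Semicontinuity of the indices and density of the regions of constant signature. -/

section Signature

variable {E : Type*} [NormedAddCommGroup E] [NormedSpace ℝ E] [FiniteDimensional ℝ E]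
  {H : Type*} [TopologicalSpace H] {I : ModelWithCorners ℝ E H}
  {M : Type*} [TopologicalSpace M] [ChartedSpace H M] [IsManifold I ∞ M] [T2Space M]
  {g : BilinField I M}

/-! ### Semicontinuity of the signature -/

instance tangentSpace_finiteDimensional (p : M) : FiniteDimensional ℝ (TangentSpace I p) :=
  inferInstanceAs (FiniteDimensional ℝ E)

theorem quadAt_apply (g : BilinField I M) (p : M) (v : TangentSpace I p) :
    quadAt g p v = g p v v := rfl

theorem quadAt_neg (g : BilinField I M) (p : M) :
    quadAt (fun p => -g p) p = -quadAt g p := by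
  ext v
  simp [quadAt_apply]

/-- A basis of a maximal positive definite subspace at p₀ extends to smooth fields. Their span stays
positive definite, of the same dimension, at nearby points. Only continuity on pairs of fields is
assumed, so that the lemma also applies to -g. -/
theorem eventually_sigPos_le (hg : ∀ X Y : VField I M, SmoothVF X → SmoothVF Y →
    Continuous (pair g X Y)) (p₀ : M) :
    ∀ᶠ p in 𝓝 p₀, sigPos (quadAt g p₀) ≤ sigPos (quadAt g p) := by
  obtain ⟨V, hV, hpos⟩ := exists_finrank_eq_sigPos_and_posDef (quadAt g p₀)
  obtain ⟨k, hk⟩ : ∃ k, Module.finrank ℝ V = k := ⟨_, rfl⟩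
  let b := Module.finBasisOfFinrankEq ℝ V hk
  choose X hX hXp using fun i => exists_smoothVF_eq (I := I) (b i : TangentSpace I p₀)
  let A : (p : M) → (Fin k → ℝ) →ₗ[ℝ] TangentSpace I p := fun p =>
    Fintype.linearCombination ℝ (fun i => X i p)
  have hA : ∀ p a, A p a = ∑ i, a i • X i p := fun p a => Fintype.linearCombination_apply ℝ _ a
  let Q : M × (Fin k → ℝ) → ℝ := fun z => g z.1 (A z.1 z.2) (A z.1 z.2)
  have hQ : Continuous Q := by
    have e : Q = fun z => ∑ i, ∑ j, z.2 j * (z.2 i * pair g (X j) (X i) z.1) := by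
      funext z
      simp only [Q, hA, map_sum, map_smul, sum_apply, smul_apply, smul_eq_mul, pair]
      refine Finset.sum_congr rfl fun i _ => ?_
      rw [Finset.mul_sum]
      exact Finset.sum_congr rfl fun j _ => by ring
    rw [e]
    refine continuous_finsetSum _ fun i _ => continuous_finsetSum _ fun j _ => ?_
    have := (hg _ _ (hX j) (hX i)).comp (continuous_fst (X := M) (Y := Fin k → ℝ))
    exact ((continuous_apply j).comp continuous_snd).mul
      (((continuous_apply i).comp continuous_snd).mul this)
  have h0 : ∀ a ∈ Metric.sphere (0 : Fin k → ℝ) 1, 0 < Q (p₀, a) := by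
    intro a ha
    have e : A p₀ a = ((∑ i, a i • b i : V) : TangentSpace I p₀) := by
      simp [hA, hXp]
    have hne : (∑ i, a i • b i : V) ≠ 0 := by
      intro h
      have := Fintype.linearIndependent_iff.1 b.linearIndependent a h
      have : a = 0 := funext this
      simp [this] at ha
    have := hpos _ hne
    simpa [Q, e, quadAt_apply, QuadraticMap.restrict] using this
  -- Compactness of the unit sphere of coefficients makes positivity hold for all directions on one
  -- neighbourhood; quadratic scaling then extends it to all nonzero coefficients.
  have hev : ∀ᶠ p in 𝓝 p₀, ∀ a ∈ Metric.sphere (0 : Fin k → ℝ) 1, 0 < Q (p, a) :=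
    (isCompact_sphere _ _).eventually_forall_of_forall_eventually fun a ha =>
      (hQ.continuousAt.eventually (lt_mem_nhds (h0 a ha)))
  filter_upwards [hev] with p hp
  have hp' : ∀ a : Fin k → ℝ, a ≠ 0 → 0 < Q (p, a) := by
    intro a ha
    have hn : ‖a‖ ≠ 0 := norm_ne_zero_iff.2 ha
    have h1 := hp (‖a‖⁻¹ • a) (by simp [norm_smul, hn])
    have e : Q (p, ‖a‖⁻¹ • a) = ‖a‖⁻¹ * (‖a‖⁻¹ * Q (p, a)) := by
      simp [Q]
    rw [e] at h1
    have h2 : 0 < ‖a‖⁻¹ := inv_pos.2 (norm_pos_iff.2 ha)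
    exact pos_of_mul_pos_right (pos_of_mul_pos_right h1 h2.le) h2.le
  -- A coefficient vector in the kernel would have Q = 0, so positivity also keeps the fields
  -- independent.
  have hinj : Function.Injective (A p) := by
    rw [← LinearMap.ker_eq_bot, LinearMap.ker_eq_bot']
    intro a ha
    by_contra hne
    have := hp' a hne
    simp [Q, ha] at this
  have hfin : Module.finrank ℝ (LinearMap.range (A p)) = k := by
    rw [LinearMap.finrank_range_of_inj hinj]; simp
  rw [← hV, hk, ← hfin]
  refine le_sigPos_of_posDef _ ?_
  rintro ⟨_, a, rfl⟩ hne
  refine hp' a fun h => hne ?_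
  simp [h]

theorem IsSingularMetric.eventually_sigPos_le (hg : IsSingularMetric g) (p₀ : M) :
    ∀ᶠ p in 𝓝 p₀, sigPos (quadAt g p₀) ≤ sigPos (quadAt g p) :=
  SingularGeometry.eventually_sigPos_le (fun _ _ hX hY => (hg.smooth_pair hX hY).continuous) p₀

theorem IsSingularMetric.eventually_sigNeg_le (hg : IsSingularMetric g) (p₀ : M) :
    ∀ᶠ p in 𝓝 p₀, sigNeg (quadAt g p₀) ≤ sigNeg (quadAt g p) := by
  have h := SingularGeometry.eventually_sigPos_le (g := fun p => -g p)
    (fun X Y hX hY => by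
      have : pair (fun p => -g p) X Y = -pair g X Y := by funext p; simp [pair]
      rw [this]
      exact (hg.smooth_pair hX hY).continuous.neg) p₀
  simpa only [quadAt_neg, sigPos_neg] using h

/-- The rank of `g` at `p`. -/
def rankAt (g : BilinField I M) (p : M) : ℕ := sigPos (quadAt g p) + sigNeg (quadAt g p)

/-- Neither index can drop nearby; if their sum does not grow, both are constant. -/
theorem IsSingularMetric.mem_constSig_of_rankAt_le (hg : IsSingularMetric g) {p : M}
    (h : ∀ᶠ q in 𝓝 p, rankAt g q ≤ rankAt g p) : p ∈ constSig g := by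
  filter_upwards [h, hg.eventually_sigPos_le p, hg.eventually_sigNeg_le p] with q h1 h2 h3
  simp only [rankAt] at h1
  exact Prod.ext (by simp only [signature]; omega) (by simp only [signature]; omega)

theorem rankAt_eq_of_mem_constSig {p : M} (h : p ∈ constSig g) :
    ∀ᶠ q in 𝓝 p, rankAt g q = rankAt g p := by
  filter_upwards [h] with q hq
  have h1 := congrArg Prod.fst hq
  have h2 := congrArg Prod.snd hq
  simp only [signature] at h1 h2
  rw [rankAt, rankAt, h1, h2]

/-- The radical of `g` at `p`. -/
def radicalAt (g : BilinField I M) (p : M) : Submodule ℝ (TangentSpace I p) :=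
  LinearMap.ker (g p).toLinearMap

theorem mem_radicalAt {p : M} {v : TangentSpace I p} :
    v ∈ radicalAt g p ↔ ∀ w, g p v w = 0 := by
  rw [radicalAt, LinearMap.mem_ker]
  exact ContinuousLinearMap.ext_iff

/-- Sylvester's law counts the radical of the quadratic form, which by polarization is the kernel of
g_p. -/
theorem rankAt_add_finrank_radicalAt
    (hs : ∀ (p : M) (v w : TangentSpace I p), g p v w = g p w v) (p : M) :
    rankAt g p + Module.finrank ℝ (radicalAt g p) = Module.finrank ℝ E := by
  have h := QuadraticForm.sigPos_add_sigNeg_add_radical (Q := quadAt g p)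
  have e : (quadAt g p).radical = radicalAt g p := by
    ext v
    rw [QuadraticMap.mem_radical_iff', mem_radicalAt]
    simp only [quadAt_apply, map_add, add_apply]
    constructor
    · rintro ⟨h1, h2⟩ w
      have := h2 w
      rw [h1, hs p w v] at this
      linarith
    · intro h
      exact ⟨h v, fun w => by rw [hs p w v, h v, h w]; ring⟩
  rw [e] at h
  exact h

/-- The rank is bounded by the dimension, hence attains a maximum on each nonempty open set, and
near such a maximum the signature is constant. -/
theorem IsSingularMetric.dense_constSig (hg : IsSingularMetric g) : Dense (constSig g) := by
  rw [dense_iff_inter_open]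
  intro O hO hne
  have hbdd : ∀ p, rankAt g p ≤ Module.finrank ℝ E := fun p => by
    have := rankAt_add_finrank_radicalAt hg.symm p
    omega
  obtain ⟨p, hp, hmax⟩ : ∃ p ∈ O, ∀ q ∈ O, rankAt g q ≤ rankAt g p := by
    have hfin : (rankAt g '' O).Finite :=
      (Set.finite_Iic (Module.finrank ℝ E)).subset (by rintro _ ⟨p, -, rfl⟩; exact hbdd p)
    obtain ⟨_, ⟨p, hp, rfl⟩, hmax⟩ := hfin.exists_maximal (hne.image _)
    exact ⟨p, hp, fun q hq => by
      rcases le_total (rankAt g q) (rankAt g p) with h | h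
      · exact h
      · exact hmax ⟨q, hq, rfl⟩ h⟩
  exact ⟨p, hp, hg.mem_constSig_of_rankAt_le (by
    filter_upwards [hO.mem_nhds hp] with q hq using hmax q hq)⟩

end Signature

/-! ### Calculus of covariant derivatives in A^•, and reduction to local frames. -/

section CovariantDerivative

variable {E : Type*} [NormedAddCommGroup E] [NormedSpace ℝ E] [FiniteDimensional ℝ E]
  {H : Type*} [TopologicalSpace H] {I : ModelWithCorners ℝ E H}
  {M : Type*} [TopologicalSpace M] [ChartedSpace H M] [IsManifold I ∞ M] [T2Space M]
  {g : BilinField I M}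

/-- Radical-stationary metrics: all the 1-forms `∇^♭_X Y` are in `A^•(M)`. -/
structure IsRadicalStationary (g : BilinField I M) : Prop where
  metric : IsSingularMetric g
  isRadAnn : ∀ X Y, SmoothVF X → SmoothVF Y → IsRadAnn g (koszul g X Y)

theorem IsSemiRegular.isRadicalStationary (h : IsSemiRegular g) : IsRadicalStationary g :=
  ⟨h.metric, h.radicalStationary⟩

/-- `η ∈ A^•(M)` is the covariant derivative `∇_Z α` of `α ∈ A^•(M)`. -/
structure IsCov (g : BilinField I M) (Z : VField I M) (α η : FormMap I M) : Prop where
  source : IsRadAnn g α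
  target : IsRadAnn g η
  eq : ∀ T, SmoothVF T → ∀ p ∈ constSig g, η T p = covDerivConst g (koszul g) Z α T p

theorem IsSemiRegular.exists_isCov (h : IsSemiRegular g) {X Y Z : VField I M} (hX : SmoothVF X)
    (hY : SmoothVF Y) (hZ : SmoothVF Z) : ∃ η, IsCov g Z (koszul g X Y) η := by
  obtain ⟨η, h1, h2⟩ := h.covDeriv_radAnn X Y Z hX hY hZ
  exact ⟨η, h.radicalStationary X Y hX hY, h1, h2⟩

/-! ### Rules of calculation -/

theorem covDerivConst_congr {Z Z' : VField I M} {α α' : FormMap I M} {p : M} {T : VField I M}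
    (hZ : Z =ᶠ[𝓝 p] Z') (hα : ∀ᶠ q in 𝓝 p, ∀ T, SmoothVF T → α T q = α' T q)
    (hT : SmoothVF T) :
    covDerivConst g (koszul g) Z α T p = covDerivConst g (koszul g) Z' α' T p := by
  simp only [covDerivConst]
  rw [dir_congr hZ.self_of_nhds (hα.mono fun q hq => hq T hT),
    coInner_congr (fun S _ => koszul_congr hZ (Filter.EventuallyEq.refl _ T)) hα.self_of_nhds]

theorem IsCov.congr {Z : VField I M} {α α' η η' : FormMap I M} (h : IsCov g Z α η)
    (hα : ∀ T, SmoothVF T → α' T = α T) (hη : ∀ T, SmoothVF T → η' T = η T) :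
    IsCov g Z α' η' where
  source := h.source.congr hα
  target := h.target.congr hη
  eq T hT p hp := by
    rw [hη T hT, h.eq T hT p hp]
    exact covDerivConst_congr (Filter.EventuallyEq.refl _ Z)
      (.of_forall fun q T hT => by rw [hα T hT]) hT

/-- Replacing X by hX adds Z(h)α(X) to the derivative term, and also ⟨⟨Z(h)X^♭, α⟩⟩ = Z(h)α(X) to
the inner product; the two cancel. -/
theorem IsRadicalStationary.isTensorAt_covDerivConst (hg : IsRadicalStationary g)
    {Z : VField I M} (hZ : SmoothVF Z) {α : FormMap I M} (hα : IsRadAnn g α) (p : M) :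
    IsTensorAt (fun T => covDerivConst g (koszul g) Z α T p) p where
  add X Y hX hY := by
    simp only [covDerivConst]
    have e : coInner g (koszul g Z (X + Y)) α p =
        coInner g (koszul g Z X + koszul g Z Y) α p :=
      coInner_congr (fun T hT => hg.metric.koszul_add_middle hZ hX hY hT p) (fun _ _ => rfl)
    rw [e, hα.oneForm.add X Y hX hY, dir_add (hα.oneForm.smooth X hX) (hα.oneForm.smooth Y hY),
      hg.metric.coInner_add_left ((hg.isRadAnn Z X hZ hX).flat p) ((hg.isRadAnn Z Y hZ hY).flat p)
      (hα.flat p)]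
    ring
  smul h X hh hX := by
    simp only [covDerivConst]
    have e : coInner g (koszul g Z (fun p => h p • X p)) α p =
        coInner g (fmul h (koszul g Z X) + fmul (dir Z h) (flatForm g X)) α p :=
      coInner_congr (fun T hT => hg.metric.koszul_smul_middle hh hZ hX hT p) (fun _ _ => rfl)
    have h1 := (hg.isRadAnn Z X hZ hX).flat p
    have h2 := (hg.metric.isRadAnn_flatForm hX).flat p
    rw [e, hα.oneForm.smul h X hh hX, dir_mul hh (hα.oneForm.smooth X hX),
      hg.metric.coInner_add_left (((hg.isRadAnn Z X hZ hX).fmul hh).flat p)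
        (((hg.metric.isRadAnn_flatForm hX).fmul (.dir hZ hh)).flat p) (hα.flat p),
      hg.metric.coInner_fmul_left h h1 (hα.flat p), hg.metric.coInner_fmul_left _ h2 (hα.flat p),
      hg.metric.coInner_flatForm hX (hα.flat p)]
    ring

theorem IsRadicalStationary.isCov_add (hg : IsRadicalStationary g) {Z : VField I M}
    (hZ : SmoothVF Z) {α β η θ : FormMap I M} (h : IsCov g Z α η) (h' : IsCov g Z β θ) :
    IsCov g Z (α + β) (η + θ) where
  source := h.source.add h'.source
  target := h.target.add h'.target
  eq T hT p hp := by
    rw [add_form_apply, h.eq T hT p hp, h'.eq T hT p hp]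
    simp only [covDerivConst]
    rw [hg.metric.coInner_add_right (h.source.flat p) (h'.source.flat p)
      ((hg.isRadAnn Z T hZ hT).flat p), Pi.add_apply,
      dir_add (h.source.oneForm.smooth T hT) (h'.source.oneForm.smooth T hT)]
    ring

theorem IsRadicalStationary.isCov_fmul (hg : IsRadicalStationary g) {Z : VField I M}
    (hZ : SmoothVF Z) {h : M → ℝ} (hh : SmoothFun I h) {α η : FormMap I M}
    (hc : IsCov g Z α η) : IsCov g Z (fmul h α) (fmul h η + fmul (dir Z h) α) where
  source := hc.source.fmul hh
  target := (hc.target.fmul hh).add (hc.source.fmul (.dir hZ hh))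
  eq T hT p hp := by
    rw [add_form_apply, fmul_apply, fmul_apply, hc.eq T hT p hp]
    simp only [covDerivConst]
    rw [hg.metric.coInner_fmul_right h (hc.source.flat p) ((hg.isRadAnn Z T hZ hT).flat p)]
    change _ = dir Z (h * α T) p - _
    rw [dir_mul hh (hc.source.oneForm.smooth T hT)]
    ring

theorem IsRadicalStationary.isCov_zero (hg : IsRadicalStationary g) {Z : VField I M}
    (hZ : SmoothVF Z) : IsCov g Z 0 0 where
  source := isRadAnn_zero g
  target := isRadAnn_zero g
  eq T hT p hp := by
    obtain ⟨v, hv⟩ := (hg.isRadAnn Z T hZ hT).flat p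
    simp only [covDerivConst]
    rw [hg.metric.coInner_eq hv (isFlatOfAt_zero g p)]
    change 0 = dir Z (fun _ => 0) p - _
    rw [dir_const]
    simp

theorem IsRadicalStationary.exists_isCov_sum (hg : IsRadicalStationary g) {Z : VField I M}
    (hZ : SmoothVF Z) {ι : Type*} {s : Finset ι} {α : ι → FormMap I M}
    (h : ∀ i ∈ s, ∃ η, IsCov g Z (α i) η) : ∃ η, IsCov g Z (∑ i ∈ s, α i) η := by
  classical
  induction s using Finset.induction_on with
  | empty => exact ⟨0, by simpa using hg.isCov_zero hZ⟩
  | insert a s ha ih =>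
    simp only [Finset.mem_insert, forall_eq_or_imp] at h
    obtain ⟨η, hη⟩ := h.1
    obtain ⟨θ, hθ⟩ := ih h.2
    rw [Finset.sum_insert ha]
    exact ⟨_, hg.isCov_add hZ hη hθ⟩

theorem IsRadicalStationary.isCov_add_vf (hg : IsRadicalStationary g) {Z Z' : VField I M}
    (hZ : SmoothVF Z) (hZ' : SmoothVF Z') {α η θ : FormMap I M}
    (h : IsCov g Z α η) (h' : IsCov g Z' α θ) : IsCov g (Z + Z') α (η + θ) where
  source := h.source
  target := h.target.add h'.target
  eq T hT p hp := by
    rw [add_form_apply, h.eq T hT p hp, h'.eq T hT p hp]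
    have e : coInner g (koszul g (Z + Z') T) α p =
        coInner g (koszul g Z T + koszul g Z' T) α p :=
      coInner_congr (fun S hS => hg.metric.koszul_add_left hZ hZ' hT hS p) (fun _ _ => rfl)
    simp only [covDerivConst]
    rw [e, hg.metric.coInner_add_left ((hg.isRadAnn Z T hZ hT).flat p)
      ((hg.isRadAnn Z' T hZ' hT).flat p) (h.source.flat p), dir_add_vf]
    ring

theorem IsRadicalStationary.isCov_smul_vf (hg : IsRadicalStationary g) {Z : VField I M}
    (hZ : SmoothVF Z) {h : M → ℝ} (hh : SmoothFun I h) {α η : FormMap I M}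
    (hc : IsCov g Z α η) : IsCov g (fun p => h p • Z p) α (fmul h η) where
  source := hc.source
  target := hc.target.fmul hh
  eq T hT p hp := by
    rw [fmul_apply, hc.eq T hT p hp]
    have e : coInner g (koszul g (fun p => h p • Z p) T) α p =
        coInner g (fmul h (koszul g Z T)) α p :=
      coInner_congr (fun S hS => hg.metric.koszul_smul_left hh hZ hT hS p) (fun _ _ => rfl)
    simp only [covDerivConst]
    rw [e, hg.metric.coInner_fmul_left h ((hg.isRadAnn Z T hZ hT).flat p) (hc.source.flat p),
      dir_smul_vf]
    ring

theorem IsRadicalStationary.exists_isCov_sum_vf (hg : IsRadicalStationary g) {ι : Type*}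
    {s : Finset ι} {Z : ι → VField I M} (hZ : ∀ i ∈ s, SmoothVF (Z i)) {α : FormMap I M}
    (hα : IsRadAnn g α) (h : ∀ i ∈ s, ∃ η, IsCov g (Z i) α η) :
    ∃ η, IsCov g (fun p => ∑ i ∈ s, Z i p) α η := by
  classical
  induction s using Finset.induction_on with
  | empty =>
    refine ⟨0, hα, isRadAnn_zero g, fun T hT p hp => ?_⟩
    have e : coInner g (koszul g 0 T) α p = coInner g 0 α p :=
      coInner_congr (fun S hS => (hg.metric.isTensorAt_koszul hT hS p).zero) (fun _ _ => rfl)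
    obtain ⟨v, hv⟩ := hα.flat p
    simp only [covDerivConst, Finset.sum_empty]
    change 0 = dir (0 : VField I M) (α T) p - coInner g (koszul g 0 T) α p
    rw [e, hg.metric.coInner_eq (isFlatOfAt_zero g p) hv, dir_zero_vf]
    simp
  | insert a s ha ih =>
    simp only [Finset.mem_insert, forall_eq_or_imp] at h hZ
    obtain ⟨η, hη⟩ := h.1
    obtain ⟨θ, hθ⟩ := ih hZ.2 h.2
    simp only [Finset.sum_insert ha]
    exact ⟨_, hg.isCov_add_vf hZ.1 (.sum hZ.2) hη hθ⟩

/-- The metric compatibility `∇_Z X^♭ = ∇^♭_Z X`. -/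
theorem IsRadicalStationary.isCov_flatForm (hg : IsRadicalStationary g) {Z X : VField I M}
    (hZ : SmoothVF Z) (hX : SmoothVF X) : IsCov g Z (flatForm g X) (koszul g Z X) where
  source := hg.metric.isRadAnn_flatForm hX
  target := hg.isRadAnn Z X hZ hX
  eq T hT p hp := by
    have h1 := (hg.metric.isRadAnn_flatForm hX).flat p
    have h2 := (hg.isRadAnn Z T hZ hT).flat p
    simp only [covDerivConst]
    rw [hg.metric.coInner_comm h2 h1, hg.metric.coInner_flatForm hX h2]
    change _ = dir Z (pair g X T) p - _
    rw [← hg.metric.koszul_compat]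
    ring

/-! ### Extension by continuity and gluing -/

theorem IsSingularMetric.eq_of_eqOn_constSig (hg : IsSingularMetric g) {h k : M → ℝ} {p : M}
    (hh : SmoothFun I h) (hk : SmoothFun I k)
    (he : ∀ᶠ q in 𝓝 p, q ∈ constSig g → h q = k q) : h p = k p := by
  have hne : (𝓝[constSig g] p).NeBot := mem_closure_iff_nhdsWithin_neBot.1 (hg.dense_constSig p)
  have h1 : Filter.Tendsto h (𝓝[constSig g] p) (𝓝 (h p)) :=
    hh.continuous.continuousAt.tendsto.mono_left nhdsWithin_le_nhds
  have h2 : Filter.Tendsto k (𝓝[constSig g] p) (𝓝 (k p)) :=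
    hk.continuous.continuousAt.tendsto.mono_left nhdsWithin_le_nhds
  refine tendsto_nhds_unique_of_eventuallyEq h1 h2 ?_
  filter_upwards [nhdsWithin_le_nhds he, self_mem_nhdsWithin] with q hq hq' using hq hq'

/-- A continuous function that agrees with the covariant derivative on the dense set of constant
signature is its extension. This is how `extendFrom` is evaluated throughout. -/
theorem IsSingularMetric.covDeriv_eq (hg : IsSingularMetric g)
    {K : VField I M → VField I M → FormMap I M} {Z T : VField I M} {α : FormMap I M} {h : M → ℝ}
    (hh : SmoothFun I h) (he : ∀ p ∈ constSig g, h p = covDerivConst g K Z α T p) (p : M) :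
    covDeriv g K Z α T p = h p := by
  refine extendFrom_eq (hg.dense_constSig p) ?_
  refine (hh.continuous.continuousAt.tendsto.mono_left nhdsWithin_le_nhds).congr' ?_
  filter_upwards [self_mem_nhdsWithin] with q hq using he q hq

theorem IsCov.covDeriv_eq {Z T : VField I M} {α η : FormMap I M} (h : IsCov g Z α η)
    (hg : IsSingularMetric g) (hT : SmoothVF T) (p : M) :
    covDeriv g (koszul g) Z α T p = η T p :=
  hg.covDeriv_eq (h.target.oneForm.smooth T hT) (h.eq T hT) p

/-- Local derivatives glue because they are smooth and agree on the dense regions of constant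
signature. No partition of unity is needed: at p the glued form takes the value of the local form
chosen for p. -/
theorem IsSingularMetric.exists_isCov_of_local (hg : IsSingularMetric g) {Z : VField I M}
    {α : FormMap I M} (hα : IsRadAnn g α)
    (h : ∀ p₀, ∃ Z' α' η', IsCov g Z' α' η' ∧ Z =ᶠ[𝓝 p₀] Z' ∧
      ∀ᶠ p in 𝓝 p₀, ∀ T, SmoothVF T → α T p = α' T p) : ∃ η, IsCov g Z α η := by
  choose Z' α' η' hc hZ' hα' using h
  have hloc : ∀ p₀, ∀ᶠ p in 𝓝 p₀, ∀ T, SmoothVF T → p ∈ constSig g →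
      η' p₀ T p = covDerivConst g (koszul g) Z α T p := by
    intro p₀
    filter_upwards [(hZ' p₀).eventually_nhds, (hα' p₀).eventually_nhds] with p h1 h2 T hT hp
    rw [(hc p₀).eq T hT p hp]
    exact (covDerivConst_congr h1 h2 hT).symm
  -- The form chosen at p and the one chosen at p₀ agree at p: both compute the same derivative near
  -- p on a dense set, and both are continuous.
  have hglue : ∀ p₀, ∀ᶠ p in 𝓝 p₀, ∀ T, SmoothVF T → η' p T p = η' p₀ T p := by
    intro p₀
    filter_upwards [(hloc p₀).eventually_nhds] with p hp T hT
    refine hg.eq_of_eqOn_constSig ((hc p).target.oneForm.smooth T hT)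
      ((hc p₀).target.oneForm.smooth T hT) ?_
    filter_upwards [hp, hloc p] with q h1 h2 hq
    rw [h1 T hT hq, h2 T hT hq]
  refine ⟨fun T p => η' p T p, hα, ⟨⟨?_, ?_, ?_⟩, ?_⟩, ?_⟩
  · exact fun X hX => SmoothFun.congr_local fun p =>
      ⟨η' p X, (hc p).target.oneForm.smooth X hX, (hglue p).mono fun q hq => hq X hX⟩
  · intro X Y hX hY
    funext p
    simp [(hc p).target.oneForm.add X Y hX hY]
  · intro k X hk hX
    funext p
    simp [(hc p).target.oneForm.smul k X hk hX]
  · exact fun p => (hc p).target.flat p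
  · exact fun T hT p hp => (hloc p).self_of_nhds T hT hp

/-- Semi-regularity can be checked on the vector fields of local frames. -/
theorem IsSingularMetric.isSemiRegular_of_frames (hg : IsSingularMetric g)
    (h : ∀ p₀ : M, ∃ (ι : Type) (_ : Fintype ι) (e : ι → VField I M), (∀ i, SmoothVF (e i)) ∧
      (∀ X, SmoothVF X → ∃ c : ι → M → ℝ, (∀ i, SmoothFun I (c i)) ∧
        ∀ᶠ p in 𝓝 p₀, X p = ∑ i, c i p • e i p) ∧
      (∀ i j, IsRadAnn g (koszul g (e i) (e j))) ∧
      (IsRadicalStationary g → ∀ i j k, ∃ η, IsCov g (e k) (koszul g (e i) (e j)) η)) :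
    IsSemiRegular g := by
  -- The expansion of ∇^♭_X Y near p₀: the Leibniz rule in Y produces the terms X(y_j)e_j^♭, while X
  -- enters tensorially.
  have hexp : ∀ (p₀ : M) (ι : Type) (_ : Fintype ι) (e : ι → VField I M) (_ : ∀ i, SmoothVF (e i))
      (X Y : VField I M) (_ : SmoothVF X) (x y : ι → M → ℝ) (_ : ∀ i, SmoothFun I (x i))
      (_ : ∀ i, SmoothFun I (y i)) (_ : ∀ᶠ p in 𝓝 p₀, X p = ∑ i, x i p • e i p)
      (_ : ∀ᶠ p in 𝓝 p₀, Y p = ∑ i, y i p • e i p),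
      ∀ᶠ p in 𝓝 p₀, ∀ T, SmoothVF T → koszul g X Y T p =
        (∑ j, (fmul (y j) (∑ i, fmul (x i) (koszul g (e i) (e j)))
          + fmul (dir X (y j)) (flatForm g (e j)))) T p := by
    intro p₀ ι _ e he X Y hX x y hx hy hXe hYe
    filter_upwards [hXe.eventually_nhds, hYe.eventually_nhds] with p hp1 hp2 T hT
    rw [koszul_congr (Filter.EventuallyEq.refl _ X) hp2,
      hg.koszul_sum_middle _ hX (fun j _ => (he j).smul (hy j)) hT]
    simp only [Finset.sum_apply, add_form_apply, fmul_apply, flatForm_apply]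
    refine Finset.sum_congr rfl fun j _ => ?_
    rw [hg.koszul_smul_middle (hy j) hX (he j) hT]
    congr 2
    rw [koszul_congr hp1 (Filter.EventuallyEq.refl _ (e j)),
      (hg.isTensorAt_koszul (he j) hT p).sum _ (fun i _ => (he i).smul (hx i))]
    refine Finset.sum_congr rfl fun i _ => ?_
    exact hg.koszul_smul_left (hx i) (he i) (he j) hT p
  -- This is settled before any derivative is taken, because the rules for `IsCov` and the
  -- hypothesis on derivatives in the frame both presuppose it.
  have hrad : IsRadicalStationary g := by
    refine ⟨hg, fun X Y hX hY => ⟨hg.isOneForm_koszul hX hY, fun p₀ => ?_⟩⟩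
    obtain ⟨ι, _, e, he, hfr, hr, -⟩ := h p₀
    obtain ⟨x, hx, hXe⟩ := hfr X hX
    obtain ⟨y, hy, hYe⟩ := hfr Y hY
    have hK := (hexp p₀ ι _ e he X Y hX x y hx hy hXe hYe).self_of_nhds
    have hR : IsRadAnn g (∑ j, (fmul (y j) (∑ i, fmul (x i) (koszul g (e i) (e j)))
          + fmul (dir X (y j)) (flatForm g (e j)))) :=
      .sum fun j _ => ((IsRadAnn.sum fun i _ => (hr i j).fmul (hx i)).fmul (hy j)).add
        ((hg.isRadAnn_flatForm (he j)).fmul (.dir hX (hy j)))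
    exact (hR.flat p₀).imp fun v hv => hv.congr hK
  refine ⟨hg, hrad.isRadAnn, fun X Y Z hX hY hZ => ?_⟩
  suffices ∃ η, IsCov g Z (koszul g X Y) η by
    obtain ⟨η, hη⟩ := this
    exact ⟨η, hη.target, hη.eq⟩
  refine hg.exists_isCov_of_local (hrad.isRadAnn X Y hX hY) fun p₀ => ?_
  obtain ⟨ι, _, e, he, hfr, hr, hE⟩ := h p₀
  obtain ⟨x, hx, hXe⟩ := hfr X hX
  obtain ⟨y, hy, hYe⟩ := hfr Y hY
  obtain ⟨z, hz, hZe⟩ := hfr Z hZ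
  have hR : IsRadAnn g (∑ j, (fmul (y j) (∑ i, fmul (x i) (koszul g (e i) (e j)))
          + fmul (dir X (y j)) (flatForm g (e j)))) :=
      .sum fun j _ => ((IsRadAnn.sum fun i _ => (hr i j).fmul (hx i)).fmul (hy j)).add
        ((hg.isRadAnn_flatForm (he j)).fmul (.dir hX (hy j)))
  -- The frame expansion involves only derivatives known to exist: those of the frame Koszul forms
  -- by hypothesis, and ∇ e_j^♭ by metric compatibility.
  have key : ∃ η, IsCov g (fun p => ∑ k, z k p • e k p)
      (∑ j, (fmul (y j) (∑ i, fmul (x i) (koszul g (e i) (e j)))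
          + fmul (dir X (y j)) (flatForm g (e j)))) η := by
    refine hrad.exists_isCov_sum_vf (fun k _ => (he k).smul (hz k)) hR fun k _ => ?_
    have : ∃ η, IsCov g (e k) (∑ j, (fmul (y j) (∑ i, fmul (x i) (koszul g (e i) (e j)))
          + fmul (dir X (y j)) (flatForm g (e j)))) η := by
      refine hrad.exists_isCov_sum (he k) fun j _ => ?_
      obtain ⟨η₁, h₁⟩ := hrad.exists_isCov_sum (he k) (s := Finset.univ)
        (α := fun i => fmul (x i) (koszul g (e i) (e j))) fun i _ => by
          obtain ⟨η, hη⟩ := hE hrad i j k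
          exact ⟨_, hrad.isCov_fmul (he k) (hx i) hη⟩
      exact ⟨_, hrad.isCov_add (he k) (hrad.isCov_fmul (he k) (hy j) h₁)
        (hrad.isCov_fmul (he k) (.dir hX (hy j)) (hrad.isCov_flatForm (he k) (he j)))⟩
    obtain ⟨η, hη⟩ := this
    exact ⟨_, hrad.isCov_smul_vf (he k) (hz k) hη⟩
  obtain ⟨η, hη⟩ := key
  exact ⟨_, _, η, hη, hZe, hexp p₀ ι _ e he X Y hX x y hx hy hXe hYe⟩

end CovariantDerivative

/-! ### Comparison of the semi-symmetric derivative and curvature with the ordinary ones. -/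

section SemiSymmetric

variable {E : Type*} [NormedAddCommGroup E] [NormedSpace ℝ E] [FiniteDimensional ℝ E]
  {H : Type*} [TopologicalSpace H] {I : ModelWithCorners ℝ E H}
  {M : Type*} [TopologicalSpace M] [ChartedSpace H M] [IsManifold I ∞ M] [T2Space M]
  {g : BilinField I M} {P : VField I M}

/-! ### The semi-symmetric metric covariant derivative -/

theorem koszulSS_eq (g : BilinField I M) (P X Y : VField I M) :
    koszulSS g P X Y = koszul g X Y + fmul (pair g Y P) (flatForm g X)
      + fmul (-pair g X Y) (flatForm g P) := by
  funext T p
  simp only [koszulSS, add_form_apply, fmul_apply, flatForm_apply, Pi.neg_apply]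
  ring

theorem IsRadicalStationary.isRadAnn_koszulSS (hg : IsRadicalStationary g) (hP : SmoothVF P)
    {X Y : VField I M} (hX : SmoothVF X) (hY : SmoothVF Y) : IsRadAnn g (koszulSS g P X Y) := by
  rw [koszulSS_eq]
  exact ((hg.isRadAnn X Y hX hY).add ((hg.metric.isRadAnn_flatForm hX).fmul
    (hg.metric.smooth_pair hY hP))).add ((hg.metric.isRadAnn_flatForm hP).fmul
    (hg.metric.smooth_pair hX hY).neg)

/-- The correction to ∇^♭_Z T is a combination of Z^♭ and P^♭, and pairing these with α evaluates α
at Z and P. So the two derivatives differ by tensorial terms that are smooth on all of M. -/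
theorem IsRadicalStationary.covDerivConst_koszulSS (hg : IsRadicalStationary g)
    (hP : SmoothVF P) {Z T : VField I M} (hZ : SmoothVF Z) (hT : SmoothVF T) {α : FormMap I M}
    (hα : IsRadAnn g α) (p : M) :
    covDerivConst g (koszulSS g P) Z α T p = covDerivConst g (koszul g) Z α T p
      + α P p * pair g Z T p - α Z p * pair g P T p := by
  have h1 := hg.metric.isRadAnn_flatForm hZ
  have h2 := hg.metric.isRadAnn_flatForm hP
  have h3 := hg.metric.smooth_pair hT hP
  have h4 := (hg.metric.smooth_pair hZ hT).neg
  have h5 := hg.isRadAnn Z T hZ hT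
  simp only [covDerivConst]
  rw [koszulSS_eq, hg.metric.coInner_add_left ((h5.add (h1.fmul h3)).flat p) ((h2.fmul h4).flat p)
    (hα.flat p), hg.metric.coInner_add_left (h5.flat p) ((h1.fmul h3).flat p) (hα.flat p),
    hg.metric.coInner_fmul_left _ (h1.flat p) (hα.flat p),
    hg.metric.coInner_fmul_left _ (h2.flat p) (hα.flat p),
    hg.metric.coInner_flatForm hZ (hα.flat p), hg.metric.coInner_flatForm hP (hα.flat p),
    hg.metric.pair_comm T P, Pi.neg_apply]
  ring

/-- The covariant derivative of `∇̄^♭_X Y` in the direction of `Z`, in terms of that of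
`∇^♭_X Y`. -/
def covSS (g : BilinField I M) (P X Y Z : VField I M) (η : FormMap I M) : FormMap I M :=
  (η + (fmul (pair g Y P) (koszul g Z X) + fmul (dir Z (pair g Y P)) (flatForm g X))
    + (fmul (-pair g X Y) (koszul g Z P) + fmul (dir Z (-pair g X Y)) (flatForm g P)))
    + fmul (koszulSS g P X Y P) (flatForm g Z) + fmul (-koszulSS g P X Y Z) (flatForm g P)

theorem IsRadicalStationary.isRadAnn_covSS (hg : IsRadicalStationary g) (hP : SmoothVF P)
    {X Y Z : VField I M} (hX : SmoothVF X) (hY : SmoothVF Y) (hZ : SmoothVF Z) {η : FormMap I M}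
    (h : IsCov g Z (koszul g X Y) η) :
    IsRadAnn g (covSS g P X Y Z η) ∧ ∀ T, SmoothVF T → ∀ p ∈ constSig g,
      covSS g P X Y Z η T p = covDerivConst g (koszulSS g P) Z (koszulSS g P X Y) T p := by
  have hK := hg.isRadAnn_koszulSS hP hX hY
  have hc := hg.isCov_add hZ (hg.isCov_add hZ h (hg.isCov_fmul hZ (hg.metric.smooth_pair hY hP)
    (hg.isCov_flatForm hZ hX))) (hg.isCov_fmul hZ (hg.metric.smooth_pair hX hY).neg
    (hg.isCov_flatForm hZ hP))
  rw [← koszulSS_eq] at hc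
  refine ⟨(hc.target.add ((hg.metric.isRadAnn_flatForm hZ).fmul (hK.oneForm.smooth P hP))).add
    ((hg.metric.isRadAnn_flatForm hP).fmul (hK.oneForm.smooth Z hZ).neg), fun T hT p hp => ?_⟩
  rw [hg.covDerivConst_koszulSS hP hZ hT hK, ← hc.eq T hT p hp]
  simp only [covSS, add_form_apply, fmul_apply, flatForm_apply, Pi.neg_apply]
  ring

/-- All correction terms are smooth multiples of flat forms and of Koszul forms, which stay in A^•;
hence P is arbitrary and no special structure of g is used. -/
theorem IsSemiRegular.isSemiRegularSS (hg : IsSemiRegular g) (hP : SmoothVF P) :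
    IsSemiRegularSS g P where
  metric := hg.metric
  radicalStationary _ _ hX hY := hg.isRadicalStationary.isRadAnn_koszulSS hP hX hY
  covDeriv_radAnn X Y Z hX hY hZ := by
    obtain ⟨η, hη⟩ := hg.exists_isCov hX hY hZ
    exact ⟨_, hg.isRadicalStationary.isRadAnn_covSS hP hX hY hZ hη⟩

/-- The derivatives of P enter only through K(X,P,·) and K(Y,P,·). This reduces the curvature for P
to the ordinary curvature and first-order data, on any semi-regular manifold. -/
theorem IsSemiRegular.curvatureSS_eq (hg : IsSemiRegular g) (hP : SmoothVF P)
    {X Y Z T : VField I M} (hX : SmoothVF X) (hY : SmoothVF Y) (hZ : SmoothVF Z)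
    (hT : SmoothVF T) (p : M) :
    curvatureSS g P X Y Z T p = curvature g X Y Z T p
      + koszul g X P Z p * pair g Y T p - koszul g Y P Z p * pair g X T p
      - pair g Y Z p * koszul g X P T p + pair g X Z p * koszul g Y P T p
      + (pair g Y Z p * pair g P X p - pair g X Z p * pair g P Y p) * pair g P T p
      + (pair g Z P p * pair g Y P p - pair g Y Z p * pair g P P p) * pair g X T p
      - (pair g Z P p * pair g X P p - pair g X Z p * pair g P P p) * pair g Y T p := by
  obtain ⟨η, hη⟩ := hg.exists_isCov hY hZ hX
  obtain ⟨θ, hθ⟩ := hg.exists_isCov hX hZ hY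
  have hr := hg.isRadicalStationary
  have h1 := hr.isRadAnn_covSS hP hY hZ hX hη
  have h2 := hr.isRadAnn_covSS hP hX hZ hY hθ
  have hm := hg.metric
  rw [curvatureSS, curvature, curvatureFor, curvatureFor,
    hm.covDeriv_eq (h1.1.oneForm.smooth T hT) (h1.2 T hT),
    hm.covDeriv_eq (h2.1.oneForm.smooth T hT) (h2.2 T hT),
    hη.covDeriv_eq hm hT, hθ.covDeriv_eq hm hT]
  simp only [covSS, koszulSS, add_form_apply, fmul_apply, flatForm_apply, Pi.neg_apply, dir_neg]
  -- Compatibility removes the derivatives of metric coefficients and torsion removes the brackets;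
  -- what is left is polynomial in K and g.
  have c1 := hm.koszul_compat (X := X) (Y := Z) (Z := P) p
  have c2 := hm.koszul_compat (X := Y) (Y := Z) (Z := P) p
  have c3 := hm.koszul_compat (X := X) (Y := Y) (Z := Z) p
  have c4 := hm.koszul_compat (X := Y) (Y := X) (Z := Z) p
  have t1 := hm.koszul_torsion (X := X) (Y := Y) (Z := T) p
  have t2 := hm.koszul_torsion (X := X) (Y := Y) (Z := Z) p
  rw [← c1, ← c2, ← c3, ← c4, ← t1, ← t2, hm.pair_comm Y X]
  ring

end SemiSymmetric

/-! ### Nondegenerate metrics: every 1-form is in A^• and can be differentiated. -/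

section Nondegenerate

variable {E : Type*} [NormedAddCommGroup E] [NormedSpace ℝ E] [FiniteDimensional ℝ E]
  {H : Type*} [TopologicalSpace H] {I : ModelWithCorners ℝ E H}
  {M : Type*} [TopologicalSpace M] [ChartedSpace H M] [IsManifold I ∞ M] [T2Space M]
  {g : BilinField I M}

/-! ### Nondegenerate metrics -/

theorem smoothFun_det {n : ℕ} {A : M → Matrix (Fin n) (Fin n) ℝ}
    (hA : ∀ i j, SmoothFun I (fun p => A p i j)) : SmoothFun I (fun p => (A p).det) := by
  simp only [Matrix.det_apply', SmoothFun]
  exact contMDiff_finsetSum fun σ _ => contMDiff_const.mul (contMDiff_finsetProd fun i _ => hA _ _)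

/-- Division by a function that does not vanish on the support of the numerator. -/
theorem smoothFun_div_of_tsupport {χ d : M → ℝ} (hχ : SmoothFun I χ) (hd : SmoothFun I d)
    (h : ∀ p ∈ tsupport χ, d p ≠ 0) : SmoothFun I (fun p => χ p / d p) := by
  intro p
  by_cases hp : p ∈ tsupport χ
  · exact (hχ p).div₀ (hd p) (h p hp)
  · refine (contMDiffAt_const (c := (0 : ℝ))).congr_of_eventuallyEq ?_
    filter_upwards [notMem_tsupport_iff_eventuallyEq.1 hp] with q hq
    simp [hq]

theorem IsFrame.eq_sum {n : ℕ} {e : Fin n → VField I M}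
    {c : Fin n → Π p : M, TangentSpace I p → ℝ} {U : Set M} (h : IsFrame e c U)
    {α : FormMap I M} (hα : IsOneForm α) {T : VField I M} (hT : SmoothVF T) {p : M} (hp : p ∈ U) :
    α T p = ∑ i, c i p (T p) * α (e i) p := by
  have hs : ∀ i ∈ (Finset.univ : Finset (Fin n)), SmoothVF (fun q => c i p (T p) • e i q) :=
    fun i _ => (h.smooth i).smul (smoothFun_const (c i p (T p)))
  rw [(hα.isTensorAt p).congr hT (.sum hs) (h.sum_eq p hp _), (hα.isTensorAt p).sum _ hs]
  exact Finset.sum_congr rfl fun i _ =>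
    (hα.isTensorAt p).smul _ _ (smoothFun_const (c i p (T p))) (h.smooth i)

/-- A kernel vector of the Gram matrix is the coefficient vector of a tangent vector orthogonal to
the frame, hence to everything. -/
theorem IsNondegenerate.gram_det_ne_zero (hnd : IsNondegenerate g) {n : ℕ}
    {e : Fin n → VField I M} {c : Fin n → Π p : M, TangentSpace I p → ℝ} {U : Set M}
    (h : IsFrame e c U) (hs : ∀ (p : M) (v w : TangentSpace I p), g p v w = g p w v)
    {p : M} (hp : p ∈ U) : (Matrix.of fun i j => pair g (e i) (e j) p).det ≠ 0 := by
  intro h0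
  obtain ⟨x, hx, hx0⟩ := Matrix.exists_mulVec_eq_zero_iff.2 h0
  have hv : ∑ j, x j • e j p = 0 := by
    have hi : ∀ i, g p (e i p) (∑ j, x j • e j p) = 0 := fun i => by
      have := congrFun hx0 i
      simp only [Matrix.mulVec, dotProduct, Matrix.of_apply, pair, Pi.zero_apply] at this
      simp only [map_sum, map_smul, smul_eq_mul, ← this]
      exact Finset.sum_congr rfl fun j _ => mul_comm _ _
    refine hnd p _ fun w => ?_
    rw [hs, h.sum_eq p hp w, map_sum (g p), sum_apply]
    exact Finset.sum_eq_zero fun i _ => by rw [map_smul, smul_apply, hi, smul_zero]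
  exact hx (funext (Fintype.linearIndependent_iff.1 (h.linearIndependent p hp) x hv))

/-- For a nondegenerate metric, every 1-form is locally a combination of the forms `X^♭`. -/
theorem IsNondegenerate.exists_eq_sum_flatForm (hnd : IsNondegenerate g)
    (hg : IsSingularMetric g) {α : FormMap I M} (hα : IsOneForm α) (p₀ : M) :
    ∃ (n : ℕ) (e : Fin n → VField I M) (a : Fin n → M → ℝ), (∀ i, SmoothVF (e i)) ∧
      (∀ i, SmoothFun I (a i)) ∧ ∀ᶠ p in 𝓝 p₀, ∀ T, SmoothVF T →
        α T p = (∑ i, fmul (a i) (flatForm g (e i))) T p := by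
  obtain ⟨n, e, c, U, hU, h⟩ := exists_isFrame I p₀
  obtain ⟨χ, hχ, hχ1, hχs⟩ := exists_smooth_bump I hU
  let G : M → Matrix (Fin n) (Fin n) ℝ := fun p => Matrix.of fun i j => pair g (e i) (e j) p
  have hG : ∀ i j, SmoothFun I (fun p => G p i j) := fun i j =>
    hg.smooth_pair (h.smooth i) (h.smooth j)
  have hd : SmoothFun I (fun p => (G p).det) := smoothFun_det hG
  have hadj : ∀ i j, SmoothFun I (fun p => (G p).adjugate i j) := by
    intro i j
    simp only [Matrix.adjugate_apply]
    refine smoothFun_det fun k l => ?_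
    by_cases hk : k = j
    · subst hk
      simpa using smoothFun_const (I := I) (M := M) (Pi.single (M := fun _ => ℝ) i 1 l)
    · simpa [Matrix.updateRow_ne hk] using hG k l
  -- The coefficients solve a linear system with the Gram matrix, written by Cramer's rule. The
  -- factor χ confines the division by the determinant to the frame domain, so they are globally
  -- smooth.
  have hr := smoothFun_div_of_tsupport hχ hd fun p hp =>
    hnd.gram_det_ne_zero h hg.symm (hχs hp)
  refine ⟨n, e, fun i p => (χ p / (G p).det) * ∑ j, (G p).adjugate i j * α (e j) p, h.smooth,
    fun i => hr.mul (contMDiff_finsetSum fun j _ =>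
      (hadj i j).mul (hα.smooth (e j) (h.smooth j))), ?_⟩
  filter_upwards [hU, hχ1] with p hp h1 T hT
  have hdet := hnd.gram_det_ne_zero h hg.symm hp
  have hβ : IsOneForm (∑ i, fmul (fun p => (χ p / (G p).det) *
      ∑ j, (G p).adjugate i j * α (e j) p) (flatForm g (e i))) :=
    (IsRadAnn.sum fun i _ => (hg.isRadAnn_flatForm (h.smooth i)).fmul (hr.mul
      (contMDiff_finsetSum fun j _ => (hadj i j).mul (hα.smooth (e j) (h.smooth j))))).oneForm
  rw [h.eq_sum hα hT hp, h.eq_sum hβ hT hp]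
  refine Finset.sum_congr rfl fun k _ => ?_
  congr 1
  simp only [Finset.sum_apply, fmul_apply, flatForm_apply, h1, Pi.one_apply]
  have hGp : ∀ i, pair g (e i) (e k) p = G p k i := fun i => by
    rw [hg.pair_comm]; rfl
  have e1 : ∑ i, 1 / (G p).det * (∑ j, (G p).adjugate i j * α (e j) p) * pair g (e i) (e k) p
      = 1 / (G p).det * ((G p * (G p).adjugate).mulVec (fun j => α (e j) p)) k := by
    rw [← Matrix.mulVec_mulVec]
    simp only [Matrix.mulVec, dotProduct, hGp]
    rw [Finset.mul_sum]
    exact Finset.sum_congr rfl fun i _ => by ring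
  rw [e1, Matrix.mul_adjugate]
  simp only [Matrix.smul_mulVec, Matrix.one_mulVec, Pi.smul_apply, smul_eq_mul]
  change (G p).det ≠ 0 at hdet
  field_simp

theorem IsNondegenerate.isRadAnn (hnd : IsNondegenerate g) (hg : IsSingularMetric g)
    {α : FormMap I M} (hα : IsOneForm α) : IsRadAnn g α := by
  refine ⟨hα, fun p => ?_⟩
  obtain ⟨n, e, a, he, ha, h⟩ := hnd.exists_eq_sum_flatForm hg hα p
  have hr : IsRadAnn g (∑ i, fmul (a i) (flatForm g (e i))) :=
    .sum fun i _ => (hg.isRadAnn_flatForm (he i)).fmul (ha i)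
  exact (hr.flat p).imp fun v hv => hv.congr h.self_of_nhds

theorem IsNondegenerate.isRadicalStationary (hnd : IsNondegenerate g)
    (hg : IsSingularMetric g) : IsRadicalStationary g :=
  ⟨hg, fun _ _ hX hY => hnd.isRadAnn hg (hg.isOneForm_koszul hX hY)⟩

/-- Locally a 1-form is a sum of functions times forms e_i^♭; these are differentiated by the
Leibniz rule and metric compatibility, and the results glue. -/
theorem IsNondegenerate.exists_isCov (hnd : IsNondegenerate g) (hg : IsSingularMetric g)
    {Z : VField I M} (hZ : SmoothVF Z) {α : FormMap I M} (hα : IsOneForm α) :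
    ∃ η, IsCov g Z α η := by
  have hr := hnd.isRadicalStationary hg
  refine hg.exists_isCov_of_local (hnd.isRadAnn hg hα) fun p => ?_
  obtain ⟨n, e, a, he, ha, h⟩ := hnd.exists_eq_sum_flatForm hg hα p
  obtain ⟨η, hη⟩ := hr.exists_isCov_sum hZ (s := Finset.univ)
    (α := fun i => fmul (a i) (flatForm g (e i)))
    fun i _ => ⟨_, hr.isCov_fmul hZ (ha i) (hr.isCov_flatForm hZ (he i))⟩
  exact ⟨Z, _, η, hη, Filter.EventuallyEq.refl _ _, h⟩

theorem isOneForm_differential {f : M → ℝ} (hf : SmoothFun I f) :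
    IsOneForm (differential f : FormMap I M) where
  smooth _ hX := .dir hX hf
  add X Y _ _ := funext fun p => dir_add_vf X Y f p
  smul h X _ _ := funext fun p => dir_smul_vf h X f p

end Nondegenerate

/-! ### Recognising a smooth metric by its values on smooth vector fields. -/

section SmoothTensor

variable {E : Type*} [NormedAddCommGroup E] [NormedSpace ℝ E] [FiniteDimensional ℝ E]
  {H : Type*} [TopologicalSpace H] {I : ModelWithCorners ℝ E H}
  {M : Type*} [TopologicalSpace M] [ChartedSpace H M] [IsManifold I ∞ M] [T2Space M]
  {g : BilinField I M}

/-! ### Smoothness of tensor fields -/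

theorem contMDiffAt_clm₂ {A : M → E →L[ℝ] E →L[ℝ] ℝ} {p : M}
    (h : ∀ v w, ContMDiffAt I 𝓘(ℝ, ℝ) ∞ (fun q => A q v w) p) :
    ContMDiffAt I 𝓘(ℝ, E →L[ℝ] E →L[ℝ] ℝ) ∞ A p := by
  let b := Module.finBasis ℝ E
  let c := fun i => LinearMap.toContinuousLinearMap (b.coord i)
  have e : A = fun q => ∑ i, ∑ j, A q (b i) (b j) • (c i).smulRight (c j) := by
    funext q
    ext v w
    conv_lhs => rw [← b.sum_repr v, ← b.sum_repr w]
    simp only [map_sum, map_smul, sum_apply, smul_apply, smul_eq_mul,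
      ContinuousLinearMap.smulRight_apply, c]
    rw [Finset.sum_comm]
    refine Finset.sum_congr rfl fun i _ => ?_
    rw [Finset.mul_sum]
    refine Finset.sum_congr rfl fun j _ => ?_
    simp
    ring
  rw [e]
  exact contMDiffAt_finsetSum fun i _ => contMDiffAt_finsetSum fun j _ =>
    (h (b i) (b j)).smul contMDiffAt_const

/-- The components of g in a trivialization are, near the point, values of g on cut-off constant
sections. The criterion spares a direct bundle computation for the warped metric. -/
theorem isSingularMetric_of_smooth_pair
    (hs : ∀ (p : M) (v w : TangentSpace I p), g p v w = g p w v)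
    (h : ∀ X Y : VField I M, SmoothVF X → SmoothVF Y → SmoothFun I (pair g X Y)) :
    IsSingularMetric g where
  symm := hs
  smooth := by
    intro p
    refine (contMDiffAt_hom_bundle _).2 ⟨contMDiffAt_id, ?_⟩
    refine contMDiffAt_clm₂ fun v w => ?_
    let t := trivializationAt E (TangentSpace I : M → Type _) p
    have hp : p ∈ t.baseSet := FiberBundle.mem_baseSet_trivializationAt E _ p
    obtain ⟨χ, hχ, hχ1, hχs⟩ := exists_smooth_bump I (t.open_baseSet.mem_nhds hp)
    have hX : ∀ v : E, SmoothVF (fun q => χ q • (t.symm q v : TangentSpace I q)) := by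
      intro v
      refine ContMDiffOn.smul_section_of_tsupport hχ.contMDiffOn t.open_baseSet hχs ?_
      rw [t.contMDiffOn_section_baseSet_iff]
      refine (contMDiffOn_const (c := v)).congr fun q hq => ?_
      exact congrArg Prod.snd (t.apply_mk_symm hq v)
    refine (h _ _ (hX v) (hX w) p).congr_of_eventuallyEq ?_
    filter_upwards [hχ1, t.open_baseSet.mem_nhds hp] with q h1 hq
    rw [inCoordinates_apply_eq₂ hq hq (Set.mem_univ _)]
    simp [pair, h1, t]

end SmoothTensor

/-! ### Lifts of vector fields to a product and their brackets. -/

section Product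

variable {EB : Type*} [NormedAddCommGroup EB] [NormedSpace ℝ EB]
  {HB : Type*} [TopologicalSpace HB] {IB : ModelWithCorners ℝ EB HB}
  {B : Type*} [TopologicalSpace B] [ChartedSpace HB B]
  {EF : Type*} [NormedAddCommGroup EF] [NormedSpace ℝ EF]
  {HF : Type*} [TopologicalSpace HF] {IF : ModelWithCorners ℝ EF HF}
  {F : Type*} [TopologicalSpace F] [ChartedSpace HF F]

/-! ### Tangent vectors and vector fields of a product -/

/-- The differential of the projection to the first factor. -/
def projB (p : B × F) : TangentSpace (IB.prod IF) p →L[ℝ] TangentSpace IB p.1 :=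
  mfderiv (IB.prod IF) IB Prod.fst p

/-- The differential of the projection to the second factor. -/
def projF (p : B × F) : TangentSpace (IB.prod IF) p →L[ℝ] TangentSpace IF p.2 :=
  mfderiv (IB.prod IF) IF Prod.snd p

theorem tangent_prod_ext {p : B × F} {v w : TangentSpace (IB.prod IF) p}
    (h1 : projB p v = projB p w) (h2 : projF p v = projF p w) : v = w := by
  rw [projB, mfderiv_fst] at h1
  rw [projF, mfderiv_snd] at h2
  exact Prod.ext h1 h2

/-- The inclusion of the tangent space of the first factor. -/
def inB (p : B × F) (v : TangentSpace IB p.1) : TangentSpace (IB.prod IF) p :=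
  ((v, 0) : TangentSpace IB p.1 × TangentSpace IF p.2)

/-- The inclusion of the tangent space of the second factor. -/
def inF (p : B × F) (w : TangentSpace IF p.2) : TangentSpace (IB.prod IF) p :=
  ((0, w) : TangentSpace IB p.1 × TangentSpace IF p.2)

@[simp] theorem projB_inB (p : B × F) (v : TangentSpace IB p.1) :
    projB p (inB p v : TangentSpace (IB.prod IF) p) = v := by
  rw [projB, mfderiv_fst]; rfl

@[simp] theorem projF_inB (p : B × F) (v : TangentSpace IB p.1) :
    projF p (inB p v : TangentSpace (IB.prod IF) p) = 0 := by
  rw [projF, mfderiv_snd]; rfl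

@[simp] theorem projB_inF (p : B × F) (w : TangentSpace IF p.2) :
    projB p (inF p w : TangentSpace (IB.prod IF) p) = 0 := by
  rw [projB, mfderiv_fst]; rfl

@[simp] theorem projF_inF (p : B × F) (w : TangentSpace IF p.2) :
    projF p (inF p w : TangentSpace (IB.prod IF) p) = w := by
  rw [projF, mfderiv_snd]; rfl

theorem liftB_apply (X : VField IB B) (p : B × F) :
    (liftB F X : VField (IB.prod IF) (B × F)) p = inB p (X p.1) := rfl

theorem liftF_apply (U : VField IF F) (p : B × F) :
    (liftF B U : VField (IB.prod IF) (B × F)) p = inF p (U p.2) := rfl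

theorem inB_add_inF (p : B × F) (v : TangentSpace (IB.prod IF) p) :
    inB p (projB p v) + inF p (projF p v) = v := by
  refine tangent_prod_ext ?_ ?_ <;> simp

variable [FiniteDimensional ℝ EB] [IsManifold IB ∞ B] [T2Space B]
  [FiniteDimensional ℝ EF] [IsManifold IF ∞ F] [T2Space F]

theorem smoothVF_liftB {X : VField IB B} (hX : SmoothVF X) :
    SmoothVF (liftB F X : VField (IB.prod IF) (B × F)) := by
  have h1 : ContMDiff (IB.prod IF) IB.tangent ∞
      (fun p : B × F => (⟨p.1, X p.1⟩ : TangentBundle IB B)) := hX.comp contMDiff_fst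
  have h2 : ContMDiff (IB.prod IF) IF.tangent ∞
      (fun p : B × F => (⟨p.2, 0⟩ : TangentBundle IF F)) :=
    (smoothVF_zero (I := IF) (M := F)).comp contMDiff_snd
  exact contMDiff_equivTangentBundleProd_symm.comp (h1.prodMk h2)

theorem smoothVF_liftF {U : VField IF F} (hU : SmoothVF U) :
    SmoothVF (liftF B U : VField (IB.prod IF) (B × F)) := by
  have h1 : ContMDiff (IB.prod IF) IF.tangent ∞
      (fun p : B × F => (⟨p.2, U p.2⟩ : TangentBundle IF F)) := hU.comp contMDiff_snd
  have h2 : ContMDiff (IB.prod IF) IB.tangent ∞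
      (fun p : B × F => (⟨p.1, 0⟩ : TangentBundle IB B)) :=
    (smoothVF_zero (I := IB) (M := B)).comp contMDiff_fst
  exact contMDiff_equivTangentBundleProd_symm.comp (h2.prodMk h1)

theorem smooth_projB {T : VField (IB.prod IF) (B × F)} (hT : SmoothVF T) :
    ContMDiff (IB.prod IF) IB.tangent ∞
      (fun p : B × F => (⟨p.1, projB p (T p)⟩ : TangentBundle IB B)) := by
  have h : ContMDiff (IB.prod IF).tangent IB.tangent ∞
      (tangentMap (IB.prod IF) IB (@Prod.fst B F)) :=
    (contMDiff_fst (n := ∞)).contMDiff_tangentMap (by simp)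
  exact h.comp hT

theorem smooth_projF {T : VField (IB.prod IF) (B × F)} (hT : SmoothVF T) :
    ContMDiff (IB.prod IF) IF.tangent ∞
      (fun p : B × F => (⟨p.2, projF p (T p)⟩ : TangentBundle IF F)) := by
  have h : ContMDiff (IB.prod IF).tangent IF.tangent ∞
      (tangentMap (IB.prod IF) IF (@Prod.snd B F)) :=
    (contMDiff_snd (n := ∞)).contMDiff_tangentMap (by simp)
  exact h.comp hT

theorem smoothFun_fst {h : B → ℝ} (hh : SmoothFun IB h) :
    SmoothFun (IB.prod IF) (fun p : B × F => h p.1) := hh.comp contMDiff_fst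

theorem smoothFun_snd {h : F → ℝ} (hh : SmoothFun IF h) :
    SmoothFun (IB.prod IF) (fun p : B × F => h p.2) := hh.comp contMDiff_snd

/-! ### Directional derivatives and brackets of lifts -/

theorem dir_fst (T : VField (IB.prod IF) (B × F)) {h : B → ℝ} (hh : SmoothFun IB h) (p : B × F) :
    dir T (fun p : B × F => h p.1) p = mfderiv IB 𝓘(ℝ, ℝ) h p.1 (projB p (T p)) := by
  have := mfderiv_comp p (hh.mdifferentiableAt p.1)
    (mdifferentiableAt_fst (I := IB) (I' := IF) (x := p))
  change mfderiv (IB.prod IF) 𝓘(ℝ, ℝ) (h ∘ Prod.fst) p (T p) = _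
  rw [this]; rfl

theorem dir_snd (T : VField (IB.prod IF) (B × F)) {h : F → ℝ} (hh : SmoothFun IF h) (p : B × F) :
    dir T (fun p : B × F => h p.2) p = mfderiv IF 𝓘(ℝ, ℝ) h p.2 (projF p (T p)) := by
  have := mfderiv_comp p (hh.mdifferentiableAt p.2)
    (mdifferentiableAt_snd (I := IB) (I' := IF) (x := p))
  change mfderiv (IB.prod IF) 𝓘(ℝ, ℝ) (h ∘ Prod.snd) p (T p) = _
  rw [this]; rfl

theorem dir_liftB_fst (X : VField IB B) {h : B → ℝ} (hh : SmoothFun IB h) (p : B × F) :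
    dir (liftB F X : VField (IB.prod IF) (B × F)) (fun p : B × F => h p.1) p = dir X h p.1 := by
  rw [dir_fst _ hh, liftB_apply, projB_inB]; rfl

theorem dir_liftB_snd (X : VField IB B) {h : F → ℝ} (hh : SmoothFun IF h) (p : B × F) :
    dir (liftB F X : VField (IB.prod IF) (B × F)) (fun p : B × F => h p.2) p = 0 := by
  rw [dir_snd _ hh, liftB_apply, projF_inB]; exact map_zero (mfderiv IF 𝓘(ℝ, ℝ) h p.2)

theorem dir_liftF_fst (U : VField IF F) {h : B → ℝ} (hh : SmoothFun IB h) (p : B × F) :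
    dir (liftF B U : VField (IB.prod IF) (B × F)) (fun p : B × F => h p.1) p = 0 := by
  rw [dir_fst _ hh, liftF_apply, projB_inF]; exact map_zero (mfderiv IB 𝓘(ℝ, ℝ) h p.1)

theorem dir_liftF_snd (U : VField IF F) {h : F → ℝ} (hh : SmoothFun IF h) (p : B × F) :
    dir (liftF B U : VField (IB.prod IF) (B × F)) (fun p : B × F => h p.2) p = dir U h p.2 := by
  rw [dir_snd _ hh, liftF_apply, projF_inF]; rfl

/-- A vector field of the product is determined by its action on functions of either factor. -/
theorem tangent_prod_eq_of_dir {A C : VField (IB.prod IF) (B × F)} {p : B × F}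
    (h1 : ∀ h : B → ℝ, SmoothFun IB h →
      dir A (fun p : B × F => h p.1) p = dir C (fun p : B × F => h p.1) p)
    (h2 : ∀ h : F → ℝ, SmoothFun IF h →
      dir A (fun p : B × F => h p.2) p = dir C (fun p : B × F => h p.2) p) : A p = C p := by
  refine tangent_prod_ext (eq_of_dir_eq fun k hk => ?_) (eq_of_dir_eq fun k hk => ?_)
  · have := h1 k hk
    rwa [dir_fst _ hk, dir_fst _ hk] at this
  · have := h2 k hk
    rwa [dir_snd _ hk, dir_snd _ hk] at this

/-- Brackets of lifts are identified by their action on functions pulled back from the two factors,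
which avoids charts; a lift acts on one factor as the original field and annihilates functions of
the other. -/
theorem bracket_liftB_liftB {X Y : VField IB B} (hX : SmoothVF X) (hY : SmoothVF Y) :
    VectorField.mlieBracket (IB.prod IF) (liftB F X) (liftB F Y) =
      (liftB F (VectorField.mlieBracket IB X Y) : VField (IB.prod IF) (B × F)) := by
  funext p
  have hX' := smoothVF_liftB (IF := IF) (F := F) hX
  have hY' := smoothVF_liftB (IF := IF) (F := F) hY
  refine tangent_prod_eq_of_dir (fun h hh => ?_) (fun h hh => ?_)
  · rw [dir_bracket hX' hY' (smoothFun_fst hh), dir_liftB_fst _ hh, dir_bracket hX hY hh,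
      funext (dir_liftB_fst (IF := IF) Y hh), funext (dir_liftB_fst (IF := IF) X hh),
      dir_liftB_fst _ (.dir hY hh), dir_liftB_fst _ (.dir hX hh)]
  · rw [dir_bracket hX' hY' (smoothFun_snd hh), dir_liftB_snd _ hh,
      funext (dir_liftB_snd Y hh), funext (dir_liftB_snd X hh), dir_const, dir_const, sub_zero]

theorem bracket_liftF_liftF {U V : VField IF F} (hU : SmoothVF U) (hV : SmoothVF V) :
    VectorField.mlieBracket (IB.prod IF) (liftF B U) (liftF B V) =
      (liftF B (VectorField.mlieBracket IF U V) : VField (IB.prod IF) (B × F)) := by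
  funext p
  have hU' := smoothVF_liftF (IB := IB) (B := B) hU
  have hV' := smoothVF_liftF (IB := IB) (B := B) hV
  refine tangent_prod_eq_of_dir (fun h hh => ?_) (fun h hh => ?_)
  · rw [dir_bracket hU' hV' (smoothFun_fst hh), dir_liftF_fst _ hh,
      funext (dir_liftF_fst U hh), funext (dir_liftF_fst V hh), dir_const, dir_const, sub_zero]
  · rw [dir_bracket hU' hV' (smoothFun_snd hh), dir_liftF_snd _ hh, dir_bracket hU hV hh,
      funext (dir_liftF_snd (IB := IB) U hh), funext (dir_liftF_snd (IB := IB) V hh),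
      dir_liftF_snd _ (.dir hU hh), dir_liftF_snd _ (.dir hV hh)]

theorem bracket_liftB_liftF {X : VField IB B} {U : VField IF F} (hX : SmoothVF X)
    (hU : SmoothVF U) : VectorField.mlieBracket (IB.prod IF) (liftB F X) (liftF B U) =
      (0 : VField (IB.prod IF) (B × F)) := by
  funext p
  have hX' := smoothVF_liftB (IF := IF) (F := F) hX
  have hU' := smoothVF_liftF (IB := IB) (B := B) hU
  refine tangent_prod_eq_of_dir (fun h hh => ?_) (fun h hh => ?_)
  · rw [dir_bracket hX' hU' (smoothFun_fst hh), funext (dir_liftF_fst U hh),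
      funext (dir_liftB_fst (IF := IF) X hh), dir_const, dir_liftF_fst _ (.dir hX hh), dir_zero_vf,
      sub_zero]
  · rw [dir_bracket hX' hU' (smoothFun_snd hh), funext (dir_liftB_snd X hh),
      funext (dir_liftF_snd (IB := IB) U hh), dir_const, dir_liftB_snd _ (.dir hU hh), dir_zero_vf,
      sub_zero]

theorem bracket_liftF_liftB {X : VField IB B} {U : VField IF F} (hX : SmoothVF X)
    (hU : SmoothVF U) : VectorField.mlieBracket (IB.prod IF) (liftF B U) (liftB F X) =
      (0 : VField (IB.prod IF) (B × F)) := by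
  rw [VectorField.mlieBracket_swap, bracket_liftB_liftF hX hU, neg_zero]

/-- Tensorial maps on the product are determined by their values on lifts. -/
theorem IsTensorAt.eq_of_lifts {φ ψ : VField (IB.prod IF) (B × F) → ℝ} {p : B × F}
    (hφ : IsTensorAt φ p) (hψ : IsTensorAt ψ p)
    (h1 : ∀ X : VField IB B, SmoothVF X → φ (liftB F X) = ψ (liftB F X))
    (h2 : ∀ U : VField IF F, SmoothVF U → φ (liftF B U) = ψ (liftF B U))
    {T : VField (IB.prod IF) (B × F)} (hT : SmoothVF T) : φ T = ψ T := by
  obtain ⟨X, hX, hXp⟩ := exists_smoothVF_eq (projB p (T p))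
  obtain ⟨U, hU, hUp⟩ := exists_smoothVF_eq (projF p (T p))
  have hX' := smoothVF_liftB (IF := IF) (F := F) hX
  have hU' := smoothVF_liftF (IB := IB) (B := B) hU
  have e : T p = (liftB F X + liftF B U : VField (IB.prod IF) (B × F)) p := by
    rw [Pi.add_apply, liftB_apply, liftF_apply, hXp, hUp, inB_add_inF]
  rw [hφ.congr hT (hX'.add hU') e, hψ.congr hT (hX'.add hU') e, hφ.add _ _ hX' hU',
    hψ.add _ _ hX' hU', h1 X hX, h2 U hU]

end Product

/-! ### Pullbacks of forms and metrics; inner products for nondegenerate metrics. -/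

section Pullback

variable {E : Type*} [NormedAddCommGroup E] [NormedSpace ℝ E] [FiniteDimensional ℝ E]
  {H : Type*} [TopologicalSpace H] {I : ModelWithCorners ℝ E H}
  {M : Type*} [TopologicalSpace M] [ChartedSpace H M] [IsManifold I ∞ M] [T2Space M]
  {E' : Type*} [NormedAddCommGroup E'] [NormedSpace ℝ E'] [FiniteDimensional ℝ E']
  {H' : Type*} [TopologicalSpace H'] {J : ModelWithCorners ℝ E' H'}
  {N : Type*} [TopologicalSpace N] [ChartedSpace H' N] [IsManifold J ∞ N] [T2Space N]
  {g : BilinField J N}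

/-! ### Values of 1-forms on tangent vectors, and pullbacks -/

/-- The value of a 1-form on a tangent vector. -/
def evalAt (β : FormMap J N) (p : N) (v : TangentSpace J p) : ℝ :=
  β (exists_smoothVF_eq v).choose p

theorem IsOneForm.evalAt_eq {β : FormMap J N} (hβ : IsOneForm β) {X : VField J N}
    (hX : SmoothVF X) (p : N) : evalAt β p (X p) = β X p :=
  (hβ.isTensorAt p).congr (exists_smoothVF_eq (X p)).choose_spec.1 hX
    (exists_smoothVF_eq (X p)).choose_spec.2

theorem IsOneForm.evalAt_add {β : FormMap J N} (hβ : IsOneForm β) {p : N}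
    (v w : TangentSpace J p) : evalAt β p (v + w) = evalAt β p v + evalAt β p w := by
  obtain ⟨X, hX, rfl⟩ := exists_smoothVF_eq v
  obtain ⟨Y, hY, rfl⟩ := exists_smoothVF_eq w
  rw [hβ.evalAt_eq hX, hβ.evalAt_eq hY, ← Pi.add_apply, hβ.evalAt_eq (hX.add hY), hβ.add X Y hX hY]
  rfl

theorem IsOneForm.evalAt_smul {β : FormMap J N} (hβ : IsOneForm β) {p : N} (a : ℝ)
    (v : TangentSpace J p) : evalAt β p (a • v) = a * evalAt β p v := by
  obtain ⟨X, hX, rfl⟩ := exists_smoothVF_eq v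
  have h := hβ.evalAt_eq (hX.smul (smoothFun_const a)) p
  rw [hβ.smul _ X (smoothFun_const a) hX] at h
  rw [hβ.evalAt_eq hX]
  exact h

theorem IsOneForm.evalAt_zero {β : FormMap J N} (hβ : IsOneForm β) (p : N) :
    evalAt β p 0 = 0 := by
  have := hβ.evalAt_smul (p := p) 0 0
  simpa using this

theorem IsFlatOfAt.evalAt {β : FormMap J N} {p : N} {u : TangentSpace J p}
    (h : IsFlatOfAt g β p u) (v : TangentSpace J p) : evalAt β p v = g p u v := by
  have := h _ (exists_smoothVF_eq v).choose_spec.1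
  rwa [(exists_smoothVF_eq v).choose_spec.2] at this

theorem IsFrame.evalAt_eq_sum {n : ℕ} {e : Fin n → VField J N}
    {c : Fin n → Π p : N, TangentSpace J p → ℝ} {U : Set N} (h : IsFrame e c U) {β : FormMap J N}
    (hβ : IsOneForm β) {p : N} (hp : p ∈ U) (v : TangentSpace J p) :
    evalAt β p v = ∑ i, c i p v * β (e i) p := by
  obtain ⟨X, hX, rfl⟩ := exists_smoothVF_eq v
  rw [hβ.evalAt_eq hX, h.eq_sum hβ hX hp]

/-- The pullback of a 1-form. -/
def pullForm (φ : M → N) (β : FormMap J N) : FormMap I M :=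
  fun T p => evalAt β (φ p) (mfderiv I J φ p (T p))

/-- Smoothness is local, and near φ(p₀) the form is expanded in a frame. Its coordinates are smooth
on the tangent bundle, so they may be composed with the field dφ(T) along φ. -/
theorem IsOneForm.pullForm {φ : M → N} (hφ : ContMDiff I J ∞ φ) {β : FormMap J N}
    (hβ : IsOneForm β) : IsOneForm (pullForm φ β : FormMap I M) where
  smooth T hT := by
    intro p₀
    obtain ⟨n, e, c, U, hU, h⟩ := exists_isFrame J (φ p₀)
    have h1 : ContMDiff I J.tangent ∞
        (fun p : M => (⟨φ p, mfderiv I J φ p (T p)⟩ : TangentBundle J N)) :=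
      (hφ.contMDiff_tangentMap (m := ∞) (by simp)).comp hT
    have h2 : SmoothFun I (∑ i, fun p => c i (φ p) (mfderiv I J φ p (T p)) * β (e i) (φ p)) :=
      SmoothFun.sum fun i _ =>
        SmoothFun.mul ((h.coeff_smooth i).comp h1) ((hβ.smooth _ (h.smooth i)).comp hφ)
    refine (h2 p₀).congr_of_eventuallyEq ?_
    filter_upwards [hφ.continuous.continuousAt hU] with p hp
    rw [Finset.sum_apply]
    exact h.evalAt_eq_sum hβ hp _
  add X Y hX hY := by
    funext p
    simp only [SingularGeometry.pullForm, Pi.add_apply, map_add]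
    exact hβ.evalAt_add _ _
  smul h X hh hX := by
    funext p
    simp only [SingularGeometry.pullForm, Pi.mul_apply, map_smul]
    exact hβ.evalAt_smul _ _

theorem IsSingularMetric.smooth_pullback (hg : IsSingularMetric g) {φ : M → N}
    (hφ : ContMDiff I J ∞ φ) {X Y : VField I M} (hX : SmoothVF X) (hY : SmoothVF Y) :
    SmoothFun I (fun p => g (φ p) (mfderiv I J φ p (X p)) (mfderiv I J φ p (Y p))) := by
  have ht := hφ.contMDiff_tangentMap (m := ∞) (by simp)
  have h := ContMDiff.clm_bundle_apply₂ (F₃ := ℝ) (E₃ := Bundle.Trivial N ℝ) (b := φ)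
    (ψ := fun p => g (φ p)) (v := fun p => mfderiv I J φ p (X p))
    (w := fun p => mfderiv I J φ p (Y p)) (hg.smooth.comp hφ) (ht.comp hX) (ht.comp hY)
  intro p
  exact ((Bundle.contMDiffAt_totalSpace).1 (h p)).2

/-- Writing α locally as Σ a_i e_i^♭ gives ⟨⟨α,β⟩⟩ = Σ a_i β(e_i). This makes the coefficient
g_B^*(df,β) in ∇_U π_B^*β smooth. -/
theorem IsNondegenerate.smooth_coInner (hnd : IsNondegenerate g) (hg : IsSingularMetric g)
    {α β : FormMap J N} (hα : IsOneForm α) (hβ : IsOneForm β) :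
    SmoothFun J (coInner g α β) := by
  intro p₀
  obtain ⟨n, e, a, he, ha, h⟩ := hnd.exists_eq_sum_flatForm hg hα p₀
  have hs : SmoothFun J (∑ i, a i * β (e i)) :=
    SmoothFun.sum fun i _ => (ha i).mul (hβ.smooth _ (he i))
  refine (hs p₀).congr_of_eventuallyEq ?_
  filter_upwards [h] with p hp
  obtain ⟨u, hu⟩ := (hnd.isRadAnn hg hα).flat p
  obtain ⟨v, hv⟩ := (hnd.isRadAnn hg hβ).flat p
  obtain ⟨T, hT, rfl⟩ := exists_smoothVF_eq v
  rw [hg.coInner_eq hu hv, ← hu T hT, hp T hT]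
  simp only [Finset.sum_apply, fmul_apply, flatForm_apply, Pi.mul_apply]
  refine Finset.sum_congr rfl fun i _ => ?_
  rw [hv _ (he i), hg.symm]
  rfl

theorem rankAt_eq_zero (hs : ∀ (p : N) (v w : TangentSpace J p), g p v w = g p w v) {p : N}
    (h : rankAt g p = 0) (v w : TangentSpace J p) : g p v w = 0 := by
  have h1 := rankAt_add_finrank_radicalAt hs p
  rw [h, zero_add] at h1
  have h2 : radicalAt g p = ⊤ := Submodule.eq_top_of_finrank_eq h1
  exact mem_radicalAt.1 (h2 ▸ Submodule.mem_top : v ∈ radicalAt g p) w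

theorem IsNondegenerate.constSig_eq_univ (hnd : IsNondegenerate g) (hg : IsSingularMetric g) :
    constSig g = Set.univ := by
  have h : ∀ p, rankAt g p = Module.finrank ℝ E' := fun p => by
    have h2 : radicalAt g p = ⊥ :=
      (Submodule.eq_bot_iff _).2 fun v hv => hnd p v (mem_radicalAt.1 hv)
    have h1 := rankAt_add_finrank_radicalAt hg.symm p
    rwa [h2, finrank_bot, add_zero] at h1
  exact Set.eq_univ_of_forall fun p =>
    hg.mem_constSig_of_rankAt_le (.of_forall fun q => by rw [h, h])

end Pullback

/-! ### The warped metric, its space A^•, and its regions of constant signature. -/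

section Warped

variable {EB : Type*} [NormedAddCommGroup EB] [NormedSpace ℝ EB] [FiniteDimensional ℝ EB]
  {HB : Type*} [TopologicalSpace HB] {IB : ModelWithCorners ℝ EB HB}
  {B : Type*} [TopologicalSpace B] [ChartedSpace HB B] [IsManifold IB ∞ B] [T2Space B]
  {EF : Type*} [NormedAddCommGroup EF] [NormedSpace ℝ EF] [FiniteDimensional ℝ EF]
  {HF : Type*} [TopologicalSpace HF] {IF : ModelWithCorners ℝ EF HF}
  {F : Type*} [TopologicalSpace F] [ChartedSpace HF F] [IsManifold IF ∞ F] [T2Space F]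
  {gB : BilinField IB B} {gF : BilinField IF F} {f : B → ℝ}

/-! ### The warped metric -/

theorem warped_apply (gB : BilinField IB B) (gF : BilinField IF F) (f : B → ℝ) (p : B × F)
    (v w : TangentSpace (IB.prod IF) p) :
    warped gB gF f p v w = gB p.1 (projB p v) (projB p w)
      + f p.1 ^ 2 * gF p.2 (projF p v) (projF p w) := rfl

theorem isSingularMetric_warped (hgB : IsSingularMetric gB) (hgF : IsSingularMetric gF)
    (hf : SmoothFun IB f) : IsSingularMetric (warped gB gF f) := by
  refine isSingularMetric_of_smooth_pair (fun p v w => ?_) fun X Y hX hY => ?_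
  · rw [warped_apply, warped_apply, hgB.symm, hgF.symm]
  · have hf' := smoothFun_fst (IF := IF) (F := F) hf
    have := (hgB.smooth_pullback contMDiff_fst hX hY).add
      ((hf'.mul hf').mul (hgF.smooth_pullback contMDiff_snd hX hY))
    refine cast (congrArg (SmoothFun (IB.prod IF)) ?_) this
    funext p
    simp only [Pi.add_apply, Pi.mul_apply, pair, warped_apply, pow_two]
    rfl

theorem pair_liftB_liftB (gF : BilinField IF F) (f : B → ℝ) (X Y : VField IB B) :
    pair (warped gB gF f) (liftB F X) (liftB F Y) = fun p => pair gB X Y p.1 := by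
  funext p; simp [pair, warped_apply, liftB_apply]

theorem pair_liftB_liftF (gF : BilinField IF F) (f : B → ℝ) (X : VField IB B) (U : VField IF F) :
    pair (warped gB gF f) (liftB F X) (liftF B U) = fun _ => 0 := by
  funext p; simp [pair, warped_apply, liftB_apply, liftF_apply]

theorem pair_liftF_liftB (gF : BilinField IF F) (f : B → ℝ) (X : VField IB B) (U : VField IF F) :
    pair (warped gB gF f) (liftF B U) (liftB F X) = fun _ => 0 := by
  funext p; simp [pair, warped_apply, liftB_apply, liftF_apply]

theorem pair_liftF_liftF (gF : BilinField IF F) (f : B → ℝ) (U V : VField IF F) :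
    pair (warped gB gF f) (liftF B U) (liftF B V) = fun p => f p.1 ^ 2 * pair gF U V p.2 := by
  funext p; simp [pair, warped_apply, liftF_apply]

/-! ### Pullbacks of 1-forms from the factors -/

/-- The pullback of a 1-form on the base. -/
def pullB (β : FormMap IB B) : FormMap (IB.prod IF) (B × F) := pullForm Prod.fst β

/-- The pullback of a 1-form on the fibre, multiplied by the warping function. -/
def pullF (f : B → ℝ) (γ : FormMap IF F) : FormMap (IB.prod IF) (B × F) :=
  fmul (fun p => f p.1) (pullForm Prod.snd γ)

theorem pullB_apply (β : FormMap IB B) (T : VField (IB.prod IF) (B × F)) (p : B × F) :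
    pullB β T p = evalAt β p.1 (projB p (T p)) := rfl

theorem pullF_apply (f : B → ℝ) (γ : FormMap IF F) (T : VField (IB.prod IF) (B × F)) (p : B × F) :
    pullF f γ T p = f p.1 * evalAt γ p.2 (projF p (T p)) := rfl

theorem IsOneForm.pullB {β : FormMap IB B} (hβ : IsOneForm β) :
    IsOneForm (pullB β : FormMap (IB.prod IF) (B × F)) := hβ.pullForm contMDiff_fst

theorem IsOneForm.pullF {γ : FormMap IF F} (hγ : IsOneForm γ) (hf : SmoothFun IB f) :
    IsOneForm (pullF f γ : FormMap (IB.prod IF) (B × F)) :=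
  (hγ.pullForm contMDiff_snd).form_fmul (smoothFun_fst hf)

theorem IsOneForm.pullB_liftB {β : FormMap IB B} (hβ : IsOneForm β) {X : VField IB B}
    (hX : SmoothVF X) : SingularGeometry.pullB β (liftB F X : VField (IB.prod IF) (B × F)) =
      fun p => β X p.1 := by
  funext p
  rw [pullB_apply, liftB_apply, projB_inB, hβ.evalAt_eq hX]

theorem IsOneForm.pullB_liftF {β : FormMap IB B} (hβ : IsOneForm β) (U : VField IF F) :
    SingularGeometry.pullB β (liftF B U : VField (IB.prod IF) (B × F)) = fun _ => 0 := by
  funext p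
  rw [pullB_apply, liftF_apply, projB_inF, hβ.evalAt_zero]

theorem IsOneForm.pullF_liftF {γ : FormMap IF F} (hγ : IsOneForm γ) (f : B → ℝ) {U : VField IF F}
    (hU : SmoothVF U) : SingularGeometry.pullF f γ (liftF B U : VField (IB.prod IF) (B × F)) =
      fun p => f p.1 * γ U p.2 := by
  funext p
  rw [pullF_apply, liftF_apply, projF_inF, hγ.evalAt_eq hU]

theorem IsOneForm.pullF_liftB {γ : FormMap IF F} (hγ : IsOneForm γ) (f : B → ℝ)
    (X : VField IB B) :
    SingularGeometry.pullF f γ (liftB F X : VField (IB.prod IF) (B × F)) = fun _ => 0 := by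
  funext p
  rw [pullF_apply, liftB_apply, projF_inB, hγ.evalAt_zero, mul_zero]

theorem IsFlatOfAt.pullB {β : FormMap IB B} {p : B × F} {v : TangentSpace IB p.1}
    (h : IsFlatOfAt gB β p.1 v) (gF : BilinField IF F) (f : B → ℝ) :
    IsFlatOfAt (warped gB gF f) (pullB β) p (inB p v) := by
  intro T _
  rw [pullB_apply, h.evalAt, warped_apply, projB_inB, projF_inB]
  simp

/-- The weight f² of the metric against f⁻¹w leaves one factor f. At a zero of f both sides are 0,
whatever value the inverse takes there. -/
theorem IsFlatOfAt.pullF {γ : FormMap IF F} {p : B × F} {w : TangentSpace IF p.2}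
    (h : IsFlatOfAt gF γ p.2 w) (gB : BilinField IB B) (f : B → ℝ) :
    IsFlatOfAt (warped gB gF f) (pullF f γ) p (inF p ((f p.1)⁻¹ • w)) := by
  intro T _
  rw [pullF_apply, h.evalAt, warped_apply, projB_inF, projF_inF]
  by_cases h0 : f p.1 = 0
  · simp [h0]
  · simp
    field_simp

theorem IsRadAnn.pullB {β : FormMap IB B} (h : IsRadAnn gB β) (gF : BilinField IF F) (f : B → ℝ) :
    IsRadAnn (warped gB gF f) (pullB β) :=
  ⟨h.oneForm.pullB, fun p => (h.flat p.1).elim fun _ hv => ⟨_, hv.pullB gF f⟩⟩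

theorem IsRadAnn.pullF {γ : FormMap IF F} (h : IsRadAnn gF γ) (gB : BilinField IB B)
    (hf : SmoothFun IB f) : IsRadAnn (warped gB gF f) (pullF f γ) :=
  ⟨h.oneForm.pullF hf, fun p => (h.flat p.2).elim fun _ hv => ⟨_, hv.pullF gB f⟩⟩

theorem coInner_pullB_pullB (hgB : IsSingularMetric gB) (hW : IsSingularMetric (warped gB gF f))
    {β β' : FormMap IB B} (h : IsRadAnn gB β) (h' : IsRadAnn gB β') (p : B × F) :
    coInner (warped gB gF f) (pullB β) (pullB β') p = coInner gB β β' p.1 := by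
  obtain ⟨v, hv⟩ := h.flat p.1
  obtain ⟨v', hv'⟩ := h'.flat p.1
  rw [hW.coInner_eq (hv.pullB gF f) (hv'.pullB gF f), hgB.coInner_eq hv hv', warped_apply]
  simp

theorem coInner_pullB_pullF (hW : IsSingularMetric (warped gB gF f))
    {β : FormMap IB B} {γ : FormMap IF F} (h : IsRadAnn gB β) (h' : IsRadAnn gF γ) (p : B × F) :
    coInner (warped gB gF f) (pullB β) (pullF f γ) p = 0 := by
  obtain ⟨v, hv⟩ := h.flat p.1
  obtain ⟨v', hv'⟩ := h'.flat p.2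
  rw [hW.coInner_eq (hv.pullB gF f) (hv'.pullF gB f), warped_apply]
  simp

theorem coInner_pullF_pullB (hW : IsSingularMetric (warped gB gF f))
    {β : FormMap IB B} {γ : FormMap IF F} (h : IsRadAnn gB β) (h' : IsRadAnn gF γ) (p : B × F) :
    coInner (warped gB gF f) (pullF f γ) (pullB β) p = 0 := by
  obtain ⟨v, hv⟩ := h.flat p.1
  obtain ⟨v', hv'⟩ := h'.flat p.2
  rw [hW.coInner_eq (hv'.pullF gB f) (hv.pullB gF f), warped_apply]
  simp

/-- The factors f² and f⁻¹ · f⁻¹ cancel away from the zeros of f. At the zeros both covectors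
vanish, so the inner product can jump; the argument for constant signature is there to handle this.
-/
theorem coInner_pullF_pullF (hgF : IsSingularMetric gF) (hW : IsSingularMetric (warped gB gF f))
    {γ γ' : FormMap IF F} (h : IsRadAnn gF γ) (h' : IsRadAnn gF γ') (p : B × F) :
    coInner (warped gB gF f) (pullF f γ) (pullF f γ') p =
      if f p.1 = 0 then 0 else coInner gF γ γ' p.2 := by
  obtain ⟨v, hv⟩ := h.flat p.2
  obtain ⟨v', hv'⟩ := h'.flat p.2
  rw [hW.coInner_eq (hv.pullF gB f) (hv'.pullF gB f), hgF.coInner_eq hv hv', warped_apply]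
  split_ifs with h0
  · simp [h0]
  · simp
    field_simp

/-! ### Regions of constant signature of the warped metric -/

/-- The inclusion of the tangent space of the second factor, as a linear map. -/
def inFLinear (p : B × F) : TangentSpace IF p.2 →ₗ[ℝ] TangentSpace (IB.prod IF) p where
  toFun := inF p
  map_add' v w := by refine tangent_prod_ext ?_ ?_ <;> simp
  map_smul' a v := by refine tangent_prod_ext ?_ ?_ <;> simp

theorem inFLinear_injective (p : B × F) :
    Function.Injective (inFLinear (IB := IB) (IF := IF) p) := fun v w h => by
  have := congrArg (projF (IB := IB) (IF := IF) p) h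
  change projF p (inF p v : TangentSpace (IB.prod IF) p) = projF p (inF p w) at this
  rwa [projF_inF, projF_inF] at this

theorem mem_radicalAt_warped (hnd : IsNondegenerate gB) {p : B × F}
    {v : TangentSpace (IB.prod IF) p} : v ∈ radicalAt (warped gB gF f) p ↔
      projB p v = 0 ∧ ∀ w, f p.1 ^ 2 * gF p.2 (projF p v) w = 0 := by
  rw [mem_radicalAt]
  refine ⟨fun h => ⟨hnd _ _ fun w => ?_, fun w => ?_⟩, fun h w => ?_⟩
  · have := h (inB p w)
    rw [warped_apply, projB_inB, projF_inB] at this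
    simpa using this
  · have := h (inF p w)
    rw [warped_apply, projB_inF, projF_inF] at this
    simpa using this
  · rw [warped_apply, h.1, h.2]
    simp

/-- Since the base is nondegenerate, the radical is that of g_F included in the second factor. -/
theorem rankAt_warped_of_ne_zero (hgB : IsSingularMetric gB) (hgF : IsSingularMetric gF)
    (hf : SmoothFun IB f) (hnd : IsNondegenerate gB) {p : B × F} (h0 : f p.1 ≠ 0) :
    rankAt (warped gB gF f) p = Module.finrank ℝ EB + rankAt gF p.2 := by
  have h1 := rankAt_add_finrank_radicalAt (isSingularMetric_warped hgB hgF hf).symm p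
  have h2 := rankAt_add_finrank_radicalAt hgF.symm p.2
  have h3 : radicalAt (warped gB gF f) p =
      (radicalAt gF p.2).map (inFLinear (IB := IB) (IF := IF) p) := by
    ext v
    rw [mem_radicalAt_warped hnd, Submodule.mem_map]
    constructor
    · rintro ⟨h, h'⟩
      refine ⟨projF p v, mem_radicalAt.2 fun w => ?_, ?_⟩
      · simpa [h0] using h' w
      · exact tangent_prod_ext ((projB_inF _ _).trans h.symm) (projF_inF _ _)
    · rintro ⟨w, hw, rfl⟩
      refine ⟨projB_inF _ _, fun w' => ?_⟩
      change f p.1 ^ 2 * gF p.2 (projF p (inF p w : TangentSpace (IB.prod IF) p)) w' = 0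
      rw [projF_inF, mem_radicalAt.1 hw, mul_zero]
  rw [h3, ← (Submodule.equivMapOfInjective _ (inFLinear_injective p) _).finrank_eq,
    Module.finrank_prod] at h1
  omega

/-- At a zero of f the radical is the whole tangent space of the fibre. -/
theorem rankAt_warped_of_eq_zero (hgB : IsSingularMetric gB) (hgF : IsSingularMetric gF)
    (hf : SmoothFun IB f) (hnd : IsNondegenerate gB) {p : B × F} (h0 : f p.1 = 0) :
    rankAt (warped gB gF f) p = Module.finrank ℝ EB := by
  have h1 := rankAt_add_finrank_radicalAt (isSingularMetric_warped hgB hgF hf).symm p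
  have h3 : radicalAt (warped gB gF f) p =
      (⊤ : Submodule ℝ (TangentSpace IF p.2)).map (inFLinear (IB := IB) (IF := IF) p) := by
    ext v
    rw [mem_radicalAt_warped hnd, Submodule.mem_map]
    constructor
    · rintro ⟨h, -⟩
      exact ⟨projF p v, trivial, tangent_prod_ext ((projB_inF _ _).trans h.symm) (projF_inF _ _)⟩
    · rintro ⟨w, -, rfl⟩
      exact ⟨projB_inF _ _, fun w' => by simp [h0]⟩
  rw [h3, ← (Submodule.equivMapOfInjective _ (inFLinear_injective p) _).finrank_eq,
    Module.finrank_prod, finrank_top] at h1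
  change _ + Module.finrank ℝ EF = _ at h1
  omega

/-- Along the slice {p.1} × F the factor f is a fixed nonzero number, so constancy of the warped
rank gives constancy of the rank of g_F. -/
theorem snd_mem_constSig (hgB : IsSingularMetric gB) (hgF : IsSingularMetric gF)
    (hf : SmoothFun IB f) (hnd : IsNondegenerate gB) {p : B × F}
    (hp : p ∈ constSig (warped gB gF f)) (h0 : f p.1 ≠ 0) : p.2 ∈ constSig gF := by
  refine hgF.mem_constSig_of_rankAt_le ?_
  have hc : ContinuousAt (fun q : F => (p.1, q)) p.2 := by fun_prop
  filter_upwards [hc (rankAt_eq_of_mem_constSig hp)] with q hq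
  change rankAt _ (p.1, q) = _ at hq
  rw [rankAt_warped_of_ne_zero hgB hgF hf hnd h0,
    rankAt_warped_of_ne_zero hgB hgF hf hnd (p := (p.1, q)) h0] at hq
  exact (add_left_cancel hq).le

/-- Along the slice B × {p.2}, nearby points with f ≠ 0 have rank dim B + rank g_F, while the point
itself has rank dim B. If such points accumulate, constancy forces g_F = 0 at p.2; otherwise f
vanishes near p.1. -/
theorem dir_eq_zero_or_of_mem_constSig (hgB : IsSingularMetric gB) (hgF : IsSingularMetric gF)
    (hf : SmoothFun IB f) (hnd : IsNondegenerate gB) {p : B × F}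
    (hp : p ∈ constSig (warped gB gF f)) (h0 : f p.1 = 0) :
    (∀ X : VField IB B, dir X f p.1 = 0) ∨ ∀ v w, gF p.2 v w = 0 := by
  by_cases h : ∀ᶠ b in 𝓝 p.1, f b = 0
  · left
    intro X
    have h' : f =ᶠ[𝓝 p.1] fun _ => 0 := h
    rw [dir_congr rfl h', dir_const]
  · right
    have hc : ContinuousAt (fun b : B => (b, p.2)) p.1 := by fun_prop
    obtain ⟨b, hb, hb'⟩ :=
      (Filter.not_eventually.1 h).and_eventually (hc (rankAt_eq_of_mem_constSig hp)) |>.exists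
    change rankAt _ (b, p.2) = _ at hb'
    rw [rankAt_warped_of_eq_zero hgB hgF hf hnd h0,
      rankAt_warped_of_ne_zero hgB hgF hf hnd (p := (b, p.2)) hb] at hb'
    exact rankAt_eq_zero hgF.symm (by simpa using hb')

end Warped

/-! ### The Koszul form on lifts, the four derivative rules, and semi-regularity. -/

section WarpedConnection

variable {EB : Type*} [NormedAddCommGroup EB] [NormedSpace ℝ EB] [FiniteDimensional ℝ EB]
  {HB : Type*} [TopologicalSpace HB] {IB : ModelWithCorners ℝ EB HB}
  {B : Type*} [TopologicalSpace B] [ChartedSpace HB B] [IsManifold IB ∞ B] [T2Space B]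
  {EF : Type*} [NormedAddCommGroup EF] [NormedSpace ℝ EF] [FiniteDimensional ℝ EF]
  {HF : Type*} [TopologicalSpace HF] {IF : ModelWithCorners ℝ EF HF}
  {F : Type*} [TopologicalSpace F] [ChartedSpace HF F] [IsManifold IF ∞ F] [T2Space F]
  {gB : BilinField IB B} {gF : BilinField IF F} {f : B → ℝ}
  {X Y Z : VField IB B} {U V : VField IF F}

/-- The data of a warped product with nondegenerate base and semi-regular fibre. -/
structure IsWarpedData (gB : BilinField IB B) (gF : BilinField IF F) (f : B → ℝ) : Prop where
  base : IsSingularMetric gB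
  nondegenerate : IsNondegenerate gB
  fibre : IsSemiRegular gF
  smooth : SmoothFun IB f

theorem IsWarpedData.metric (h : IsWarpedData gB gF f) : IsSingularMetric (warped gB gF f) :=
  isSingularMetric_warped h.base h.fibre.metric h.smooth

/-! ### The Koszul form on lifts -/

theorem dir_liftB_mul (X : VField IB B) {h : B → ℝ} {k : F → ℝ} (hh : SmoothFun IB h)
    (hk : SmoothFun IF k) (p : B × F) :
    dir (liftB F X : VField (IB.prod IF) (B × F)) (fun p : B × F => h p.1 * k p.2) p =
      dir X h p.1 * k p.2 := by
  have := dir_mul (X := (liftB F X : VField (IB.prod IF) (B × F))) (smoothFun_fst hh)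
    (smoothFun_snd hk) p
  rw [dir_liftB_fst _ hh, dir_liftB_snd _ hk, mul_zero, add_zero] at this
  exact this

theorem dir_liftF_mul (U : VField IF F) {h : B → ℝ} {k : F → ℝ} (hh : SmoothFun IB h)
    (hk : SmoothFun IF k) (p : B × F) :
    dir (liftF B U : VField (IB.prod IF) (B × F)) (fun p : B × F => h p.1 * k p.2) p =
      h p.1 * dir U k p.2 := by
  have := dir_mul (X := (liftF B U : VField (IB.prod IF) (B × F))) (smoothFun_fst hh)
    (smoothFun_snd hk) p
  rw [dir_liftF_fst _ hh, dir_liftF_snd _ hk, zero_mul, zero_add] at this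
  exact this

theorem smoothFun_fst_mul_snd {h : B → ℝ} {k : F → ℝ} (hh : SmoothFun IB h)
    (hk : SmoothFun IF k) : SmoothFun (IB.prod IF) (fun p : B × F => h p.1 * k p.2) :=
  (smoothFun_fst hh).mul (smoothFun_snd hk)

theorem SmoothFun.sq (hf : SmoothFun IB f) : SmoothFun IB (fun b => f b ^ 2) := by
  have h : (fun b => f b ^ 2) = f * f := funext fun b => pow_two (f b)
  exact h ▸ hf.mul hf

theorem dir_sq (X : VField IB B) (hf : SmoothFun IB f) (b : B) :
    dir X (fun b => f b ^ 2) b = 2 * f b * dir X f b := by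
  have h : (fun b => f b ^ 2) = f * f := funext fun b => pow_two (f b)
  rw [h, dir_mul hf hf]
  ring

theorem pair_zero_right (gB : BilinField IB B) (X : VField IB B) : pair gB X 0 = fun _ => 0 := by
  funext p; simp [pair]

theorem IsOneForm.eq_of_lifts {α η : FormMap (IB.prod IF) (B × F)} (hα : IsOneForm α)
    (hη : IsOneForm η)
    (h1 : ∀ X : VField IB B, SmoothVF X → α (liftB F X) = η (liftB F X))
    (h2 : ∀ U : VField IF F, SmoothVF U → α (liftF B U) = η (liftF B U))
    {T : VField (IB.prod IF) (B × F)} (hT : SmoothVF T) : α T = η T :=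
  funext fun p => (hα.isTensorAt p).eq_of_lifts (hη.isTensorAt p)
    (fun X hX => congrFun (h1 X hX) p) (fun U hU => congrFun (h2 U hU) p) hT

theorem IsWarpedData.koszul_liftB_liftB (h : IsWarpedData gB gF f) (hX : SmoothVF X)
    (hY : SmoothVF Y) {T : VField (IB.prod IF) (B × F)} (hT : SmoothVF T) :
    koszul (warped gB gF f) (liftB F X) (liftB F Y) T = pullB (koszul gB X Y) T := by
  have hK := h.base.isOneForm_koszul hX hY
  refine (h.metric.isOneForm_koszul (smoothVF_liftB hX) (smoothVF_liftB hY)).eq_of_lifts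
    hK.pullB (fun Z hZ => ?_) (fun Q hQ => ?_) hT
  · rw [hK.pullB_liftB hZ]
    funext p
    simp only [koszul, bracket_liftB_liftB hX hY, bracket_liftB_liftB hY hZ,
      bracket_liftB_liftB hZ hX, pair_liftB_liftB, dir_liftB_fst _ (h.base.smooth_pair hX hY),
      dir_liftB_fst _ (h.base.smooth_pair hY hZ), dir_liftB_fst _ (h.base.smooth_pair hZ hX)]
  · rw [hK.pullB_liftF]
    funext p
    simp only [koszul, bracket_liftB_liftB hX hY, bracket_liftB_liftF hY hQ,
      bracket_liftF_liftB hX hQ, pair_liftB_liftB, pair_liftB_liftF, pair_liftF_liftB,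
      pair_zero_right, dir_const, dir_liftF_fst _ (h.base.smooth_pair hX hY)]
    ring

/-- The only Koszul term that survives is ½X(f² g_F(V,Q)) = f X(f) g_F(V,Q). One factor f is kept
inside `pullF`, the other has been differentiated. -/
theorem IsWarpedData.koszul_liftB_liftF (h : IsWarpedData gB gF f) (hX : SmoothVF X)
    (hV : SmoothVF V) {T : VField (IB.prod IF) (B × F)} (hT : SmoothVF T) :
    koszul (warped gB gF f) (liftB F X) (liftF B V) T =
      fmul (fun p => dir X f p.1) (pullF f (flatForm gF V)) T := by
  have hK := h.fibre.metric.isOneForm_flatForm hV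
  refine (h.metric.isOneForm_koszul (smoothVF_liftB hX) (smoothVF_liftF hV)).eq_of_lifts
    ((hK.pullF h.smooth).form_fmul (smoothFun_fst (.dir hX h.smooth)))
    (fun Z hZ => ?_) (fun Q hQ => ?_) hT
  · funext p
    rw [fmul_apply, hK.pullF_liftB]
    simp only [koszul, bracket_liftB_liftF hX hV, bracket_liftF_liftB hZ hV,
      bracket_liftB_liftB hZ hX, pair_liftB_liftB, pair_liftB_liftF, pair_liftF_liftB,
      pair_zero_right, dir_const, dir_liftF_fst _ (h.base.smooth_pair hZ hX)]
    ring
  · funext p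
    rw [fmul_apply, hK.pullF_liftF _ hQ]
    simp only [koszul, bracket_liftB_liftF hX hV, bracket_liftF_liftF hV hQ,
      bracket_liftF_liftB hX hQ, pair_liftF_liftF, pair_liftB_liftF, pair_liftF_liftB,
      pair_zero_right, dir_const, dir_liftB_mul _ h.smooth.sq (h.fibre.metric.smooth_pair hV hQ),
      dir_sq _ h.smooth, flatForm_apply]
    ring

/-- Torsion-freeness, since lifts from different factors commute. -/
theorem IsWarpedData.koszul_liftF_liftB (h : IsWarpedData gB gF f) (hX : SmoothVF X)
    (hV : SmoothVF V) {T : VField (IB.prod IF) (B × F)} (hT : SmoothVF T) :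
    koszul (warped gB gF f) (liftF B V) (liftB F X) T =
      fmul (fun p => dir X f p.1) (pullF f (flatForm gF V)) T := by
  rw [← h.koszul_liftB_liftF hX hV hT]
  funext p
  have := h.metric.koszul_torsion (X := liftB F X) (Y := liftF B V) (Z := T) p
  rw [bracket_liftB_liftF hX hV, h.metric.pair_comm, pair_zero_right] at this
  linarith

/-- On a lift from B only -½Z(f² g_F(U,V)) survives, which yields the df term; on lifts from F the
factor f² is constant and the Koszul form of the fibre appears. -/
theorem IsWarpedData.koszul_liftF_liftF (h : IsWarpedData gB gF f) (hU : SmoothVF U)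
    (hV : SmoothVF V) {T : VField (IB.prod IF) (B × F)} (hT : SmoothVF T) :
    koszul (warped gB gF f) (liftF B U) (liftF B V) T =
      (fmul (fun p => f p.1 * (-pair gF U V) p.2) (pullB (differential f))
        + fmul (fun p => f p.1) (pullF f (koszul gF U V)) : FormMap (IB.prod IF) (B × F)) T := by
  have hf := h.smooth
  have hK := h.fibre.metric.isOneForm_koszul hU hV
  have hd := isOneForm_differential hf
  have hs := h.fibre.metric.smooth_pair hU hV
  refine (h.metric.isOneForm_koszul (smoothVF_liftF hU) (smoothVF_liftF hV)).eq_of_lifts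
    ((hd.pullB.form_fmul (smoothFun_fst_mul_snd hf hs.neg)).form_add
      ((hK.pullF hf).form_fmul (smoothFun_fst hf)))
    (fun Z hZ => ?_) (fun Q hQ => ?_) hT
  · funext p
    rw [add_form_apply, fmul_apply, fmul_apply, hK.pullF_liftB, hd.pullB_liftB hZ]
    simp only [koszul, bracket_liftB_liftF hZ hU, bracket_liftF_liftB hZ hV,
      bracket_liftF_liftF hU hV, pair_liftF_liftF, pair_liftB_liftF, pair_liftF_liftB,
      pair_zero_right, dir_const, dir_liftB_mul _ hf.sq hs, dir_sq _ hf, Pi.neg_apply,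
      differential]
    ring
  · funext p
    rw [add_form_apply, fmul_apply, fmul_apply, hK.pullF_liftF _ hQ, hd.pullB_liftF]
    simp only [koszul, bracket_liftF_liftF hU hV, bracket_liftF_liftF hV hQ,
      bracket_liftF_liftF hQ hU, pair_liftF_liftF, dir_liftF_mul _ hf.sq hs,
      dir_liftF_mul _ hf.sq (h.fibre.metric.smooth_pair hV hQ),
      dir_liftF_mul _ hf.sq (h.fibre.metric.smooth_pair hQ hU)]
    ring

theorem IsWarpedData.isRadAnn_flat (h : IsWarpedData gB gF f) (hU : SmoothVF U) :
    IsRadAnn (warped gB gF f) (pullF f (flatForm gF U)) :=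
  (h.fibre.metric.isRadAnn_flatForm hU).pullF gB h.smooth

theorem IsWarpedData.isRadAnn_differential (h : IsWarpedData gB gF f) :
    IsRadAnn gB (differential f : FormMap IB B) :=
  h.nondegenerate.isRadAnn h.base (isOneForm_differential h.smooth)

theorem IsWarpedData.isRadAnn_koszul_base (h : IsWarpedData gB gF f) (hX : SmoothVF X)
    (hY : SmoothVF Y) : IsRadAnn gB (koszul gB X Y) :=
  h.nondegenerate.isRadAnn h.base (h.base.isOneForm_koszul hX hY)

theorem IsWarpedData.isRadAnn_koszul_liftF_liftF (h : IsWarpedData gB gF f) (hU : SmoothVF U)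
    (hV : SmoothVF V) :
    IsRadAnn (warped gB gF f) (koszul (warped gB gF f) (liftF B U) (liftF B V)) :=
  (((h.isRadAnn_differential.pullB gF f).fmul (smoothFun_fst_mul_snd h.smooth
      (h.fibre.metric.smooth_pair hU hV).neg)).add
    (((h.fibre.radicalStationary U V hU hV).pullF gB h.smooth).fmul
      (smoothFun_fst h.smooth))).congr fun _ hT => h.koszul_liftF_liftF hU hV hT

/-! ### Covariant derivatives of pullbacks -/

section CoInner

variable {α : FormMap (IB.prod IF) (B × F)} (p : B × F)

theorem IsWarpedData.coInner_koszul_liftB_liftB (h : IsWarpedData gB gF f) (hX : SmoothVF X)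
    (hY : SmoothVF Y) :
    coInner (warped gB gF f) (koszul (warped gB gF f) (liftB F X) (liftB F Y)) α p =
      coInner (warped gB gF f) (pullB (koszul gB X Y)) α p :=
  coInner_congr (fun _ hT => congrFun (h.koszul_liftB_liftB hX hY hT) p) fun _ _ => rfl

theorem IsWarpedData.coInner_koszul_liftB_liftF (h : IsWarpedData gB gF f) (hX : SmoothVF X)
    (hV : SmoothVF V) (hα : IsRadAnn (warped gB gF f) α) :
    coInner (warped gB gF f) (koszul (warped gB gF f) (liftB F X) (liftF B V)) α p =
      dir X f p.1 * coInner (warped gB gF f) (pullF f (flatForm gF V)) α p := by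
  rw [coInner_congr (fun _ hT => congrFun (h.koszul_liftB_liftF hX hV hT) p) fun _ _ => rfl,
    h.metric.coInner_fmul_left _ ((h.isRadAnn_flat hV).flat p) (hα.flat p)]

theorem IsWarpedData.coInner_koszul_liftF_liftB (h : IsWarpedData gB gF f) (hX : SmoothVF X)
    (hV : SmoothVF V) (hα : IsRadAnn (warped gB gF f) α) :
    coInner (warped gB gF f) (koszul (warped gB gF f) (liftF B V) (liftB F X)) α p =
      dir X f p.1 * coInner (warped gB gF f) (pullF f (flatForm gF V)) α p := by
  rw [coInner_congr (fun _ hT => congrFun (h.koszul_liftF_liftB hX hV hT) p) fun _ _ => rfl,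
    h.metric.coInner_fmul_left _ ((h.isRadAnn_flat hV).flat p) (hα.flat p)]

theorem IsWarpedData.coInner_koszul_liftF_liftF (h : IsWarpedData gB gF f) (hU : SmoothVF U)
    (hV : SmoothVF V) (hα : IsRadAnn (warped gB gF f) α) :
    coInner (warped gB gF f) (koszul (warped gB gF f) (liftF B U) (liftF B V)) α p =
      -(f p.1 * pair gF U V p.2) * coInner (warped gB gF f) (pullB (differential f)) α p
        + f p.1 * coInner (warped gB gF f) (pullF f (koszul gF U V)) α p := by
  have h1 := h.isRadAnn_differential.pullB gF f
  have h2 := (h.fibre.radicalStationary U V hU hV).pullF gB h.smooth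
  rw [coInner_congr (fun _ hT => congrFun (h.koszul_liftF_liftF hU hV hT) p) fun _ _ => rfl,
    h.metric.coInner_add_left ((h1.fmul (smoothFun_fst_mul_snd h.smooth
      (h.fibre.metric.smooth_pair hU hV).neg)).flat p)
      ((h2.fmul (smoothFun_fst h.smooth)).flat p) (hα.flat p),
    h.metric.coInner_fmul_left _ (h1.flat p) (hα.flat p),
    h.metric.coInner_fmul_left _ (h2.flat p) (hα.flat p)]
  simp only [Pi.neg_apply]
  ring

end CoInner

/-- Both sides are tensorial in the argument, so a derivative needs to be checked only against lifts
from the two factors. -/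
theorem IsRadicalStationary.isCov_of_lifts {g : BilinField (IB.prod IF) (B × F)}
    (hg : IsRadicalStationary g) {Z : VField (IB.prod IF) (B × F)} (hZ : SmoothVF Z)
    {α η : FormMap (IB.prod IF) (B × F)} (hα : IsRadAnn g α) (hη : IsRadAnn g η)
    (h1 : ∀ X : VField IB B, SmoothVF X → ∀ p ∈ constSig g,
      η (liftB F X) p = dir Z (α (liftB F X)) p - coInner g (koszul g Z (liftB F X)) α p)
    (h2 : ∀ U : VField IF F, SmoothVF U → ∀ p ∈ constSig g,
      η (liftF B U) p = dir Z (α (liftF B U)) p - coInner g (koszul g Z (liftF B U)) α p) :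
    IsCov g Z α η :=
  ⟨hα, hη, fun _ hT p hp => (hη.oneForm.isTensorAt p).eq_of_lifts
    (hg.isTensorAt_covDerivConst hZ hα p) (fun X hX => h1 X hX p hp)
    (fun U hU => h2 U hU p hp) hT⟩

theorem IsWarpedData.isCov_liftB_pullB (h : IsWarpedData gB gF f)
    (hW : IsRadicalStationary (warped gB gF f)) (hZ : SmoothVF Z) {β η : FormMap IB B}
    (hc : IsCov gB Z β η) : IsCov (warped gB gF f) (liftB F Z) (pullB β) (pullB η) := by
  have hβ := hc.source
  refine hW.isCov_of_lifts (smoothVF_liftB hZ) (hβ.pullB gF f) (hc.target.pullB gF f)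
    (fun X hX p _ => ?_) (fun U hU p _ => ?_)
  · rw [hc.target.oneForm.pullB_liftB hX, hβ.oneForm.pullB_liftB hX,
      dir_liftB_fst _ (hβ.oneForm.smooth X hX), h.coInner_koszul_liftB_liftB _ hZ hX,
      coInner_pullB_pullB h.base h.metric (h.isRadAnn_koszul_base hZ hX) hβ]
    exact hc.eq X hX p.1 (h.nondegenerate.constSig_eq_univ h.base ▸ Set.mem_univ _)
  · rw [hc.target.oneForm.pullB_liftF, hβ.oneForm.pullB_liftF, dir_const,
      h.coInner_koszul_liftB_liftF _ hZ hU (hβ.pullB gF f),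
      coInner_pullF_pullB h.metric hβ (h.fibre.metric.isRadAnn_flatForm hU)]
    ring

theorem IsWarpedData.isCov_liftF_pullB (h : IsWarpedData gB gF f)
    (hW : IsRadicalStationary (warped gB gF f)) (hU : SmoothVF U) {β : FormMap IB B}
    (hβ : IsRadAnn gB β) : IsCov (warped gB gF f) (liftF B U) (pullB β)
      (fmul (fun p => coInner gB (differential f) β p.1) (pullF f (flatForm gF U))) := by
  have hU' := h.fibre.metric.isRadAnn_flatForm hU
  refine hW.isCov_of_lifts (smoothVF_liftF hU) (hβ.pullB gF f)
    ((h.isRadAnn_flat hU).fmul (smoothFun_fst (h.nondegenerate.smooth_coInner h.base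
      h.isRadAnn_differential.oneForm hβ.oneForm))) (fun X hX p _ => ?_) (fun V hV p _ => ?_)
  · rw [fmul_apply, hU'.oneForm.pullF_liftB, hβ.oneForm.pullB_liftB hX,
      dir_liftF_fst _ (hβ.oneForm.smooth X hX),
      h.coInner_koszul_liftF_liftB _ hX hU (hβ.pullB gF f), coInner_pullF_pullB h.metric hβ hU']
    ring
  · rw [fmul_apply, hU'.oneForm.pullF_liftF _ hV, hβ.oneForm.pullB_liftF, dir_const,
      h.coInner_koszul_liftF_liftF _ hU hV (hβ.pullB gF f),
      coInner_pullF_pullB h.metric hβ (h.fibre.radicalStationary U V hU hV),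
      coInner_pullB_pullB h.base h.metric h.isRadAnn_differential hβ]
    simp only [flatForm_apply]
    ring

/-- At a zero of `f` in a region of constant signature, `df` or `γ ∈ A^•(F)` vanishes. -/
theorem IsWarpedData.dir_mul_eq_zero (h : IsWarpedData gB gF f) {p : B × F}
    (hp : p ∈ constSig (warped gB gF f)) (h0 : f p.1 = 0) (X : VField IB B) {γ : FormMap IF F}
    (hγ : IsRadAnn gF γ) (hV : SmoothVF V) : dir X f p.1 * γ V p.2 = 0 := by
  rcases dir_eq_zero_or_of_mem_constSig h.base h.fibre.metric h.smooth h.nondegenerate hp h0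
    with h1 | h1
  · rw [h1, zero_mul]
  · obtain ⟨v, hv⟩ := hγ.flat p.2
    rw [hv V hV, h1, mul_zero]

/-- Away from the zeros of f, the derivative Z(f)γ(V) cancels the inner product of Z(f) f π_F^*V^♭
with f π_F^*γ. At a zero that inner product is 0, and Z(f)γ(V) vanishes by `dir_mul_eq_zero`. -/
theorem IsWarpedData.isCov_liftB_pullF (h : IsWarpedData gB gF f)
    (hW : IsRadicalStationary (warped gB gF f)) (hZ : SmoothVF Z) {γ : FormMap IF F}
    (hγ : IsRadAnn gF γ) : IsCov (warped gB gF f) (liftB F Z) (pullF f γ) 0 := by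
  refine hW.isCov_of_lifts (smoothVF_liftB hZ) (hγ.pullF gB h.smooth) (isRadAnn_zero _)
    (fun X hX p _ => ?_) (fun V hV p hp => ?_)
  · rw [hγ.oneForm.pullF_liftB, dir_const, h.coInner_koszul_liftB_liftB _ hZ hX,
      coInner_pullB_pullF h.metric (h.isRadAnn_koszul_base hZ hX) hγ, sub_zero]
    rfl
  · rw [hγ.oneForm.pullF_liftF _ hV, dir_liftB_mul _ h.smooth (hγ.oneForm.smooth V hV),
      h.coInner_koszul_liftB_liftF _ hZ hV (hγ.pullF gB h.smooth),
      coInner_pullF_pullF h.fibre.metric h.metric (h.fibre.metric.isRadAnn_flatForm hV) hγ]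
    split_ifs with h0
    · rw [h.dir_mul_eq_zero hp h0 Z hγ hV, mul_zero, sub_zero]
      rfl
    · rw [h.fibre.metric.coInner_flatForm hV (hγ.flat _), sub_self]
      rfl

/-- Two uses of constant signature: on base lifts, the df term must vanish at zeros of f; on fibre
lifts, the derivative of γ on the fibre may be used only where f ≠ 0, since the fibre point need not
be in a constant region otherwise. -/
theorem IsWarpedData.isCov_liftF_pullF (h : IsWarpedData gB gF f)
    (hW : IsRadicalStationary (warped gB gF f)) (hU : SmoothVF U) {γ η : FormMap IF F}
    (hc : IsCov gF U γ η) : IsCov (warped gB gF f) (liftF B U) (pullF f γ)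
      (fmul (fun p => (-γ U) p.2) (pullB (differential f)) + pullF f η) := by
  have hγ := hc.source
  have hd := h.isRadAnn_differential
  refine hW.isCov_of_lifts (smoothVF_liftF hU) (hγ.pullF gB h.smooth)
    (((hd.pullB gF f).fmul (smoothFun_snd (hγ.oneForm.smooth U hU).neg)).add
      (hc.target.pullF gB h.smooth))
    (fun X hX p hp => ?_) (fun V hV p hp => ?_)
  · rw [add_form_apply, fmul_apply, hc.target.oneForm.pullF_liftB, hγ.oneForm.pullF_liftB,
      hd.oneForm.pullB_liftB hX, dir_const,
      h.coInner_koszul_liftF_liftB _ hX hU (hγ.pullF gB h.smooth),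
      coInner_pullF_pullF h.fibre.metric h.metric (h.fibre.metric.isRadAnn_flatForm hU) hγ]
    simp only [Pi.neg_apply, differential]
    split_ifs with h0
    · linear_combination -h.dir_mul_eq_zero hp h0 X hγ hU
    · rw [h.fibre.metric.coInner_flatForm hU (hγ.flat _)]
      ring
  · have hK := h.fibre.radicalStationary U V hU hV
    rw [add_form_apply, fmul_apply, hc.target.oneForm.pullF_liftF _ hV,
      hγ.oneForm.pullF_liftF _ hV, hd.oneForm.pullB_liftF,
      dir_liftF_mul _ h.smooth (hγ.oneForm.smooth V hV),
      h.coInner_koszul_liftF_liftF _ hU hV (hγ.pullF gB h.smooth),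
      coInner_pullF_pullF h.fibre.metric h.metric hK hγ, coInner_pullB_pullF h.metric hd hγ]
    split_ifs with h0
    · simp [h0]
    · have := hc.eq V hV p.2
        (snd_mem_constSig h.base h.fibre.metric h.smooth h.nondegenerate hp h0)
      rw [covDerivConst] at this
      beta_reduce
      linear_combination f p.1 * this

/-! ### Covariant derivatives of the Koszul form on lifts -/

section

variable {U₁ U₂ : VField IF F}

theorem IsWarpedData.isCov_liftB_liftB_liftB (h : IsWarpedData gB gF f)
    (hW : IsRadicalStationary (warped gB gF f)) (hX : SmoothVF X) (hY : SmoothVF Y)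
    (hZ : SmoothVF Z) {η : FormMap IB B} (hc : IsCov gB X (koszul gB Y Z) η) :
    IsCov (warped gB gF f) (liftB F X) (koszul (warped gB gF f) (liftB F Y) (liftB F Z))
      (pullB η) :=
  (h.isCov_liftB_pullB hW hX hc).congr (fun _ hT => h.koszul_liftB_liftB hY hZ hT) fun _ _ => rfl

theorem IsWarpedData.isCov_liftF_liftB_liftB (h : IsWarpedData gB gF f)
    (hW : IsRadicalStationary (warped gB gF f)) (hU : SmoothVF U) (hY : SmoothVF Y)
    (hZ : SmoothVF Z) :
    IsCov (warped gB gF f) (liftF B U) (koszul (warped gB gF f) (liftB F Y) (liftB F Z))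
      (fmul (fun p => coInner gB (differential f) (koszul gB Y Z) p.1)
        (pullF f (flatForm gF U))) :=
  (h.isCov_liftF_pullB hW hU (h.isRadAnn_koszul_base hY hZ)).congr
    (fun _ hT => h.koszul_liftB_liftB hY hZ hT) fun _ _ => rfl

/-- The form differentiated here is both K(Y,V,·) and K(V,Y,·). As f π_F^*V^♭ is parallel along the
base, only its coefficient Y(f) is differentiated. -/
theorem IsWarpedData.isCov_liftB_mixed (h : IsWarpedData gB gF f)
    (hW : IsRadicalStationary (warped gB gF f)) (hX : SmoothVF X) (hY : SmoothVF Y)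
    (hV : SmoothVF V) :
    IsCov (warped gB gF f) (liftB F X) (fmul (fun p => dir Y f p.1) (pullF f (flatForm gF V)))
      (fmul (fun p => dir X (dir Y f) p.1) (pullF f (flatForm gF V))) := by
  have hs := SmoothFun.dir hY h.smooth
  refine (hW.isCov_fmul (smoothVF_liftB hX) (smoothFun_fst hs) (h.isCov_liftB_pullF hW hX
    (h.fibre.metric.isRadAnn_flatForm hV))).congr (fun _ _ => rfl) fun T _ => ?_
  funext p
  have h0 : (0 : FormMap (IB.prod IF) (B × F)) T p = 0 := rfl
  rw [add_form_apply, fmul_apply, fmul_apply, fmul_apply, dir_liftB_fst _ hs, h0, mul_zero,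
    zero_add]

theorem IsWarpedData.isCov_liftF_mixed (h : IsWarpedData gB gF f)
    (hW : IsRadicalStationary (warped gB gF f)) (hU : SmoothVF U) (hY : SmoothVF Y)
    (hV : SmoothVF V) :
    IsCov (warped gB gF f) (liftF B U) (fmul (fun p => dir Y f p.1) (pullF f (flatForm gF V)))
      (fmul (fun p => dir Y f p.1) (fmul (fun p => (-pair gF V U) p.2) (pullB (differential f))
        + pullF f (koszul gF U V))) := by
  have hs := SmoothFun.dir hY h.smooth
  refine (hW.isCov_fmul (smoothVF_liftF hU) (smoothFun_fst hs) (h.isCov_liftF_pullF hW hU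
    (h.fibre.isRadicalStationary.isCov_flatForm hU hV))).congr (fun _ _ => rfl) fun T _ => ?_
  funext p
  rw [add_form_apply, fmul_apply _ (pullF f (flatForm gF V)), dir_liftF_fst _ hs, zero_mul,
    add_zero]
  rfl

theorem IsWarpedData.isCov_liftB_liftF_liftF (h : IsWarpedData gB gF f)
    (hW : IsRadicalStationary (warped gB gF f)) (hX : SmoothVF X) (hU : SmoothVF U)
    (hV : SmoothVF V) {η : FormMap IB B} (hc : IsCov gB X (differential f) η) :
    IsCov (warped gB gF f) (liftB F X) (koszul (warped gB gF f) (liftF B U) (liftF B V))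
      (fmul (fun p => f p.1 * (-pair gF U V) p.2) (pullB η)
        + fmul (fun p => dir X f p.1 * (-pair gF U V) p.2) (pullB (differential f))
        + fmul (fun p => dir X f p.1) (pullF f (koszul gF U V))) := by
  have hf := h.smooth
  have hs := (h.fibre.metric.smooth_pair hU hV).neg
  have hX' := smoothVF_liftB (IF := IF) (F := F) hX
  refine (hW.isCov_add hX' (hW.isCov_fmul hX' (smoothFun_fst_mul_snd hf hs)
    (h.isCov_liftB_pullB hW hX hc)) (hW.isCov_fmul hX' (smoothFun_fst hf)
      (h.isCov_liftB_pullF hW hX (h.fibre.radicalStationary U V hU hV)))).congr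
    (fun _ hT => h.koszul_liftF_liftF hU hV hT) fun T _ => ?_
  funext p
  simp only [add_form_apply, fmul_apply]
  have e1 := dir_liftB_mul (IF := IF) X hf hs p
  have e2 := dir_liftB_fst (IF := IF) (F := F) X hf p
  have e3 : (0 : FormMap (IB.prod IF) (B × F)) T p = 0 := rfl
  change _ = _ + dir _ (fun p : B × F => f p.1 * (-pair gF U V) p.2) p * _ + _
  rw [e1, e2, e3]
  ring

theorem IsWarpedData.isCov_liftF_liftF_liftF (h : IsWarpedData gB gF f)
    (hW : IsRadicalStationary (warped gB gF f)) (hU : SmoothVF U) (hV : SmoothVF V)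
    (hU₁ : SmoothVF U₁) {η : FormMap IF F} (hc : IsCov gF U₁ (koszul gF U V) η) :
    IsCov (warped gB gF f) (liftF B U₁) (koszul (warped gB gF f) (liftF B U) (liftF B V))
      (fmul (fun p => f p.1 * (-pair gF U V) p.2)
          (fmul (fun p => coInner gB (differential f) (differential f) p.1)
            (pullF f (flatForm gF U₁)))
        + fmul (fun p => f p.1 * dir U₁ (-pair gF U V) p.2) (pullB (differential f))
        + fmul (fun p => f p.1) (fmul (fun p => (-koszul gF U V U₁) p.2) (pullB (differential f))
          + pullF f η)) := by
  have hf := h.smooth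
  have hs := (h.fibre.metric.smooth_pair hU hV).neg
  have hU' := smoothVF_liftF (IB := IB) (B := B) hU₁
  refine (hW.isCov_add hU' (hW.isCov_fmul hU' (smoothFun_fst_mul_snd hf hs)
    (h.isCov_liftF_pullB hW hU₁ h.isRadAnn_differential)) (hW.isCov_fmul hU' (smoothFun_fst hf)
      (h.isCov_liftF_pullF hW hU₁ hc))).congr
    (fun _ hT => h.koszul_liftF_liftF hU hV hT) fun T _ => ?_
  funext p
  simp only [add_form_apply, fmul_apply]
  have e1 := dir_liftF_mul (IB := IB) U₁ hf hs p
  have e2 := dir_liftF_fst (IB := IB) (B := B) U₁ hf p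
  change _ = _ + dir _ (fun p : B × F => f p.1 * (-pair gF U V) p.2) p * _ + _
  rw [e1, e2]
  ring

end

/-! ### Semi-regularity -/

/-- Lifts of frames of the two factors form local frames of the product, which leaves eight type
combinations. Semi-regularity of the fibre is needed for second derivatives only when all three
fields come from F. -/
theorem IsWarpedData.isSemiRegular (h : IsWarpedData gB gF f) :
    IsSemiRegular (warped gB gF f) := by
  refine h.metric.isSemiRegular_of_frames fun p₀ => ?_
  obtain ⟨n, eB, cB, UB, hUB, hB⟩ := exists_isFrame IB p₀.1
  obtain ⟨m, eF, cF, UF, hUF, hF⟩ := exists_isFrame IF p₀.2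
  refine ⟨Fin n ⊕ Fin m, inferInstance,
    Sum.elim (fun i => liftB F (eB i)) (fun i => liftF B (eF i)), ?_, ?_, ?_, ?_⟩
  · rintro (i | i)
    · exact smoothVF_liftB (hB.smooth i)
    · exact smoothVF_liftF (hF.smooth i)
  · intro X hX
    refine ⟨Sum.elim (fun i p => cB i p.1 (projB p (X p))) (fun i p => cF i p.2 (projF p (X p))),
      ?_, ?_⟩
    · rintro (i | i)
      · exact (hB.coeff_smooth i).comp (smooth_projB hX)
      · exact (hF.coeff_smooth i).comp (smooth_projF hX)
    · filter_upwards [continuousAt_fst hUB, continuousAt_snd hUF] with p hp1 hp2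
      rw [Fintype.sum_sum_type]
      refine tangent_prod_ext ?_ ?_
      · simpa [liftB_apply, liftF_apply] using hB.sum_eq p.1 hp1 (projB p (X p))
      · simpa [liftB_apply, liftF_apply] using hF.sum_eq p.2 hp2 (projF p (X p))
  · rintro (i | i) (j | j)
    · exact ((h.isRadAnn_koszul_base (hB.smooth i) (hB.smooth j)).pullB gF f).congr
        fun _ hT => h.koszul_liftB_liftB (hB.smooth i) (hB.smooth j) hT
    · exact ((h.isRadAnn_flat (hF.smooth j)).fmul (smoothFun_fst (.dir (hB.smooth i) h.smooth))).congr
        fun _ hT => h.koszul_liftB_liftF (hB.smooth i) (hF.smooth j) hT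
    · exact ((h.isRadAnn_flat (hF.smooth i)).fmul (smoothFun_fst (.dir (hB.smooth j) h.smooth))).congr
        fun _ hT => h.koszul_liftF_liftB (hB.smooth j) (hF.smooth i) hT
    · exact h.isRadAnn_koszul_liftF_liftF (hF.smooth i) (hF.smooth j)
  · intro hW
    have hb := hB.smooth
    have hf := hF.smooth
    rintro (i | i) (j | j) (k | k)
    · obtain ⟨η, hη⟩ := h.nondegenerate.exists_isCov h.base (hb k)
        (h.base.isOneForm_koszul (hb i) (hb j))
      exact ⟨_, h.isCov_liftB_liftB_liftB hW (hb k) (hb i) (hb j) hη⟩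
    · exact ⟨_, h.isCov_liftF_liftB_liftB hW (hf k) (hb i) (hb j)⟩
    · exact ⟨_, (h.isCov_liftB_mixed hW (hb k) (hb i) (hf j)).congr
        (fun _ hT => h.koszul_liftB_liftF (hb i) (hf j) hT) fun _ _ => rfl⟩
    · exact ⟨_, (h.isCov_liftF_mixed hW (hf k) (hb i) (hf j)).congr
        (fun _ hT => h.koszul_liftB_liftF (hb i) (hf j) hT) fun _ _ => rfl⟩
    · exact ⟨_, (h.isCov_liftB_mixed hW (hb k) (hb j) (hf i)).congr
        (fun _ hT => h.koszul_liftF_liftB (hb j) (hf i) hT) fun _ _ => rfl⟩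
    · exact ⟨_, (h.isCov_liftF_mixed hW (hf k) (hb j) (hf i)).congr
        (fun _ hT => h.koszul_liftF_liftB (hb j) (hf i) hT) fun _ _ => rfl⟩
    · obtain ⟨η, hη⟩ := h.nondegenerate.exists_isCov h.base (hb k)
        (isOneForm_differential h.smooth)
      exact ⟨_, h.isCov_liftB_liftF_liftF hW (hb k) (hf i) (hf j) hη⟩
    · obtain ⟨η, hη⟩ := h.fibre.exists_isCov (hf i) (hf j) (hf k)
      exact ⟨_, h.isCov_liftF_liftF_liftF hW (hf i) (hf j) (hf k) hη⟩

end WarpedConnection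

/-! ### Ordinary curvature of the warped product on lifts. -/

section WarpedCurvature

variable {EB : Type*} [NormedAddCommGroup EB] [NormedSpace ℝ EB] [FiniteDimensional ℝ EB]
  {HB : Type*} [TopologicalSpace HB] {IB : ModelWithCorners ℝ EB HB}
  {B : Type*} [TopologicalSpace B] [ChartedSpace HB B] [IsManifold IB ∞ B] [T2Space B]
  {EF : Type*} [NormedAddCommGroup EF] [NormedSpace ℝ EF] [FiniteDimensional ℝ EF]
  {HF : Type*} [TopologicalSpace HF] {IF : ModelWithCorners ℝ EF HF}
  {F : Type*} [TopologicalSpace F] [ChartedSpace HF F] [IsManifold IF ∞ F] [T2Space F]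
  {gB : BilinField IB B} {gF : BilinField IF F} {f : B → ℝ}
  {X Y Z T : VField IB B} {U V W Q : VField IF F}

/-! ### Values of the Koszul form on lifts -/

section Koszul

variable (p : B × F)

theorem IsWarpedData.koszul_BBB (h : IsWarpedData gB gF f) (hX : SmoothVF X) (hY : SmoothVF Y)
    (hZ : SmoothVF Z) :
    koszul (warped gB gF f) (liftB F X) (liftB F Y) (liftB F Z) p = koszul gB X Y Z p.1 := by
  rw [h.koszul_liftB_liftB hX hY (smoothVF_liftB hZ),
    (h.base.isOneForm_koszul hX hY).pullB_liftB hZ]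

theorem IsWarpedData.koszul_BBF (h : IsWarpedData gB gF f) (hX : SmoothVF X) (hY : SmoothVF Y)
    (hQ : SmoothVF Q) :
    koszul (warped gB gF f) (liftB F X) (liftB F Y) (liftF B Q) p = 0 := by
  rw [h.koszul_liftB_liftB hX hY (smoothVF_liftF hQ),
    (h.base.isOneForm_koszul hX hY).pullB_liftF]

theorem IsWarpedData.koszul_BFB (h : IsWarpedData gB gF f) (hX : SmoothVF X) (hV : SmoothVF V)
    (hZ : SmoothVF Z) :
    koszul (warped gB gF f) (liftB F X) (liftF B V) (liftB F Z) p = 0 := by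
  rw [h.koszul_liftB_liftF hX hV (smoothVF_liftB hZ), fmul_apply,
    (h.fibre.metric.isOneForm_flatForm hV).pullF_liftB, mul_zero]

theorem IsWarpedData.koszul_BFF (h : IsWarpedData gB gF f) (hX : SmoothVF X) (hV : SmoothVF V)
    (hQ : SmoothVF Q) :
    koszul (warped gB gF f) (liftB F X) (liftF B V) (liftF B Q) p =
      dir X f p.1 * (f p.1 * pair gF V Q p.2) := by
  rw [h.koszul_liftB_liftF hX hV (smoothVF_liftF hQ), fmul_apply,
    (h.fibre.metric.isOneForm_flatForm hV).pullF_liftF _ hQ]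
  rfl

theorem IsWarpedData.koszul_FBB (h : IsWarpedData gB gF f) (hX : SmoothVF X) (hV : SmoothVF V)
    (hZ : SmoothVF Z) :
    koszul (warped gB gF f) (liftF B V) (liftB F X) (liftB F Z) p = 0 := by
  rw [h.koszul_liftF_liftB hX hV (smoothVF_liftB hZ), fmul_apply,
    (h.fibre.metric.isOneForm_flatForm hV).pullF_liftB, mul_zero]

theorem IsWarpedData.koszul_FBF (h : IsWarpedData gB gF f) (hX : SmoothVF X) (hV : SmoothVF V)
    (hQ : SmoothVF Q) :
    koszul (warped gB gF f) (liftF B V) (liftB F X) (liftF B Q) p =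
      dir X f p.1 * (f p.1 * pair gF V Q p.2) := by
  rw [h.koszul_liftF_liftB hX hV (smoothVF_liftF hQ), fmul_apply,
    (h.fibre.metric.isOneForm_flatForm hV).pullF_liftF _ hQ]
  rfl

theorem IsWarpedData.koszul_FFB (h : IsWarpedData gB gF f) (hU : SmoothVF U) (hV : SmoothVF V)
    (hZ : SmoothVF Z) :
    koszul (warped gB gF f) (liftF B U) (liftF B V) (liftB F Z) p =
      -(f p.1 * dir Z f p.1 * pair gF U V p.2) := by
  rw [h.koszul_liftF_liftF hU hV (smoothVF_liftB hZ), add_form_apply, fmul_apply, fmul_apply,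
    (isOneForm_differential h.smooth).pullB_liftB hZ,
    (h.fibre.metric.isOneForm_koszul hU hV).pullF_liftB]
  simp only [differential, Pi.neg_apply]
  ring

theorem IsWarpedData.koszul_FFF (h : IsWarpedData gB gF f) (hU : SmoothVF U) (hV : SmoothVF V)
    (hQ : SmoothVF Q) :
    koszul (warped gB gF f) (liftF B U) (liftF B V) (liftF B Q) p =
      f p.1 ^ 2 * koszul gF U V Q p.2 := by
  rw [h.koszul_liftF_liftF hU hV (smoothVF_liftF hQ), add_form_apply, fmul_apply, fmul_apply,
    (isOneForm_differential h.smooth).pullB_liftF,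
    (h.fibre.metric.isOneForm_koszul hU hV).pullF_liftF _ hQ]
  ring

theorem IsSingularMetric.koszul_zero_left {g : BilinField IB B} (hg : IsSingularMetric g)
    (hY : SmoothVF Y) (hZ : SmoothVF Z) (b : B) : koszul g 0 Y Z b = 0 :=
  (hg.isTensorAt_koszul hY hZ b).zero

end Koszul

/-! ### The curvature of the warped product on lifts -/

section Curvature

variable (p : B × F)

/-- Evaluation of the curvature through the covariant derivatives of the Koszul form. -/
theorem curvature_eq_of_isCov {g : BilinField IB B} (hg : IsSingularMetric g)
    {η θ : FormMap IB B} (hη : IsCov g X (koszul g Y Z) η) (hθ : IsCov g Y (koszul g X Z) θ)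
    (hT : SmoothVF T) (b : B) : curvature g X Y Z T b =
      η T b - θ T b - koszul g (VectorField.mlieBracket IB X Y) Z T b := by
  rw [curvature, curvatureFor, hη.covDeriv_eq hg hT, hθ.covDeriv_eq hg hT]

theorem IsWarpedData.isCov_liftB_liftB_liftF (h : IsWarpedData gB gF f)
    (hX : SmoothVF X) (hY : SmoothVF Y) (hV : SmoothVF V) :
    IsCov (warped gB gF f) (liftB F X) (koszul (warped gB gF f) (liftB F Y) (liftF B V))
      (fmul (fun p => dir X (dir Y f) p.1) (pullF f (flatForm gF V))) :=
  (h.isCov_liftB_mixed h.isSemiRegular.isRadicalStationary hX hY hV).congr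
    (fun _ hT => h.koszul_liftB_liftF hY hV hT) fun _ _ => rfl

theorem IsWarpedData.isCov_liftB_liftF_liftB (h : IsWarpedData gB gF f)
    (hX : SmoothVF X) (hY : SmoothVF Y) (hV : SmoothVF V) :
    IsCov (warped gB gF f) (liftB F X) (koszul (warped gB gF f) (liftF B V) (liftB F Y))
      (fmul (fun p => dir X (dir Y f) p.1) (pullF f (flatForm gF V))) :=
  (h.isCov_liftB_mixed h.isSemiRegular.isRadicalStationary hX hY hV).congr
    (fun _ hT => h.koszul_liftF_liftB hY hV hT) fun _ _ => rfl

theorem IsWarpedData.isCov_liftF_liftB_liftF (h : IsWarpedData gB gF f)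
    (hU : SmoothVF U) (hY : SmoothVF Y) (hV : SmoothVF V) :
    IsCov (warped gB gF f) (liftF B U) (koszul (warped gB gF f) (liftB F Y) (liftF B V))
      (fmul (fun p => dir Y f p.1) (fmul (fun p => (-pair gF V U) p.2) (pullB (differential f))
        + pullF f (koszul gF U V))) :=
  (h.isCov_liftF_mixed h.isSemiRegular.isRadicalStationary hU hY hV).congr
    (fun _ hT => h.koszul_liftB_liftF hY hV hT) fun _ _ => rfl

theorem IsWarpedData.isCov_liftF_liftF_liftB (h : IsWarpedData gB gF f)
    (hU : SmoothVF U) (hY : SmoothVF Y) (hV : SmoothVF V) :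
    IsCov (warped gB gF f) (liftF B U) (koszul (warped gB gF f) (liftF B V) (liftB F Y))
      (fmul (fun p => dir Y f p.1) (fmul (fun p => (-pair gF V U) p.2) (pullB (differential f))
        + pullF f (koszul gF U V))) :=
  (h.isCov_liftF_mixed h.isSemiRegular.isRadicalStationary hU hY hV).congr
    (fun _ hT => h.koszul_liftF_liftB hY hV hT) fun _ _ => rfl

theorem IsWarpedData.curvature_BBBB (h : IsWarpedData gB gF f) (hX : SmoothVF X)
    (hY : SmoothVF Y) (hZ : SmoothVF Z) (hT : SmoothVF T) :
    curvature (warped gB gF f) (liftB F X) (liftB F Y) (liftB F Z) (liftB F T) p =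
      curvature gB X Y Z T p.1 := by
  have hW := h.isSemiRegular.isRadicalStationary
  obtain ⟨η, hη⟩ := h.nondegenerate.exists_isCov h.base hX (h.base.isOneForm_koszul hY hZ)
  obtain ⟨θ, hθ⟩ := h.nondegenerate.exists_isCov h.base hY (h.base.isOneForm_koszul hX hZ)
  rw [curvature_eq_of_isCov h.metric (h.isCov_liftB_liftB_liftB hW hX hY hZ hη)
    (h.isCov_liftB_liftB_liftB hW hY hX hZ hθ) (smoothVF_liftB hT),
    curvature_eq_of_isCov h.base hη hθ hT, bracket_liftB_liftB hX hY,
    h.koszul_BBB p (hX.mlieBracket hY) hZ hT, hη.target.oneForm.pullB_liftB hT,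
    hθ.target.oneForm.pullB_liftB hT]

theorem IsWarpedData.curvature_BBBF (h : IsWarpedData gB gF f) (hX : SmoothVF X)
    (hY : SmoothVF Y) (hZ : SmoothVF Z) (hQ : SmoothVF Q) :
    curvature (warped gB gF f) (liftB F X) (liftB F Y) (liftB F Z) (liftF B Q) p = 0 := by
  have hW := h.isSemiRegular.isRadicalStationary
  obtain ⟨η, hη⟩ := h.nondegenerate.exists_isCov h.base hX (h.base.isOneForm_koszul hY hZ)
  obtain ⟨θ, hθ⟩ := h.nondegenerate.exists_isCov h.base hY (h.base.isOneForm_koszul hX hZ)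
  rw [curvature_eq_of_isCov h.metric (h.isCov_liftB_liftB_liftB hW hX hY hZ hη)
    (h.isCov_liftB_liftB_liftB hW hY hX hZ hθ) (smoothVF_liftF hQ), bracket_liftB_liftB hX hY,
    h.koszul_BBF p (hX.mlieBracket hY) hZ hQ, hη.target.oneForm.pullB_liftF,
    hθ.target.oneForm.pullB_liftF]
  ring

theorem IsWarpedData.curvature_BFBB (h : IsWarpedData gB gF f) (hZ : SmoothVF Z)
    (hQ : SmoothVF Q) (hX : SmoothVF X) (hY : SmoothVF Y) :
    curvature (warped gB gF f) (liftB F Z) (liftF B Q) (liftB F X) (liftB F Y) p = 0 := by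
  have hW := h.isSemiRegular.isRadicalStationary
  have hq := h.fibre.metric.isOneForm_flatForm hQ
  rw [curvature_eq_of_isCov h.metric (h.isCov_liftB_liftF_liftB hZ hX hQ)
    (h.isCov_liftF_liftB_liftB hW hQ hZ hX) (smoothVF_liftB hY), bracket_liftB_liftF hZ hQ,
    h.metric.koszul_zero_left (smoothVF_liftB hX) (smoothVF_liftB hY), fmul_apply, fmul_apply,
    hq.pullF_liftB]
  ring

/-- The coefficient of f π_F^*W^♭ is XY(f) - YX(f) - [X,Y](f), which is zero. -/
theorem IsWarpedData.curvature_BBFF (h : IsWarpedData gB gF f) (hX : SmoothVF X)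
    (hY : SmoothVF Y) (hW : SmoothVF W) (hQ : SmoothVF Q) :
    curvature (warped gB gF f) (liftB F X) (liftB F Y) (liftF B W) (liftF B Q) p = 0 := by
  have hw := h.fibre.metric.isOneForm_flatForm hW
  rw [curvature_eq_of_isCov h.metric (h.isCov_liftB_liftB_liftF hX hY hW)
    (h.isCov_liftB_liftB_liftF hY hX hW) (smoothVF_liftF hQ), bracket_liftB_liftB hX hY,
    h.koszul_BFF p (hX.mlieBracket hY) hW hQ, fmul_apply, fmul_apply, hw.pullF_liftF _ hQ,
    dir_bracket hX hY h.smooth]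
  simp only [flatForm_apply]
  ring

/-- On a base lift only the df terms survive, with coefficient symmetric in W and Q, so they cancel.
-/
theorem IsWarpedData.curvature_FFBB (h : IsWarpedData gB gF f) (hW : SmoothVF W)
    (hQ : SmoothVF Q) (hX : SmoothVF X) (hY : SmoothVF Y) :
    curvature (warped gB gF f) (liftF B W) (liftF B Q) (liftB F X) (liftB F Y) p = 0 := by
  have hd := isOneForm_differential h.smooth
  rw [curvature_eq_of_isCov h.metric (h.isCov_liftF_liftF_liftB hW hX hQ)
    (h.isCov_liftF_liftF_liftB hQ hX hW) (smoothVF_liftB hY), bracket_liftF_liftF hW hQ,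
    h.koszul_FBB p hX (hW.mlieBracket hQ) hY]
  simp only [fmul_apply, add_form_apply, hd.pullB_liftB hY,
    (h.fibre.metric.isOneForm_koszul hW hQ).pullF_liftB,
    (h.fibre.metric.isOneForm_koszul hQ hW).pullF_liftB, h.fibre.metric.pair_comm W Q]
  ring

/-- The terms X(f)T(f)g_F(V,W) of the two derivatives cancel, and the derivative of df leaves the
Hessian. -/
theorem IsWarpedData.curvature_BFFB (h : IsWarpedData gB gF f) (hX : SmoothVF X)
    (hV : SmoothVF V) (hW : SmoothVF W) (hT : SmoothVF T) :
    curvature (warped gB gF f) (liftB F X) (liftF B V) (liftF B W) (liftB F T) p =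
      -(f p.1 * hessian gB f X T p.1 * pair gF V W p.2) := by
  have hd := isOneForm_differential h.smooth
  obtain ⟨η, hη⟩ := h.nondegenerate.exists_isCov h.base hX hd
  rw [curvature_eq_of_isCov h.metric (h.isCov_liftB_liftF_liftF
    h.isSemiRegular.isRadicalStationary hX hV hW hη)
    (h.isCov_liftF_liftB_liftF hV hX hW) (smoothVF_liftB hT), bracket_liftB_liftF hX hV,
    h.metric.koszul_zero_left (smoothVF_liftF hW) (smoothVF_liftB hT), hessian,
    hη.covDeriv_eq h.base hT]
  simp only [fmul_apply, add_form_apply, hd.pullB_liftB hT, hη.target.oneForm.pullB_liftB hT,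
    (h.fibre.metric.isOneForm_koszul hV hW).pullF_liftB, h.fibre.metric.pair_comm W V,
    Pi.neg_apply]
  ring

/-- The difference K_F(U,V,·) - K_F(V,U,·) is the torsion identity on F and matches the bracket
term. -/
theorem IsWarpedData.curvature_FFBF (h : IsWarpedData gB gF f) (hU : SmoothVF U)
    (hV : SmoothVF V) (hZ : SmoothVF Z) (hQ : SmoothVF Q) :
    curvature (warped gB gF f) (liftF B U) (liftF B V) (liftB F Z) (liftF B Q) p = 0 := by
  have hd := isOneForm_differential h.smooth
  rw [curvature_eq_of_isCov h.metric (h.isCov_liftF_liftF_liftB hU hZ hV)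
    (h.isCov_liftF_liftF_liftB hV hZ hU) (smoothVF_liftF hQ), bracket_liftF_liftF hU hV,
    h.koszul_FBF p hZ (hU.mlieBracket hV) hQ, ← h.fibre.metric.koszul_torsion]
  simp only [fmul_apply, add_form_apply, hd.pullB_liftF,
    (h.fibre.metric.isOneForm_koszul hU hV).pullF_liftF _ hQ,
    (h.fibre.metric.isOneForm_koszul hV hU).pullF_liftF _ hQ]
  ring

theorem IsWarpedData.curvature_BFFF (h : IsWarpedData gB gF f) (hZ : SmoothVF Z)
    (hQ : SmoothVF Q) (hU : SmoothVF U) (hV : SmoothVF V) :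
    curvature (warped gB gF f) (liftB F Z) (liftF B Q) (liftF B U) (liftF B V) p = 0 := by
  have hd := isOneForm_differential h.smooth
  obtain ⟨η, hη⟩ := h.nondegenerate.exists_isCov h.base hZ hd
  rw [curvature_eq_of_isCov h.metric (h.isCov_liftB_liftF_liftF
    h.isSemiRegular.isRadicalStationary hZ hQ hU hη)
    (h.isCov_liftF_liftB_liftF hQ hZ hU) (smoothVF_liftF hV), bracket_liftB_liftF hZ hQ,
    h.metric.koszul_zero_left (smoothVF_liftF hU) (smoothVF_liftF hV)]
  simp only [fmul_apply, add_form_apply, hd.pullB_liftF, hη.target.oneForm.pullB_liftF,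
    (h.fibre.metric.isOneForm_koszul hQ hU).pullF_liftF _ hV]
  ring

/-- The |df|² terms arise from differentiating π_B^*df along the fibre. The remaining df terms
vanish on lifts from F. -/
theorem IsWarpedData.curvature_FFFF (h : IsWarpedData gB gF f) (hU : SmoothVF U)
    (hV : SmoothVF V) (hW : SmoothVF W) (hQ : SmoothVF Q) :
    curvature (warped gB gF f) (liftF B U) (liftF B V) (liftF B W) (liftF B Q) p =
      f p.1 ^ 2 * curvature gF U V W Q p.2
        + f p.1 ^ 2 * coInner gB (differential f) (differential f) p.1
          * (pair gF U W p.2 * pair gF V Q p.2 - pair gF V W p.2 * pair gF U Q p.2) := by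
  have hd := isOneForm_differential h.smooth
  have hr := h.isSemiRegular.isRadicalStationary
  have hm := h.fibre.metric
  obtain ⟨η, hη⟩ := h.fibre.exists_isCov hV hW hU
  obtain ⟨θ, hθ⟩ := h.fibre.exists_isCov hU hW hV
  rw [curvature_eq_of_isCov h.metric (h.isCov_liftF_liftF_liftF hr hV hW hU hη)
    (h.isCov_liftF_liftF_liftF hr hU hW hV hθ) (smoothVF_liftF hQ),
    curvature_eq_of_isCov hm hη hθ hQ, bracket_liftF_liftF hU hV,
    h.koszul_FFF p (hU.mlieBracket hV) hW hQ]
  simp only [fmul_apply, add_form_apply, hd.pullB_liftF, hη.target.oneForm.pullF_liftF _ hQ,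
    hθ.target.oneForm.pullF_liftF _ hQ, (hm.isOneForm_flatForm hU).pullF_liftF _ hQ,
    (hm.isOneForm_flatForm hV).pullF_liftF _ hQ, flatForm_apply, Pi.neg_apply]
  ring

end Curvature

end WarpedCurvature

end SingularGeometry

end

/-! ### The semi-symmetric curvature formulas. -/

open SingularGeometry in
theorem theorem2p18
    {EB : Type*} [NormedAddCommGroup EB] [NormedSpace ℝ EB] [FiniteDimensional ℝ EB]
    {EF : Type*} [NormedAddCommGroup EF] [NormedSpace ℝ EF] [FiniteDimensional ℝ EF]
    {B : Type*} [TopologicalSpace B] [ChartedSpace EB B] [IsManifold 𝓘(ℝ, EB) ∞ B] [T2Space B]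
    {F : Type*} [TopologicalSpace F] [ChartedSpace EF F] [IsManifold 𝓘(ℝ, EF) ∞ F] [T2Space F]
    (gB : BilinField 𝓘(ℝ, EB) B) (hgB : IsSingularMetric gB) (hndB : IsNondegenerate gB)
    (gF : BilinField 𝓘(ℝ, EF) F) (hgF : IsSemiRegular gF)
    (f : B → ℝ) (hf : SmoothFun 𝓘(ℝ, EB) f) :
    IsSemiRegular (warped gB gF f) ∧
    ∀ P : VField 𝓘(ℝ, EF) F, SmoothVF P →
      -- `g` is also semi-regular for the semi-symmetric metric covariant derivative, so that
      -- its curvature is defined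
      IsSemiRegularSS (warped gB gF f) (liftF B P) ∧
      ∀ X Y Z T : VField 𝓘(ℝ, EB) B, SmoothVF X → SmoothVF Y → SmoothVF Z → SmoothVF T →
      ∀ U V W Q : VField 𝓘(ℝ, EF) F, SmoothVF U → SmoothVF V → SmoothVF W → SmoothVF Q →
      ∀ (b : B) (q : F),
        -- (1)
        warpedCurvatureSS gB gF f P (liftB F X) (liftB F Y) (liftB F Z) (liftB F T) (b, q) =
            curvature gB X Y Z T b
            + f b ^ 2 * pair gB X Z b * pair gF P P q * pair gB Y T b
            - f b ^ 2 * pair gB Y Z b * pair gF P P q * pair gB X T b ∧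
        -- (2)
        (warpedCurvatureSS gB gF f P (liftB F X) (liftB F Y) (liftB F Z) (liftF B Q) (b, q) =
            - warpedCurvatureSS gB gF f P (liftB F Z) (liftF B Q) (liftB F X) (liftB F Y) (b, q) ∧
          warpedCurvatureSS gB gF f P (liftB F X) (liftB F Y) (liftB F Z) (liftF B Q) (b, q) =
            - f b * dir X f b * pair gB Y Z b * pair gF P Q q
            + f b * dir Y f b * pair gB X Z b * pair gF P Q q) ∧
        -- (3)
        (warpedCurvatureSS gB gF f P (liftB F X) (liftB F Y) (liftF B W) (liftF B Q) (b, q) = 0 ∧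
          warpedCurvatureSS gB gF f P (liftF B W) (liftF B Q) (liftB F X) (liftB F Y) (b, q) = 0) ∧
        -- (4)
        warpedCurvatureSS gB gF f P (liftB F X) (liftF B V) (liftF B W) (liftB F T) (b, q) =
            - f b * hessian gB f X T b * pair gF V W q
            - (koszul gF V P W q + f b ^ 2 * pair gF P P q * pair gF V W q
                - f b ^ 2 * pair gF V P q * pair gF P W q) * f b ^ 2 * pair gB X T b ∧
        -- (5)
        (warpedCurvatureSS gB gF f P (liftF B U) (liftF B V) (liftB F Z) (liftF B Q) (b, q) =
            - warpedCurvatureSS gB gF f P (liftB F Z) (liftF B Q) (liftF B U) (liftF B V) (b, q) ∧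
          warpedCurvatureSS gB gF f P (liftF B U) (liftF B V) (liftB F Z) (liftF B Q) (b, q) =
            f b ^ 3 * dir Z f b * (- pair gF P U q * pair gF Q V q + pair gF P V q * pair gF Q U q)) ∧
        -- (6)
        warpedCurvatureSS gB gF f P (liftF B U) (liftF B V) (liftF B W) (liftF B Q) (b, q) =
            f b ^ 2 * curvature gF U V W Q q
            + f b ^ 2 * coInner gB (differential f) (differential f) b
              * (pair gF U W q * pair gF V Q q - pair gF V W q * pair gF U Q q)
            - f b ^ 6 * pair gF V P q * pair gF U W q * pair gF P Q q
            + f b ^ 6 * pair gF U P q * pair gF V W q * pair gF P Q q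
            + f b ^ 4 * koszul gF U P W q * pair gF V Q q
            - f b ^ 4 * koszul gF V P W q * pair gF U Q q
            - f b ^ 4 * koszul gF U P Q q * pair gF V W q
            + f b ^ 4 * koszul gF V P Q q * pair gF U W q
            + f b ^ 6 * pair gF P P q * pair gF U W q * pair gF V Q q
            - f b ^ 6 * pair gF U P q * pair gF P W q * pair gF V Q q
            - f b ^ 6 * pair gF P P q * pair gF V W q * pair gF U Q q
            + f b ^ 6 * pair gF V P q * pair gF P W q * pair gF U Q q := by
  have h : IsWarpedData gB gF f := ⟨hgB, hndB, hgF, hf⟩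
  have hW := h.isSemiRegular
  refine ⟨hW, fun P hP => ⟨hW.isSemiRegularSS (smoothVF_liftF hP), ?_⟩⟩
  intro X Y Z T hX hY hZ hT U V W Q hU hV hW' hQ b q
  have hP' : SmoothVF (liftF B P : VField (𝓘(ℝ, EB).prod 𝓘(ℝ, EF)) (B × F)) := smoothVF_liftF hP
  have bX := smoothVF_liftB (IF := 𝓘(ℝ, EF)) (F := F) hX
  have bY := smoothVF_liftB (IF := 𝓘(ℝ, EF)) (F := F) hY
  have bZ := smoothVF_liftB (IF := 𝓘(ℝ, EF)) (F := F) hZ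
  have bT := smoothVF_liftB (IF := 𝓘(ℝ, EF)) (F := F) hT
  have fU := smoothVF_liftF (IB := 𝓘(ℝ, EB)) (B := B) hU
  have fV := smoothVF_liftF (IB := 𝓘(ℝ, EB)) (B := B) hV
  have fW := smoothVF_liftF (IB := 𝓘(ℝ, EB)) (B := B) hW'
  have fQ := smoothVF_liftF (IB := 𝓘(ℝ, EB)) (B := B) hQ
  have c := h.fibre.metric.pair_comm
  have d := h.base.pair_comm
  have hFF := pair_liftF_liftF (gB := gB) gF f
  have hBB := pair_liftB_liftB (gB := gB) gF f
  have hBF := pair_liftB_liftF (gB := gB) gF f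
  have hFB := pair_liftF_liftB (gB := gB) gF f
  -- Pair symmetry is not available for the semi-symmetric curvature, and here the sign is in fact
  -- opposite; both orders are therefore evaluated separately.
  have hXYZQ : warpedCurvatureSS gB gF f P (liftB F X) (liftB F Y) (liftB F Z) (liftF B Q) (b, q) =
      - f b * dir X f b * pair gB Y Z b * pair gF P Q q
      + f b * dir Y f b * pair gB X Z b * pair gF P Q q := by
    rw [warpedCurvatureSS, hW.curvatureSS_eq hP' bX bY bZ fQ, h.curvature_BBBF _ hX hY hZ hQ,
      h.koszul_BFB _ hX hP hZ, h.koszul_BFB _ hY hP hZ, h.koszul_BFF _ hX hP hQ,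
      h.koszul_BFF _ hY hP hQ]
    simp only [hBB, hBF, hFB, hFF]
    ring
  -- The opposite sign comes from K(Q,P,X) = -K(X,P,Q) on lifts, as the metric vanishes between the
  -- factors.
  have hZQXY : warpedCurvatureSS gB gF f P (liftB F Z) (liftF B Q) (liftB F X) (liftB F Y) (b, q) =
      - (- f b * dir X f b * pair gB Y Z b * pair gF P Q q
        + f b * dir Y f b * pair gB X Z b * pair gF P Q q) := by
    rw [warpedCurvatureSS, hW.curvatureSS_eq hP' bZ fQ bX bY, h.curvature_BFBB _ hZ hQ hX hY,
      h.koszul_BFB _ hZ hP hX, h.koszul_FFB _ hQ hP hX, h.koszul_BFB _ hZ hP hY,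
      h.koszul_FFB _ hQ hP hY]
    simp only [hBB, hBF, hFB, hFF, c Q P, d Z X, d Z Y]
    ring
  have hUVZQ : warpedCurvatureSS gB gF f P (liftF B U) (liftF B V) (liftB F Z) (liftF B Q) (b, q) =
      f b ^ 3 * dir Z f b * (- pair gF P U q * pair gF Q V q + pair gF P V q * pair gF Q U q) := by
    rw [warpedCurvatureSS, hW.curvatureSS_eq hP' fU fV bZ fQ, h.curvature_FFBF _ hU hV hZ hQ,
      h.koszul_FFB _ hU hP hZ, h.koszul_FFB _ hV hP hZ]
    simp only [hBF, hFB, hFF, c U P, c V P, c Q U, c Q V]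
    ring
  have hZQUV : warpedCurvatureSS gB gF f P (liftB F Z) (liftF B Q) (liftF B U) (liftF B V) (b, q) =
      - (f b ^ 3 * dir Z f b
        * (- pair gF P U q * pair gF Q V q + pair gF P V q * pair gF Q U q)) := by
    rw [warpedCurvatureSS, hW.curvatureSS_eq hP' bZ fQ fU fV, h.curvature_BFFF _ hZ hQ hU hV,
      h.koszul_BFF _ hZ hP hU, h.koszul_BFF _ hZ hP hV]
    simp only [hBF, hFB, hFF]
    ring
  refine ⟨?_, ⟨by rw [hXYZQ, hZQXY, neg_neg], hXYZQ⟩, ⟨?_, ?_⟩, ?_,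
    ⟨by rw [hUVZQ, hZQUV, neg_neg], hUVZQ⟩, ?_⟩
  · rw [warpedCurvatureSS, hW.curvatureSS_eq hP' bX bY bZ bT, h.curvature_BBBB _ hX hY hZ hT,
      h.koszul_BFB _ hX hP hZ, h.koszul_BFB _ hY hP hZ, h.koszul_BFB _ hX hP hT,
      h.koszul_BFB _ hY hP hT]
    simp only [hBB, hBF, hFB, hFF]
    ring
  · rw [warpedCurvatureSS, hW.curvatureSS_eq hP' bX bY fW fQ, h.curvature_BBFF _ hX hY hW' hQ]
    simp only [hBF, hFB, hFF]
    ring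
  · rw [warpedCurvatureSS, hW.curvatureSS_eq hP' fW fQ bX bY, h.curvature_FFBB _ hW' hQ hX hY]
    simp only [hBF, hFB, hFF]
    ring
  -- Besides the Hessian term, only those with the factor g(X,T) survive; K(V,P,W) = f² K_F(V,P,W)
  -- supplies the f² in front of the bracket.
  · rw [warpedCurvatureSS, hW.curvatureSS_eq hP' bX fV fW bT, h.curvature_BFFB _ hX hV hW' hT,
      h.koszul_FFF _ hV hP hW', h.koszul_BFB _ hX hP hT]
    simp only [hBB, hBF, hFB, hFF, c W P]
    ring
  · rw [warpedCurvatureSS, hW.curvatureSS_eq hP' fU fV fW fQ, h.curvature_FFFF _ hU hV hW' hQ,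
      h.koszul_FFF _ hU hP hW', h.koszul_FFF _ hV hP hW', h.koszul_FFF _ hU hP hQ,
      h.koszul_FFF _ hV hP hQ]
    simp only [hFF, c W P, c U P, c V P]
    ring
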